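/- **Theorem (characterization of $\Delta_2(<,<_{\mathrm{lex}})$).** Let $A$ be a finite alphabet and let $L$ be a forest language over $A$, i.e. a set of finite, ordered, unranked forests with nodes labelled by $A$ (the empty forest $0$ included). Then $L$ is definable in $\Delta_2(<,<_{\mathrm{lex}})$ if and only if its syntactic forest algebra $(H_L,V_L)$ is finite (i.e. $L$ is regular) and satisfies the $\Delta_2$ identity $$v^\omega\, w\, v^\omega = v^\omega\qquad\text{for all } v,w\in V_L \text{ with } w\preceq v .$$ *Logic.* A forest is a relational structure whose domain is its set of nodes (empty for the forest $0$), with a unary predicate $P_a$ for each $a\in A$, the strict ancestor relation $<$, and the lexicographic order: $x<_{\mathrm{lex}}y$ iff $x<y$ or there are $x'\le x$, $y'\le y$ such that $x'$ is a sibling to the left of $y'$ (roots of the forest count as siblings). A $\Sigma_2$ sentence is a finite combination, by disjunction and conjunction, of sentences $\exists x_1\cdots x_n\,\forall y_1\cdots y_m\ \gamma$ ($n,m\ge 0$) with $\gamma$ quantifier-free; on nonempty forests it is equivalent to a single such sentence. A $\Pi_2$ sentence is the negation of a $\Sigma_2$ sentence. $L$ is definable in $\Delta_2(<,<_{\mathrm{lex}})$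 if it is defined by a $\Sigma_2$ sentence and also by a $\Pi_2$ sentence over this signature. *Algebra.* A context is a forest in which exactly one leaf is a hole $\Box$; $ps$ (resp. $pq$) is the result of substituting the forest $s$ (resp. the context $q$) for the hole of $p$. A forest algebra $(H,V)$ consists of a monoid $(H,+,0)$ and a monoid $V$ with a faithful monoidal left action of $V$ on $H$ and, for every $g\in H$, elements $\Box+g,\ g+\Box\in V$ with $(\Box+g)h=h+g$ and $(g+\Box)h=g+h$. A morphism is a pair of monoid morphisms compatible with the action and with the operations $g\mapsto\Box+g$, $g\mapsto g+\Box$. The forests and contexts over an alphabet $B$ form the free forest algebra $B^\Delta$. The syntactic forest algebra $(H_L,V_L)$ is the quotient of $A^\Delta$ by: $s\sim_L s'$ iff for all contexts $p$, $ps\in L\Leftrightarrow ps'\in L$; and $p\sim_L p'$ iff $ps\sim_L p's$ for all forests $s$. The number $\omega\ge 1$ is such that $v^\omega$ is idempotent for all $v\in V_L$. *Pieces.* A context $p$ is a piece of a context $q$, written $p\preceq q$, if $p$ is obtained from $q$ by removing finitely many (possibly zero) nodes other than the hole, the children of a removed node taking its place. For $v,w$ in $V$, where $(H,V)$ is a forest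 algebra, $w\preceq v$ means that there are a finite alphabet $B$, a morphism $\alpha:B^\Delta\to(H,V)$ and contexts $p\preceq q$ over $B$ with $\alpha(p)=w$ and $\alpha(q)=v$. -/

import Mathlib

universe u v w x y

namespace ForestLogic

/-! ### Forests and contexts -/

/-- Finite ordered unranked forests over `A`: a forest is either the empty forest `nil`, or
`cons a s t`, the tree `a s` (root label `a`, forest of children `s`) followed by the forest `t`. -/
inductive Forest (A : Type u) : Type u
  | nil : Forest A
  | cons (a : A) (s t : Forest A) : Forest A

namespace Forest

variable {A : Type u}

/-- Concatenation of forests. -/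
def append : Forest A → Forest A → Forest A
  | nil, u => u
  | cons a s t, u => cons a s (append t u)

instance : Add (Forest A) := ⟨append⟩
instance : Zero (Forest A) := ⟨nil⟩

@[simp] theorem nil_eq_zero : (nil : Forest A) = 0 := rfl
@[simp] theorem nil_add (u : Forest A) : nil + u = u := rfl
@[simp] theorem cons_add (a : A) (s t u : Forest A) : cons a s t + u = cons a s (t + u) := rfl

instance : AddMonoid (Forest A) where
  zero_add _ := rfl
  add_zero s := by
    induction s with
    | nil => rfl
    | cons a s t _ ih => exact congrArg (cons a s) ih
  add_assoc s t u := by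
    induction s with
    | nil => rfl
    | cons a s t' _ ih => exact congrArg (cons a s) ih
  nsmul := nsmulRec

/-- The forest with the single tree `a s`. -/
def tree (a : A) (s : Forest A) : Forest A := cons a s 0

end Forest

/-- Contexts over `A`, i.e. forests in which exactly one leaf is the hole. The topmost level is
either `l + □ + r` (`hole l r`) or `l + a p + r` (`node l a p r`) with `p` again a context. -/
inductive Context (A : Type u) : Type u
  | hole (l r : Forest A) : Context A
  | node (l : Forest A) (a : A) (p : Context A) (r : Forest A) : Context A

namespace Context

variable {A : Type u}

/-- `p.fill s` is `p s`: the forest `s` substituted for the hole of `p`. -/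
def fill : Context A → Forest A → Forest A
  | hole l r, s => l + s + r
  | node l a p r, s => l + Forest.tree a (fill p s) + r

/-- `p.comp q` is `p q`: the context `q` substituted for the hole of `p`. -/
def comp : Context A → Context A → Context A
  | hole l r, hole l' r' => hole (l + l') (r' + r)
  | hole l r, node l' a p r' => node (l + l') a p (r' + r)
  | node l a p r, q => node l a (comp p q) r

instance : One (Context A) := ⟨hole 0 0⟩
instance : Mul (Context A) := ⟨comp⟩

theorem one_def : (1 : Context A) = hole 0 0 := rfl
theorem hole_mul_hole (l r l' r' : Forest A) :
    hole l r * hole l' r' = hole (l + l') (r' + r) := rfl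
theorem hole_mul_node (l r l' r' : Forest A) (a : A) (p : Context A) :
    hole l r * node l' a p r' = node (l + l') a p (r' + r) := rfl
theorem node_mul (l r : Forest A) (a : A) (p q : Context A) :
    node l a p r * q = node l a (p * q) r := by
  cases q <;> rfl

instance : Monoid (Context A) where
  one_mul p := by
    cases p <;> simp [one_def, hole_mul_hole, hole_mul_node]
  mul_one p := by
    induction p with
    | hole l r => simp [one_def, hole_mul_hole]
    | node l a p r ih => rw [node_mul, ih]
  mul_assoc p q r := by
    induction p with
    | hole l r' =>
      cases q with
      | hole l1 r1 => cases r <;> simp [hole_mul_hole, hole_mul_node, add_assoc]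
      | node l1 a1 q r1 => simp only [hole_mul_node, node_mul]
    | node l a p r' ih => simp only [node_mul, ih]

instance : SMul (Context A) (Forest A) := ⟨fill⟩

theorem hole_smul (l r s : Forest A) : hole l r • s = l + s + r := rfl
theorem node_smul (l r s : Forest A) (a : A) (p : Context A) :
    node l a p r • s = l + Forest.tree a (p • s) + r := rfl

instance : MulAction (Context A) (Forest A) where
  one_smul s := by simp [one_def, hole_smul]
  mul_smul p q s := by
    induction p with
    | hole l r =>
      cases q <;> simp [hole_mul_hole, hole_mul_node, hole_smul, node_smul, add_assoc]
    | node l a p r ih => simp only [node_mul, node_smul, ih]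

/-- The context `a □`. -/
def letter (a : A) : Context A := node 0 a 1 0

/-- The context `s + □`. -/
def leftOf (s : Forest A) : Context A := hole s 0

/-- The context `□ + s`. -/
def rightOf (s : Forest A) : Context A := hole 0 s

end Context

/-! ### Pieces of forests and contexts -/

/-- `s` is an immediate piece of `s'`: `s = p t` and `s' = p a t`, i.e. one node is removed. -/
def Forest.IsImmediatePiece {A : Type u} (s s' : Forest A) : Prop :=
  ∃ (p : Context A) (a : A) (t : Forest A), s = p • t ∧ s' = (p * Context.letter a) • t

/-- One context is obtained from the other by removing one node: either an ancestor of the hole,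
or a node of a forest `s'` standing to the left or to the right of the path to the hole. -/
inductive Context.IsImmediatePiece {A : Type u} : Context A → Context A → Prop
  | path (p q : Context A) (a : A) :
      IsImmediatePiece (p * q) (p * Context.letter a * q)
  | left (p q : Context A) {s s' : Forest A} (h : s.IsImmediatePiece s') :
      IsImmediatePiece (p * Context.leftOf s * q) (p * Context.leftOf s' * q)
  | right (p q : Context A) {s s' : Forest A} (h : s.IsImmediatePiece s') :
      IsImmediatePiece (p * Context.rightOf s * q) (p * Context.rightOf s' * q)

/-- The piece relation on contexts. -/
def Context.IsPiece {A : Type u} (p q : Context A) : Prop :=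
  Relation.ReflTransGen Context.IsImmediatePiece p q

/-! ### Forest algebras -/

/-- Forest algebras `(H, V)`: the monoid `V` acts faithfully on the monoid `H`, and `V` contains
for every `g : H` the elements `g + □` (`leftOf g`) and `□ + g` (`rightOf g`).
Finiteness is not part of this definition, so that the free forest algebra is an instance. -/
class ForestAlgebra (H : Type v) (V : Type w) [AddMonoid H] [Monoid V]
    extends MulAction V H, FaithfulSMul V H where
  leftOf : H → V
  rightOf : H → V
  leftOf_smul : ∀ g h : H, leftOf g • h = g + h
  rightOf_smul : ∀ g h : H, rightOf g • h = h + g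

/-- Morphisms of forest algebras: pairs of monoid morphisms compatible with the action and with
the operations `g ↦ g + □` and `g ↦ □ + g`. -/
structure ForestAlgebraHom (H₁ : Type v) (V₁ : Type w) (H₂ : Type x) (V₂ : Type y)
    [AddMonoid H₁] [Monoid V₁] [ForestAlgebra H₁ V₁]
    [AddMonoid H₂] [Monoid V₂] [ForestAlgebra H₂ V₂] where
  onForests : H₁ →+ H₂
  onContexts : V₁ →* V₂
  map_smul : ∀ (p : V₁) (h : H₁), onForests (p • h) = onContexts p • onForests h
  map_leftOf : ∀ g : H₁,
    onContexts (ForestAlgebra.leftOf g) = ForestAlgebra.leftOf (onForests g)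
  map_rightOf : ∀ g : H₁,
    onContexts (ForestAlgebra.rightOf g) = ForestAlgebra.rightOf (onForests g)

/-! ### The free forest algebra -/

section Free

variable {A : Type u}

/-- Number of nodes (used only to show that the action of contexts on forests is faithful). -/
def Forest.size : Forest A → ℕ
  | .nil => 0
  | .cons _ s t => s.size + 1 + t.size

/-- Number of nodes of a context other than the hole. -/
def Context.size : Context A → ℕ
  | .hole l r => l.size + r.size
  | .node l _ p r => l.size + 1 + p.size + r.size

theorem Forest.size_add (s t : Forest A) : (s + t).size = s.size + t.size := by
  induction s with
  | nil => simp [Forest.size]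
  | cons a s u _ ih => simp only [Forest.cons_add, Forest.size, ih]; omega

theorem Context.size_smul (p : Context A) (s : Forest A) :
    (p • s).size = p.size + s.size := by
  induction p with
  | hole l r => simp only [Context.hole_smul, Forest.size_add, Context.size]; omega
  | node l a p r ih =>
    simp only [Context.node_smul, Forest.size_add, Context.size, Forest.tree, Forest.size, ih,
      ← Forest.nil_eq_zero]
    omega

theorem Forest.eq_of_big_tree {a b : A} {X Y : Forest A} :
    ∀ {l l' r r' : Forest A}, l'.size ≤ X.size → r'.size ≤ X.size → l.size ≤ Y.size →
      l + Forest.tree a X + r = l' + Forest.tree b Y + r' → l = l' ∧ a = b ∧ X = Y ∧ r = r'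
  | .nil, .nil, r, r', _, _, _, h => by
    simpa [Forest.tree, ← Forest.nil_eq_zero] using h
  | .nil, .cons c s t, r, r', h1, _, _, h => by
    simp only [Forest.nil_add, Forest.tree, Forest.cons_add, Forest.cons.injEq] at h
    have := h.2.1
    subst this
    simp only [Forest.size] at h1
    omega
  | .cons c s t, .nil, r, r', _, _, h3, h => by
    simp only [Forest.nil_add, Forest.tree, Forest.cons_add, Forest.cons.injEq] at h
    have := h.2.1
    subst this
    simp only [Forest.size] at h3
    omega
  | .cons c s t, .cons c' s' t', r, r', h1, h2, h3, h => by
    simp only [Forest.cons_add, Forest.cons.injEq] at h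
    simp only [Forest.size] at h1 h3
    obtain ⟨e1, e2, e3, e4⟩ :=
      Forest.eq_of_big_tree (l := t) (l' := t') (by omega) h2 (by omega) h.2.2
    exact ⟨by rw [h.1, h.2.1, e1], e2, e3, e4⟩

theorem Context.eq_of_big_tree (a : A) (C : Forest A) :
    ∀ p q : Context A, p.size ≤ C.size → q.size ≤ C.size →
      p • Forest.tree a C = q • Forest.tree a C → p = q
  | .hole l r, .hole l' r', hp, hq, h => by
    simp only [Context.hole_smul] at h
    simp only [Context.size] at hp hq
    obtain ⟨e1, -, -, e2⟩ := Forest.eq_of_big_tree (by omega) (by omega) (by omega) h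
    rw [e1, e2]
  | .hole l r, .node l' b q r', hp, hq, h => by
    simp only [Context.hole_smul, Context.node_smul] at h
    have hs := congrArg Forest.size (Forest.eq_of_big_tree
      (by simp only [Context.size] at hq; omega)
      (by simp only [Context.size] at hq; omega)
      (by
        simp only [Context.size] at hp
        rw [Context.size_smul]
        simp only [Forest.tree, Forest.size]
        omega) h).2.2.1
    rw [Context.size_smul] at hs
    simp only [Forest.tree, Forest.size] at hs
    omega
  | .node l b p r, .hole l' r', hp, hq, h => by
    simp only [Context.hole_smul, Context.node_smul] at h
    have hs := congrArg Forest.size (Forest.eq_of_big_tree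
      (by simp only [Context.size] at hp; omega)
      (by simp only [Context.size] at hp; omega)
      (by
        simp only [Context.size] at hq
        rw [Context.size_smul]
        simp only [Forest.tree, Forest.size]
        omega) h.symm).2.2.1
    rw [Context.size_smul] at hs
    simp only [Forest.tree, Forest.size] at hs
    omega
  | .node l b p r, .node l' b' q r', hp, hq, h => by
    simp only [Context.node_smul] at h
    simp only [Context.size] at hp hq
    have hb : ∀ p' : Context A, C.size ≤ (p' • Forest.tree a C).size := fun p' => by
      rw [Context.size_smul]
      simp only [Forest.tree, Forest.size]
      omega
    have h1 := hb p
    have h2 := hb q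
    obtain ⟨e1, e2, e3, e4⟩ := Forest.eq_of_big_tree (by omega) (by omega) (by omega) h
    rw [e1, e2, e4, Context.eq_of_big_tree a C p q (by omega) (by omega) e3]

theorem Forest.exists_size_ge (a : A) (n : ℕ) : ∃ s : Forest A, n ≤ s.size := by
  induction n with
  | zero => exact ⟨0, Nat.zero_le _⟩
  | succ n ih =>
    obtain ⟨s, hs⟩ := ih
    refine ⟨Forest.cons a s 0, ?_⟩
    simp only [Forest.size]
    omega

theorem Context.eq_of_smul_eq (p q : Context A)
    (h : ∀ s : Forest A, p • s = q • s) : p = q := by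
  rcases isEmpty_or_nonempty A with hA | ⟨⟨a⟩⟩
  · have hF : ∀ s t : Forest A, s = t := by
      intro s t
      cases s with
      | nil => cases t with
        | nil => rfl
        | cons a _ _ => exact hA.elim a
      | cons a _ _ => exact hA.elim a
    cases p with
    | hole l r => cases q with
      | hole l' r' => rw [hF l l', hF r r']
      | node _ a _ _ => exact hA.elim a
    | node _ a _ _ => exact hA.elim a
  · obtain ⟨C, hC⟩ := Forest.exists_size_ge a (p.size + q.size)
    exact Context.eq_of_big_tree a C p q (by omega) (by omega) (h _)

/-- The free forest algebra `(H_A, V_A)` of all forests and all contexts over `A`. -/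
instance : ForestAlgebra (Forest A) (Context A) where
  eq_of_smul_eq_smul {p q} h := Context.eq_of_smul_eq p q h
  leftOf := Context.leftOf
  rightOf := Context.rightOf
  leftOf_smul g h := by simp [Context.leftOf, Context.hole_smul]
  rightOf_smul g h := by simp [Context.rightOf, Context.hole_smul]

end Free

/-! ### The piece relation and the identity in a forest algebra -/

section Identity

variable (H : Type v) (V : Type w) [AddMonoid H] [Monoid V] [ForestAlgebra H V]

/-- The piece relation on context types: `v` is a piece of `w` if, for some finite alphabet `A`
and some morphism from the free forest algebra over `A` to `(H, V)`, there are contexts `p`, `q`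
over `A` of types `v`, `w` such that `p` is a piece of `q`. -/
def IsPieceType (v w : V) : Prop :=
  ∃ (A : Type) (_ : Finite A) (α : ForestAlgebraHom (Forest A) (Context A) H V)
    (p q : Context A), p.IsPiece q ∧ α.onContexts p = v ∧ α.onContexts q = w

/-- `n` is an admissible value of `ω` for the monoid `M`: a positive number such that all `n`-th
powers are idempotent. (Any two admissible `n` give the same power `m ^ n`.) -/
def IsOmega (M : Type w) [Monoid M] (n : ℕ) : Prop :=
  0 < n ∧ ∀ m : M, IsIdempotentElem (m ^ n)

theorem exists_isOmega (M : Type w) [Monoid M] [Finite M] : ∃ n, IsOmega M n := by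
  have key : ∀ m : M, ∃ n, 0 < n ∧ IsIdempotentElem (m ^ n) := by
    intro m
    obtain ⟨i, j, hij, h⟩ : ∃ i j : ℕ, i < j ∧ m ^ i = m ^ j := by
      obtain ⟨i, j, hne, h⟩ := Finite.exists_ne_map_eq_of_infinite (fun k : ℕ => m ^ k)
      rcases lt_or_gt_of_ne hne with hlt | hlt
      · exact ⟨i, j, hlt, h⟩
      · exact ⟨j, i, hlt, h.symm⟩
    obtain ⟨d, rfl⟩ : ∃ d, j = i + d := ⟨j - i, by omega⟩
    have step : ∀ k c, m ^ (i + c) = m ^ (i + c + k * d) := by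
      intro k c
      induction k with
      | zero => simp
      | succ k ih =>
        rw [ih, show i + c + k * d = i + (c + k * d) by ring, pow_add, h, ← pow_add]
        congr 1
        ring
    refine ⟨(i + 1) * d, Nat.mul_pos (by omega) (by omega), ?_⟩
    obtain ⟨c, hc⟩ : ∃ c, (i + 1) * d = i + c := by
      refine ⟨(i + 1) * d - i, ?_⟩
      have : i + 1 ≤ (i + 1) * d := Nat.le_mul_of_pos_right _ (by omega)
      omega
    have h2 := step (i + 1) c
    rw [← hc] at h2
    change m ^ _ * m ^ _ = m ^ _
    rw [← pow_add, ← h2]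
  choose f hf hi using key
  have := Fintype.ofFinite M
  refine ⟨∏ m : M, f m, Finset.prod_pos fun m _ => hf m, fun m => ?_⟩
  obtain ⟨k, hk⟩ := Finset.dvd_prod_of_mem f (Finset.mem_univ m)
  rw [hk, pow_mul]
  exact (hi m).pow k

theorem IsOmega.pow_eq {M : Type w} [Monoid M] {n k : ℕ} (hn : IsOmega M n) (hk : IsOmega M k)
    (m : M) : m ^ n = m ^ k := by
  rw [← (hn.2 m).pow_eq hk.1.ne', ← (hk.2 m).pow_eq hn.1.ne', ← pow_mul, ← pow_mul, mul_comm]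

/-- The `Δ₂` identity: `v ^ ω * w * v ^ ω = v ^ ω` whenever `w` is a piece of `v`. -/
def SatisfiesDeltaTwoIdentity : Prop :=
  ∃ n : ℕ, IsOmega V n ∧ ∀ v w : V, IsPieceType H V w v → v ^ n * w * v ^ n = v ^ n

end Identity

/-! ### The syntactic forest algebra -/

section Syntactic

variable {A : Type u} (L : Set (Forest A))

/-- The syntactic congruence on forests. -/
def forestCon : AddCon (Forest A) where
  r s s' := ∀ p : Context A, p • s ∈ L ↔ p • s' ∈ L
  iseqv := ⟨fun _ _ => Iff.rfl, fun h p => (h p).symm, fun h h' p => (h p).trans (h' p)⟩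
  add' {s s' t t'} h h' p := by
    have h1 := h (p * Context.rightOf t)
    have h2 := h' (p * Context.leftOf s')
    simp only [mul_smul, Context.rightOf, Context.leftOf, Context.hole_smul, zero_add,
      add_zero] at h1 h2
    exact h1.trans h2

/-- The syntactic congruence on contexts. -/
def contextCon : Con (Context A) where
  r p p' := ∀ s : Forest A, forestCon L (p • s) (p' • s)
  iseqv := ⟨fun _ _ => (forestCon L).refl _, fun h s => (forestCon L).symm (h s),
    fun h h' s => (forestCon L).trans (h s) (h' s)⟩
  mul' {p p' q q'} h h' s := by
    have h1 : forestCon L ((p * q) • s) ((p * q') • s) := fun r => by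
      have := h' s (r * p)
      simpa only [mul_smul] using this
    have h2 : forestCon L ((p * q') • s) ((p' * q') • s) := by
      simpa only [mul_smul] using h (q' • s)
    exact (forestCon L).trans h1 h2

/-- The monoid `H_L` of forest types. -/
abbrev ForestType : Type u := (forestCon L).Quotient

/-- The monoid `V_L` of context types. -/
abbrev ContextType : Type u := (contextCon L).Quotient

/-- The syntactic forest algebra `(H_L, V_L)` of `L`. -/
instance : ForestAlgebra (ForestType L) (ContextType L) where
  smul := Quotient.map₂ (fun p s => p • s) (by
    intro p p' hp s s' hs
    have h1 : forestCon L (p • s) (p • s') := fun r => by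
      have := hs (r * p)
      simpa only [mul_smul] using this
    exact (forestCon L).trans h1 (hp s'))
  one_smul h := by
    induction h using Quotient.inductionOn with
    | h s => exact congrArg (Quotient.mk _) (one_smul (Context A) s)
  mul_smul v w h := by
    induction v using Quotient.inductionOn with
    | h p =>
      induction w using Quotient.inductionOn with
      | h q =>
        induction h using Quotient.inductionOn with
        | h s => exact congrArg (Quotient.mk _) (mul_smul p q s)
  eq_of_smul_eq_smul {v w} h := by
    induction v using Quotient.inductionOn with
    | h p =>
      induction w using Quotient.inductionOn with
      | h q => exact Quotient.sound fun s => Quotient.exact (h (Quotient.mk _ s))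
  leftOf := Quotient.map Context.leftOf (by
    intro s s' hs t p
    have := hs (p * Context.rightOf t)
    simpa only [mul_smul, Context.rightOf, Context.leftOf, Context.hole_smul, zero_add,
      add_zero] using this)
  rightOf := Quotient.map Context.rightOf (by
    intro s s' hs t p
    have := hs (p * Context.leftOf t)
    simpa only [mul_smul, Context.rightOf, Context.leftOf, Context.hole_smul, zero_add,
      add_zero] using this)
  leftOf_smul g h := by
    induction g using Quotient.inductionOn with
    | h s =>
      induction h using Quotient.inductionOn with
      | h t => exact congrArg (Quotient.mk _) (ForestAlgebra.leftOf_smul (V := Context A) s t)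
  rightOf_smul g h := by
    induction g using Quotient.inductionOn with
    | h s =>
      induction h using Quotient.inductionOn with
      | h t => exact congrArg (Quotient.mk _) (ForestAlgebra.rightOf_smul (V := Context A) s t)

end Syntactic

/-! ### Forests as logical structures -/

namespace Forest

variable {A : Type u}

/-- The nodes of a forest. In `cons a s t` they are the root labelled `a`, the nodes of `s`
(`inside`, the proper descendants of that root) and the nodes of `t` (`after`). -/
inductive Node : Forest A → Type u
  | root {a : A} {s t : Forest A} : Node (cons a s t)
  | inside {a : A} {s t : Forest A} (x : Node s) : Node (cons a s t)
  | after {a : A} {s t : Forest A} (x : Node t) : Node (cons a s t)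

namespace Node

/-- The label of a node. -/
def label : {s : Forest A} → Node s → A
  | cons a _ _, root => a
  | _, inside x => x.label
  | _, after x => x.label

/-- `x < y`: the node `x` is a strict ancestor of the node `y`. -/
def Ancestor : {s : Forest A} → Node s → Node s → Prop
  | _, root, inside _ => True
  | _, inside x, inside y => Ancestor x y
  | _, after x, after y => Ancestor x y
  | _, _, _ => False

/-- The node is the root of one of the trees of the forest. -/
def IsRoot : {s : Forest A} → Node s → Prop
  | _, root => True
  | _, inside _ => False
  | _, after x => IsRoot x

/-- `x` is a sibling of `y` to the left of `y`. The roots of the trees of a forest count as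
siblings of each other. -/
def LeftSibling : {s : Forest A} → Node s → Node s → Prop
  | _, root, after y => IsRoot y
  | _, inside x, inside y => LeftSibling x y
  | _, after x, after y => LeftSibling x y
  | _, _, _ => False

/-- The lexicographic order: `x <_lex y` if `x < y`, or there are `x' ≤ x` and `y' ≤ y` such that
`x'` is a sibling to the left of `y'`. -/
def Lex {s : Forest A} (x y : Node s) : Prop :=
  Ancestor x y ∨ ∃ x' y' : Node s,
    (x' = x ∨ Ancestor x' x) ∧ (y' = y ∨ Ancestor y' y) ∧ LeftSibling x' y'

end Node

end Forest

/-- The relation symbols: unary label predicates, and binary symbols for `<` and `<_lex`. -/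
inductive ForestRelation (A : Type u) : ℕ → Type u
  | label (a : A) : ForestRelation A 1
  | anc : ForestRelation A 2
  | lex : ForestRelation A 2

/-- The first-order signature with label predicates, `<` and `<_lex`. -/
def forestLanguage (A : Type u) : FirstOrder.Language.{0, u} where
  Functions _ := Empty
  Relations := ForestRelation A

open FirstOrder Language

/-- The relational structure of a forest; its domain is the set of nodes (possibly empty). -/
instance {A : Type u} (t : Forest A) : (forestLanguage A).Structure t.Node where
  funMap f := nomatch f
  RelMap
    | .label a, xs => (xs 0).label = a
    | .anc, xs => (xs 0).Ancestor (xs 1)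
    | .lex, xs => (xs 0).Lex (xs 1)

/-- Formulas `∃ x₁ ⋯ xₙ ∀ y₁ ⋯ yₘ γ` with `γ` quantifier free. -/
inductive IsExistsForall {L : FirstOrder.Language.{v, w}} {α : Type x} :
    {n : ℕ} → L.BoundedFormula α n → Prop
  | of_isUniversal {n : ℕ} {φ : L.BoundedFormula α n} (h : φ.IsUniversal) : IsExistsForall φ
  | ex {n : ℕ} {φ : L.BoundedFormula α (n + 1)} (h : IsExistsForall φ) : IsExistsForall φ.ex

/-- `Σ₂` sentences: disjunctions and conjunctions of sentences `∃ x₁ ⋯ xₙ ∀ y₁ ⋯ yₘ γ` with `γ`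
quantifier free. (On a nonempty domain every such sentence is equivalent to a single prenex
sentence; the closure under `∨` and `∧` matters only for the empty forest, whose domain is
empty.) -/
inductive IsSigmaTwo {L : FirstOrder.Language.{v, w}} : L.Sentence → Prop
  | prenex {φ : L.Sentence} (h : IsExistsForall φ) : IsSigmaTwo φ
  | or {φ ψ : L.Sentence} (hφ : IsSigmaTwo φ) (hψ : IsSigmaTwo ψ) : IsSigmaTwo (φ ⊔ ψ)
  | and {φ ψ : L.Sentence} (hφ : IsSigmaTwo φ) (hψ : IsSigmaTwo ψ) : IsSigmaTwo (φ ⊓ ψ)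

/-- `Π₂` sentences are the negations of `Σ₂` sentences. -/
def IsPiTwo {L : FirstOrder.Language.{v, w}} (φ : L.Sentence) : Prop :=
  ∃ ψ : L.Sentence, IsSigmaTwo ψ ∧ φ = ∼ψ

/-- The forest language defined by a sentence. -/
def languageOf {A : Type u} (φ : (forestLanguage A).Sentence) : Set (Forest A) :=
  {t | t.Node ⊨ φ}

/-- `L` is definable in `Δ₂(<, <_lex)`: by a `Σ₂` sentence and also by a `Π₂` sentence. -/
def DeltaTwoDefinable {A : Type u} (L : Set (Forest A)) : Prop :=
  (∃ φ : (forestLanguage A).Sentence, IsSigmaTwo φ ∧ L = languageOf φ) ∧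
    ∃ φ : (forestLanguage A).Sentence, IsPiTwo φ ∧ L = languageOf φ

end ForestLogic

/-! From logic to algebra. `Match` and `Le` are the two rounds of a game for sentences with one
block of existential and one block of universal quantifiers: `Le k S T` means that such sentences
with at most `k` variables per block carry over from `S` to `T`. If `L` is in `Δ₂`, the `Σ₂`
sentences for `L` and for its complement together show that `Le k` implies syntactic equivalence,
for some `k` (`DeltaTwoDefinable.exists_le_forestCon`). The game has a finite invariant
(`gameType`), so `H_L` is finite, and so is `V_L`, which acts faithfully on it. For the identity,
let `p` be a piece of `q`. In `q ^ (k * (k + 1)) • s`, any `k` marked nodes miss one of the `k + 1`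
blocks `q ^ k`. That block may be replaced by a long product of copies of `q` around one `p`,
because every `k`-tuple of nodes of such a product already occurs in `q ^ k` (`Le.insert`).

From algebra to logic. It suffices to find one `B` such that in every forest some `B` marked nodes
force its type, in the sense of `Det` and `Cap`: then `L` and its complement are both `Σ₂`
(`sigmaTwoDefinable_of_det`). Pieces are the same as order embeddings (`CEmb.isPiece`), and every
context has a piece of bounded size and equal type (`exists_small_context`). A bounded number of
nodes therefore controls the type of a context from above in the piece order, although not exactly.
Two composition lemmas use this: `exists_cap_cons` needs a context only up to piece equivalence, and
`exists_cap_smul` needs only that it lies in a downward closed set `X` on which the result is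
constant.

The bound comes from an induction on `|X| + |U|`, where `Reg` says that all remainders of `t` that
are not yet forced are reached through types in `X` and under left contexts in `U`. If `t` resists,
the induction hypothesis cuts it at a context whose type is above all of `X` ("full") and which
takes `u` to any chosen element of `U` (`Reg.exists_reach`). Choosing `u` itself gives a full `y`
with `u * y = u`, hence an idempotent `e = y ^ ω` with `u * e = u` and, by the identity, `e * x * e
= e` for all `x` in `X`. A smallest resisting remainder `s` is forced by `exists_cap_cons`. A
pigeonhole argument (`Reach.exists_loop`) writes its type as `m • G`, with `m * f = m` for an
idempotent power `f` of a full element. Then `u * x * m = u * (e * (x * m * f) * e) * f = u * e * f`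
does not depend on `x`, and `exists_cap_smul` forces the type of `t` after all. -/

namespace ForestLogic
open FirstOrder Language

/-! ### The lexicographic order, by recursion on forests -/

namespace Forest.Node

variable {A : Type u}

/-- This supplies the sibling `y'` in the definition of `Lex` whenever the second node lies in the
forest after the first tree. -/
theorem exists_isRoot {s : Forest A} (x : Node s) :
    ∃ y : Node s, (y = x ∨ Ancestor y x) ∧ IsRoot y := by
  induction x with
  | root => exact ⟨root, Or.inl rfl, trivial⟩
  | inside x _ => exact ⟨root, Or.inr trivial, trivial⟩
  | after x ih =>
    obtain ⟨y, hy, hr⟩ := ih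
    refine ⟨after y, ?_, hr⟩
    rcases hy with rfl | hy
    · exact Or.inl rfl
    · exact Or.inr hy

variable {a : A} {s t : Forest A}

@[simp] theorem ancestor_root_inside (x : Node s) :
    Ancestor (root : Node (cons a s t)) (inside x) := trivial
@[simp] theorem not_ancestor_root_after (x : Node t) :
    ¬ Ancestor (root : Node (cons a s t)) (after x) := id
@[simp] theorem not_ancestor_root (x : Node (cons a s t)) : ¬ Ancestor x root := by
  cases x <;> exact id
@[simp] theorem ancestor_inside (x y : Node s) :
    Ancestor (inside x : Node (cons a s t)) (inside y) ↔ Ancestor x y := Iff.rfl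
@[simp] theorem ancestor_after (x y : Node t) :
    Ancestor (after x : Node (cons a s t)) (after y) ↔ Ancestor x y := Iff.rfl
@[simp] theorem not_ancestor_inside_after (x : Node s) (y : Node t) :
    ¬ Ancestor (inside x : Node (cons a s t)) (after y) := id
@[simp] theorem not_ancestor_after_inside (x : Node t) (y : Node s) :
    ¬ Ancestor (after x : Node (cons a s t)) (inside y) := id

@[simp] theorem lex_root_inside (x : Node s) :
    Lex (root : Node (cons a s t)) (inside x) := Or.inl trivial
@[simp] theorem lex_root_after (x : Node t) :
    Lex (root : Node (cons a s t)) (after x) := by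
  obtain ⟨y, hy, hr⟩ := exists_isRoot x
  refine Or.inr ⟨root, after y, Or.inl rfl, ?_, hr⟩
  rcases hy with rfl | hy
  · exact Or.inl rfl
  · exact Or.inr hy
@[simp] theorem lex_inside_after (x : Node s) (y : Node t) :
    Lex (inside x : Node (cons a s t)) (after y) := by
  obtain ⟨z, hz, hr⟩ := exists_isRoot y
  refine Or.inr ⟨root, after z, Or.inr trivial, ?_, hr⟩
  rcases hz with rfl | hz
  · exact Or.inl rfl
  · exact Or.inr hz
@[simp] theorem not_lex_root (x : Node (cons a s t)) : ¬ Lex x root := by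
  rintro (h | ⟨x', y', hx, hy, h⟩)
  · exact not_ancestor_root _ h
  · rcases hy with rfl | hy
    · cases x' <;> exact h
    · exact not_ancestor_root _ hy
@[simp] theorem not_lex_after_inside (x : Node t) (y : Node s) :
    ¬ Lex (after x : Node (cons a s t)) (inside y) := by
  rintro (h | ⟨x', y', hx, hy, h⟩)
  · exact h
  · cases x' with
    | root => rcases hx with hx | hx <;> cases hx
    | inside x' => rcases hx with hx | hx <;> cases hx
    | after x' =>
      cases y' with
      | after y' => rcases hy with hy | hy <;> cases hy
      | root => exact h
      | inside y' => exact h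
@[simp] theorem lex_inside (x y : Node s) :
    Lex (inside x : Node (cons a s t)) (inside y) ↔ Lex x y := by
  constructor
  · rintro (h | ⟨x', y', hx, hy, h⟩)
    · exact Or.inl h
    · refine Or.inr ?_
      cases x' with
      | root =>
        cases y' with
        | after y' => rcases hy with hy | hy <;> cases hy
        | root => exact h.elim
        | inside y' => exact h.elim
      | after x' => rcases hx with hx | hx <;> cases hx
      | inside x' =>
        cases y' with
        | after y' => exact h.elim
        | root => exact h.elim
        | inside y' =>
          exact ⟨x', y', hx.imp_left (by rintro ⟨⟩; rfl), hy.imp_left (by rintro ⟨⟩; rfl), h⟩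
  · rintro (h | ⟨x', y', hx, hy, h⟩)
    · exact Or.inl h
    · exact Or.inr ⟨inside x', inside y', hx.imp_left (congrArg _), hy.imp_left (congrArg _), h⟩
@[simp] theorem lex_after (x y : Node t) :
    Lex (after x : Node (cons a s t)) (after y) ↔ Lex x y := by
  constructor
  · rintro (h | ⟨x', y', hx, hy, h⟩)
    · exact Or.inl h
    · refine Or.inr ?_
      cases x' with
      | root => rcases hx with hx | hx <;> cases hx
      | inside x' => rcases hx with hx | hx <;> cases hx
      | after x' =>
        cases y' with
        | inside y' => exact h.elim
        | root => exact h.elim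
        | after y' =>
          exact ⟨x', y', hx.imp_left (by rintro ⟨⟩; rfl), hy.imp_left (by rintro ⟨⟩; rfl), h⟩
  · rintro (h | ⟨x', y', hx, hy, h⟩)
    · exact Or.inl h
    · exact Or.inr ⟨after x', after y', hx.imp_left (congrArg _), hy.imp_left (congrArg _), h⟩

theorem lex_irrefl {s : Forest A} (x : Node s) : ¬ Lex x x := by
  induction x with
  | root => simp
  | inside x ih => simpa using ih
  | after x ih => simpa using ih

theorem eq_of_not_lex {s : Forest A} (x y : Node s) : ¬ Lex x y → ¬ Lex y x → x = y := by
  induction x with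
  | root => cases y <;> simp
  | inside x ih =>
    cases y with
    | root => simp
    | inside y => simpa using ih y
    | after y => simp
  | after x ih =>
    cases y with
    | root => simp
    | inside y => simp
    | after y => simpa using ih y

theorem ancestor_irrefl {s : Forest A} (x : Node s) : ¬ Ancestor x x := by
  induction x with
  | root => simp
  | inside x ih => simpa using ih
  | after x ih => simpa using ih

theorem ancestor_trans {s : Forest A} {x y z : Node s} :
    Ancestor x y → Ancestor y z → Ancestor x z := by
  induction x with
  | root =>
    cases y <;> cases z <;> simp
  | inside x ih =>
    cases y <;> cases z <;> simp
    exact ih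
  | after x ih =>
    cases y <;> cases z <;> simp
    exact ih

instance : IsEmpty (Node (0 : Forest A)) := ⟨fun x => nomatch x⟩
instance : IsEmpty (Node (nil : Forest A)) := ⟨fun x => nomatch x⟩

/-- The nodes of a nonempty forest. -/
def consEquiv (a : A) (s t : Forest A) : Node (cons a s t) ≃ Option (Node s ⊕ Node t) where
  toFun
    | root => none
    | inside x => some (Sum.inl x)
    | after x => some (Sum.inr x)
  invFun
    | none => root
    | some (Sum.inl x) => inside x
    | some (Sum.inr x) => after x
  left_inv x := by cases x <;> rfl
  right_inv x := by rcases x with _ | _ | _ <;> rfl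

instance instFinite (s : Forest A) : Finite (Node s) := by
  induction s with
  | nil => infer_instance
  | cons a s t _ _ => exact Finite.of_equiv _ (consEquiv a s t).symm

theorem card_eq_size (s : Forest A) : Nat.card (Node s) = s.size := by
  induction s with
  | nil => simp [size]
  | cons a s t ihs iht =>
    rw [Nat.card_congr (consEquiv a s t), Finite.card_option, Nat.card_sum, ihs, iht, size]
    omega

end Forest.Node

/-! ### Structures with two binary relations, and structures with a hole -/

/-- A labelled set with two binary relations. -/
structure Str (A : Type u) where
  carrier : Type u
  lab : carrier → A
  anc : carrier → carrier → Prop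
  lex : carrier → carrier → Prop

/-- A labelled set with two binary relations and a hole: `up` are the ancestors of the hole and
`bef` are the elements before the hole. -/
structure CStr (A : Type u) extends Str A where
  up : carrier → Prop
  bef : carrier → Prop

instance {A : Type u} : CoeSort (Str A) (Type u) := ⟨Str.carrier⟩
instance {A : Type u} : CoeSort (CStr A) (Type u) := ⟨fun C => C.carrier⟩

variable {A : Type u}

/-- The two tuples have the same atomic type. -/
structure Same {S T : Str A} {ι : Type*} (x : ι → S) (y : ι → T) : Prop where
  lab : ∀ i, S.lab (x i) = T.lab (y i)
  anc : ∀ i j, S.anc (x i) (x j) ↔ T.anc (y i) (y j)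
  lex : ∀ i j, S.lex (x i) (x j) ↔ T.lex (y i) (y j)

/-- The two tuples have the same atomic type, taking the hole into account. -/
structure CSame {C D : CStr A} {ι : Type*} (x : ι → C) (y : ι → D) : Prop where
  same : Same (S := C.toStr) (T := D.toStr) x y
  up : ∀ i, C.up (x i) ↔ D.up (y i)
  bef : ∀ i, C.bef (x i) ↔ D.bef (y i)

theorem Same.refl {S : Str A} {ι : Type*} (x : ι → S) : Same x x :=
  ⟨fun _ => rfl, fun _ _ => Iff.rfl, fun _ _ => Iff.rfl⟩
theorem Same.symm {S T : Str A} {ι : Type*} {x : ι → S} {y : ι → T} (h : Same x y) : Same y x :=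
  ⟨fun i => (h.lab i).symm, fun i j => (h.anc i j).symm, fun i j => (h.lex i j).symm⟩
theorem Same.trans {S T U : Str A} {ι : Type*} {x : ι → S} {y : ι → T} {z : ι → U}
    (h : Same x y) (h' : Same y z) : Same x z :=
  ⟨fun i => (h.lab i).trans (h'.lab i), fun i j => (h.anc i j).trans (h'.anc i j),
    fun i j => (h.lex i j).trans (h'.lex i j)⟩
theorem Same.comp {S T : Str A} {ι κ : Type*} {x : ι → S} {y : ι → T} (h : Same x y)
    (g : κ → ι) : Same (x ∘ g) (y ∘ g) :=
  ⟨fun _ => h.lab _, fun _ _ => h.anc _ _, fun _ _ => h.lex _ _⟩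

theorem CSame.refl {S : CStr A} {ι : Type*} (x : ι → S) : CSame x x :=
  ⟨.refl x, fun _ => Iff.rfl, fun _ => Iff.rfl⟩
theorem CSame.symm {S T : CStr A} {ι : Type*} {x : ι → S} {y : ι → T} (h : CSame x y) :
    CSame y x :=
  ⟨h.same.symm, fun i => (h.up i).symm, fun i => (h.bef i).symm⟩
theorem CSame.trans {S T U : CStr A} {ι : Type*} {x : ι → S} {y : ι → T} {z : ι → U}
    (h : CSame x y) (h' : CSame y z) : CSame x z :=
  ⟨h.same.trans h'.same, fun i => (h.up i).trans (h'.up i), fun i => (h.bef i).trans (h'.bef i)⟩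
theorem CSame.comp {S T : CStr A} {ι κ : Type*} {x : ι → S} {y : ι → T} (h : CSame x y)
    (g : κ → ι) : CSame (x ∘ g) (y ∘ g) :=
  ⟨h.same.comp g, fun _ => h.up _, fun _ => h.bef _⟩

/-- `S` substituted for the hole of `C`. -/
def plug (C : CStr A) (S : Str A) : Str A where
  carrier := C ⊕ S
  lab := Sum.elim C.lab S.lab
  anc
    | .inl a, .inl b => C.anc a b
    | .inl a, .inr _ => C.up a
    | .inr _, .inl _ => False
    | .inr a, .inr b => S.anc a b
  lex
    | .inl a, .inl b => C.lex a b
    | .inl a, .inr _ => C.bef a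
    | .inr _, .inl b => ¬ C.bef b
    | .inr a, .inr b => S.lex a b

/-- `D` substituted for the hole of `C`. -/
def cplug (C D : CStr A) : CStr A where
  toStr := plug C D.toStr
  up := Sum.elim C.up D.up
  bef := Sum.elim C.bef D.bef

/-- Relations across the two parts depend only on `up` and `bef` of the element of the context, so
the atomic types of the two parts determine that of the whole tuple. The map `g` places the two
parts in the index set of that tuple. -/
theorem Same.plug_map {C D : CStr A} {S T : Str A} {K₁ K₂ J : Type*} {xc : K₁ → C} {yc : K₁ → D}
    {xs : K₂ → S} {ys : K₂ → T} (hc : CSame xc yc) (hs : Same xs ys) (g : J → K₁ ⊕ K₂) :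
    Same (S := plug C S) (T := plug D T) (Sum.map xc xs ∘ g) (Sum.map yc ys ∘ g) := by
  suffices h : Same (S := plug C S) (T := plug D T)
      (Sum.map xc xs) (Sum.map yc ys) from h.comp g
  refine ⟨?_, ?_, ?_⟩
  · rintro (i | i)
    · exact hc.same.lab i
    · exact hs.lab i
  · rintro (i | i) (j | j)
    · exact hc.same.anc i j
    · exact hc.up i
    · exact Iff.rfl
    · exact hs.anc i j
  · rintro (i | i) (j | j)
    · exact hc.same.lex i j
    · exact hc.bef i
    · exact not_congr (hc.bef j)
    · exact hs.lex i j

theorem CSame.cplug_map {C D : CStr A} {S T : CStr A} {K₁ K₂ J : Type*} {xc : K₁ → C} {yc : K₁ → D}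
    {xs : K₂ → S} {ys : K₂ → T} (hc : CSame xc yc) (hs : CSame xs ys) (g : J → K₁ ⊕ K₂) :
    CSame (C := cplug C S) (D := cplug D T) (Sum.map xc xs ∘ g) (Sum.map yc ys ∘ g) := by
  suffices h : CSame (C := cplug C S) (D := cplug D T)
      (Sum.map xc xs) (Sum.map yc ys) from h.comp g
  refine ⟨Same.plug_map hc hs.same id, ?_, ?_⟩
  · rintro (i | i)
    · exact hc.up i
    · exact hs.up i
  · rintro (i | i)
    · exact hc.bef i
    · exact hs.bef i

/-! ### Embeddings and coverings of structures -/

/-- `f` preserves and reflects the structure. -/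
def IsEmb {S T : Str A} (f : S → T) : Prop := Same (fun a : S => a) f

/-- `f` preserves and reflects the structure, including the position of the hole. -/
def IsCEmb {C D : CStr A} (f : C → D) : Prop := CSame (fun a : C => a) f

def Emb (S T : Str A) : Prop := ∃ f : S → T, IsEmb f
def CEmb (C D : CStr A) : Prop := ∃ f : C → D, IsCEmb f
/-- `T` is the image of `S` under a map that preserves and reflects the structure. -/
def Cov (S T : Str A) : Prop := ∃ f : S → T, f.Surjective ∧ IsEmb f
def CCov (C D : CStr A) : Prop := ∃ f : C → D, f.Surjective ∧ IsCEmb f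

theorem IsEmb.id (S : Str A) : IsEmb (fun a : S => a) := .refl _
theorem IsEmb.comp {S T U : Str A} {g : T → U} {f : S → T} (hg : IsEmb g) (hf : IsEmb f) :
    IsEmb (g ∘ f) := Same.trans hf (Same.comp hg f)
theorem IsEmb.same {S T : Str A} {f : S → T} (hf : IsEmb f) {ι : Type*} (x : ι → S) :
    Same x (f ∘ x) := Same.comp hf x
theorem IsCEmb.id (S : CStr A) : IsCEmb (fun a : S => a) := .refl _
theorem IsCEmb.comp {S T U : CStr A} {g : T → U} {f : S → T} (hg : IsCEmb g) (hf : IsCEmb f) :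
    IsCEmb (g ∘ f) := CSame.trans hf (CSame.comp hg f)
theorem IsCEmb.csame {S T : CStr A} {f : S → T} (hf : IsCEmb f) {ι : Type*} (x : ι → S) :
    CSame x (f ∘ x) := CSame.comp hf x

theorem IsEmb.plug_map {C D : CStr A} {S T : Str A} {f : C → D} {g : S → T} (hf : IsCEmb f)
    (hg : IsEmb g) : IsEmb (S := plug C S) (T := plug D T) (Sum.map f g) := by
  have := Same.plug_map hf hg _root_.id
  rwa [show (Sum.map (fun a : C => a) (fun a : S => a)) = _root_.id from Sum.map_id_id] at this
theorem IsCEmb.cplug_map {C D S T : CStr A} {f : C → D} {g : S → T} (hf : IsCEmb f)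
    (hg : IsCEmb g) : IsCEmb (C := cplug C S) (D := cplug D T) (Sum.map f g) := by
  have := CSame.cplug_map hf hg _root_.id
  rwa [show (Sum.map (fun a : C => a) (fun a : S => a)) = _root_.id from Sum.map_id_id] at this

theorem Emb.refl (S : Str A) : Emb S S := ⟨_, .id S⟩
theorem Emb.trans {S T U : Str A} : Emb S T → Emb T U → Emb S U
  | ⟨_, hf⟩, ⟨_, hg⟩ => ⟨_, hg.comp hf⟩
theorem CEmb.refl (S : CStr A) : CEmb S S := ⟨_, .id S⟩
theorem CEmb.trans {S T U : CStr A} : CEmb S T → CEmb T U → CEmb S U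
  | ⟨_, hf⟩, ⟨_, hg⟩ => ⟨_, hg.comp hf⟩
theorem Emb.plug_map {C D : CStr A} {S T : Str A} : CEmb C D → Emb S T →
    Emb (plug C S) (plug D T)
  | ⟨_, hf⟩, ⟨_, hg⟩ => ⟨_, IsEmb.plug_map hf hg⟩
theorem CEmb.cplug_map {C D S T : CStr A} : CEmb C D → CEmb S T → CEmb (cplug C S) (cplug D T)
  | ⟨_, hf⟩, ⟨_, hg⟩ => ⟨_, IsCEmb.cplug_map hf hg⟩

theorem Cov.trans {S T U : Str A} : Cov S T → Cov T U → Cov S U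
  | ⟨_, sf, hf⟩, ⟨_, sg, hg⟩ => ⟨_, sg.comp sf, hg.comp hf⟩
theorem CCov.refl (S : CStr A) : CCov S S := ⟨_, Function.surjective_id, .id S⟩
theorem CCov.trans {S T U : CStr A} : CCov S T → CCov T U → CCov S U
  | ⟨_, sf, hf⟩, ⟨_, sg, hg⟩ => ⟨_, sg.comp sf, hg.comp hf⟩
theorem Cov.plug_map {C D : CStr A} {S T : Str A} : CCov C D → Cov S T →
    Cov (plug C S) (plug D T)
  | ⟨_, sf, hf⟩, ⟨_, sg, hg⟩ => ⟨_, sf.sumMap sg, IsEmb.plug_map hf hg⟩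
theorem CCov.cplug_map {C D S T : CStr A} : CCov C D → CCov S T → CCov (cplug C S) (cplug D T)
  | ⟨_, sf, hf⟩, ⟨_, sg, hg⟩ => ⟨_, sf.sumMap sg, IsCEmb.cplug_map hf hg⟩

theorem Cov.emb {S T : Str A} : Cov S T → Emb S T
  | ⟨f, _, hf⟩ => ⟨f, hf⟩
theorem CCov.emb {S T : CStr A} : CCov S T → CEmb S T
  | ⟨f, _, hf⟩ => ⟨f, hf⟩
-- Any section of a structure-reflecting surjection is an embedding. Coverings thus serve as
-- isomorphisms and injectivity never has to be proved.
theorem Cov.emb_symm {S T : Str A} : Cov S T → Emb T S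
  | ⟨f, sf, hf⟩ => by
    refine ⟨Function.surjInv sf, ?_⟩
    have := (hf.same (Function.surjInv sf)).symm
    rwa [show f ∘ Function.surjInv sf = (fun a => a) from
      funext (Function.surjInv_eq sf)] at this
theorem CCov.emb_symm {S T : CStr A} : CCov S T → CEmb T S
  | ⟨f, sf, hf⟩ => by
    refine ⟨Function.surjInv sf, ?_⟩
    have := (hf.csame (Function.surjInv sf)).symm
    rwa [show f ∘ Function.surjInv sf = (fun a => a) from
      funext (Function.surjInv_eq sf)] at this

theorem isEmb_plug_assoc (C D : CStr A) (S : Str A) :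
    IsEmb (S := plug (cplug C D) S) (T := plug C (plug D S)) (Equiv.sumAssoc _ _ _) := by
  refine ⟨?_, ?_, ?_⟩
  · rintro ((i | i) | i) <;> rfl
  · rintro ((i | i) | i) ((j | j) | j) <;> exact Iff.rfl
  · rintro ((i | i) | i) ((j | j) | j) <;> exact Iff.rfl

theorem Cov.plug_assoc (C D : CStr A) (S : Str A) :
    Cov (plug (cplug C D) S) (plug C (plug D S)) :=
  ⟨_, (Equiv.sumAssoc _ _ _).surjective, isEmb_plug_assoc C D S⟩

theorem CCov.cplug_assoc (C D S : CStr A) :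
    CCov (cplug (cplug C D) S) (cplug C (cplug D S)) := by
  refine ⟨Equiv.sumAssoc _ _ _, (Equiv.sumAssoc _ _ _).surjective, isEmb_plug_assoc C D _, ?_, ?_⟩
  · rintro ((i | i) | i) <;> exact Iff.rfl
  · rintro ((i | i) | i) <;> exact Iff.rfl

theorem CCov.cplug_assoc_symm (C D S : CStr A) :
    CCov (cplug C (cplug D S)) (cplug (cplug C D) S) := by
  refine ⟨(Equiv.sumAssoc _ _ _).symm, (Equiv.sumAssoc _ _ _).symm.surjective, ⟨?_, ?_, ?_⟩, ?_, ?_⟩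
  · rintro (i | i | i) <;> rfl
  · rintro (i | i | i) (j | j | j) <;> exact Iff.rfl
  · rintro (i | i | i) (j | j | j) <;> exact Iff.rfl
  · rintro (i | i | i) <;> exact Iff.rfl
  · rintro (i | i | i) <;> exact Iff.rfl

/-! ### The structures of forests and contexts -/

open Forest (Node)

/-- The nodes of a forest as a structure. -/
def Forest.str (s : Forest A) : Str A := ⟨Node s, Node.label, Node.Ancestor, Node.Lex⟩

/-- The structure of `l + □`. -/
def leftS (l : Forest A) : CStr A := ⟨l.str, fun _ => False, fun _ => True⟩
/-- The structure of `□ + r`. -/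
def rightS (r : Forest A) : CStr A := ⟨r.str, fun _ => False, fun _ => False⟩
/-- The structure of `a □`. -/
def letterS (a : A) : CStr A :=
  ⟨⟨PUnit, fun _ => a, fun _ _ => False, fun _ _ => False⟩, fun _ => True, fun _ => True⟩

/-- The nodes of a context other than the hole, as a structure. -/
def Context.str : Context A → CStr A
  | .hole l r => cplug (leftS l) (rightS r)
  | .node l a p r => cplug (cplug (leftS l) (rightS r)) (cplug (letterS a) p.str)

namespace Forest.Node

/-- A node of `l` as a node of `l + s`. -/
def inl : {l : Forest A} → (s : Forest A) → Node l → Node (l + s)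
  | .cons _ _ _, _, root => root
  | .cons _ _ _, _, inside x => inside x
  | .cons _ _ _, s, after x => after (inl s x)

/-- A node of `s` as a node of `l + s`. -/
def inr {s : Forest A} : (l : Forest A) → Node s → Node (l + s)
  | .nil, x => x
  | .cons _ _ t, x => after (inr t x)

theorem inl_inr_surjective (l s : Forest A) :
    Function.Surjective (Sum.elim (inl s) (inr l) : Node l ⊕ Node s → Node (l + s)) := by
  induction l with
  | nil => exact fun x => ⟨.inr x, rfl⟩
  | cons a l t _ ih =>
    intro x
    cases x with
    | root => exact ⟨.inl root, rfl⟩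
    | inside x => exact ⟨.inl (inside x), rfl⟩
    | after x =>
      obtain ⟨x | x, rfl⟩ := ih x
      · exact ⟨.inl (after x), rfl⟩
      · exact ⟨.inr x, rfl⟩

theorem label_inl {l : Forest A} (s : Forest A) (x : Node l) : label (inl s x) = label x := by
  induction x with
  | root => rfl
  | inside x => rfl
  | after x ih => exact ih

theorem label_inr (l : Forest A) {s : Forest A} (x : Node s) : label (inr l x) = label x := by
  induction l with
  | nil => rfl
  | cons a l t _ ih => exact ih

theorem ancestor_inl {l : Forest A} (s : Forest A) (x y : Node l) :
    Ancestor (inl s x) (inl s y) ↔ Ancestor x y := by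
  induction x with
  | root => cases y <;> exact Iff.rfl
  | inside x => cases y <;> exact Iff.rfl
  | after x ih =>
    cases y with
    | after y => exact ih y
    | root => exact Iff.rfl
    | inside y => exact Iff.rfl

theorem ancestor_inr (l : Forest A) {s : Forest A} (x y : Node s) :
    Ancestor (inr l x) (inr l y) ↔ Ancestor x y := by
  induction l with
  | nil => rfl
  | cons a l t _ ih => exact ih

theorem not_ancestor_inl_inr {l s : Forest A} (x : Node l) (y : Node s) :
    ¬ Ancestor (inl s x) (inr l y) := by
  induction x with
  | root => exact id
  | inside x => exact id
  | after x ih => exact ih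

theorem not_ancestor_inr_inl {l s : Forest A} (x : Node l) (y : Node s) :
    ¬ Ancestor (inr l y) (inl s x) := by
  induction x with
  | root => exact id
  | inside x => exact id
  | after x ih => exact ih

theorem lex_inl {l : Forest A} (s : Forest A) (x y : Node l) :
    Lex (inl s x) (inl s y) ↔ Lex x y := by
  induction x with
  | root =>
    cases y with
    | root => exact iff_of_false (not_lex_root _) (not_lex_root _)
    | inside y => exact iff_of_true (lex_root_inside _) (lex_root_inside _)
    | after y => exact iff_of_true (lex_root_after _) (lex_root_after _)
  | inside x =>
    cases y with
    | root => exact iff_of_false (not_lex_root _) (not_lex_root _)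
    | inside y => exact (Forest.Node.lex_inside _ _).trans (Forest.Node.lex_inside _ _).symm
    | after y => exact iff_of_true (lex_inside_after _ _) (lex_inside_after _ _)
  | after x ih =>
    cases y with
    | root => exact iff_of_false (not_lex_root _) (not_lex_root _)
    | inside y => exact iff_of_false (not_lex_after_inside _ _) (not_lex_after_inside _ _)
    | after y =>
      exact ((Forest.Node.lex_after _ _).trans (ih y)).trans (Forest.Node.lex_after _ _).symm

theorem lex_inr (l : Forest A) {s : Forest A} (x y : Node s) :
    Lex (inr l x) (inr l y) ↔ Lex x y := by
  induction l with
  | nil => rfl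
  | cons a l t _ ih => exact (lex_after (a := a) (s := l) _ _).trans ih

theorem lex_inl_inr {l s : Forest A} (x : Node l) (y : Node s) :
    Lex (inl s x) (inr l y) := by
  induction x with
  | root => exact lex_root_after _
  | inside x => exact lex_inside_after _ _
  | after x ih => exact (lex_after _ _).2 ih

theorem not_lex_inr_inl {l s : Forest A} (x : Node l) (y : Node s) :
    ¬ Lex (inr l y) (inl s x) := by
  induction x with
  | root => exact not_lex_root _
  | inside x => exact not_lex_after_inside _ _
  | after x ih => exact (lex_after _ _).not.2 ih

end Forest.Node

open Forest.Node

theorem isEmb_leftS (l s : Forest A) :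
    IsEmb (S := plug (leftS l) s.str) (T := (l + s).str) (Sum.elim (inl s) (inr l)) := by
  refine ⟨?_, ?_, ?_⟩
  · rintro (i | i)
    · exact (label_inl s i).symm
    · exact (label_inr l i).symm
  · rintro (i | i) (j | j)
    · exact (ancestor_inl s i j).symm
    · exact iff_of_false id (not_ancestor_inl_inr i j)
    · exact iff_of_false id (not_ancestor_inr_inl j i)
    · exact (ancestor_inr l i j).symm
  · rintro (i | i) (j | j)
    · exact (lex_inl s i j).symm
    · exact iff_of_true trivial (lex_inl_inr i j)
    · exact iff_of_false (fun h => h trivial) (not_lex_inr_inl j i)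
    · exact (lex_inr l i j).symm

theorem Cov.left (l s : Forest A) : Cov (plug (leftS l) s.str) (l + s).str :=
  ⟨_, inl_inr_surjective l s, isEmb_leftS l s⟩

theorem CCov.left_add (l s : Forest A) :
    CCov (cplug (leftS l) (leftS s)) (leftS (l + s)) :=
  ⟨_, inl_inr_surjective l s, isEmb_leftS l s, by rintro (i | i) <;> exact Iff.rfl,
    by rintro (i | i) <;> exact Iff.rfl⟩

theorem isEmb_rightS (s r : Forest A) :
    IsEmb (S := plug (rightS r) s.str) (T := (s + r).str) (Sum.elim (inr s) (inl r)) := by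
  refine ⟨?_, ?_, ?_⟩
  · rintro (i | i)
    · exact (label_inr s i).symm
    · exact (label_inl r i).symm
  · rintro (i | i) (j | j)
    · exact (ancestor_inr s i j).symm
    · exact iff_of_false id (not_ancestor_inr_inl j i)
    · exact iff_of_false id (not_ancestor_inl_inr i j)
    · exact (ancestor_inl r i j).symm
  · rintro (i | i) (j | j)
    · exact (lex_inr s i j).symm
    · exact iff_of_false id (not_lex_inr_inl j i)
    · exact iff_of_true id (lex_inl_inr i j)
    · exact (lex_inl r i j).symm

theorem inr_inl_surjective (s r : Forest A) :
    Function.Surjective (Sum.elim (inr s) (inl r) : Node r ⊕ Node s → Node (s + r)) := by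
  intro x
  obtain ⟨y | y, rfl⟩ := inl_inr_surjective s r x
  · exact ⟨.inr y, rfl⟩
  · exact ⟨.inl y, rfl⟩

theorem Cov.right (s r : Forest A) : Cov (plug (rightS r) s.str) (s + r).str :=
  ⟨_, inr_inl_surjective s r, isEmb_rightS s r⟩

theorem CCov.right_add (s r : Forest A) :
    CCov (cplug (rightS r) (rightS s)) (rightS (s + r)) :=
  ⟨_, inr_inl_surjective s r, isEmb_rightS s r, by rintro (i | i) <;> exact Iff.rfl,
    by rintro (i | i) <;> exact Iff.rfl⟩

/-- Every node of `l` is before the hole and every node of `r` after it, so each way of nesting puts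
`l` before `r`. -/
theorem CCov.swap (l r : Forest A) :
    CCov (cplug (rightS r) (leftS l))
      (cplug (leftS l) (rightS r)) := by
  refine ⟨Sum.swap, Sum.swap_rightInverse.surjective, ⟨?_, ?_, ?_⟩, ?_, ?_⟩
  · rintro (i | i) <;> rfl
  · rintro (i | i) (j | j) <;> exact Iff.rfl
  · rintro (i | i) (j | j)
    · exact Iff.rfl
    · exact iff_of_false id (fun h => h trivial)
    · exact iff_of_true id trivial
    · exact Iff.rfl
  · rintro (i | i) <;> exact Iff.rfl
  · rintro (i | i) <;> exact Iff.rfl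

theorem isEmb_letterS (a : A) (s : Forest A) :
    IsEmb (S := plug (letterS a) s.str) (T := (Forest.tree a s).str)
      (Sum.elim (fun _ => root) inside) := by
  refine ⟨?_, ?_, ?_⟩
  · rintro (i | i) <;> rfl
  · rintro (i | i) (j | j)
    · exact iff_of_false id (not_ancestor_root _)
    · exact Iff.rfl
    · exact iff_of_false id (not_ancestor_root _)
    · exact Iff.rfl
  · rintro (i | i) (j | j)
    · exact iff_of_false id (not_lex_root _)
    · exact iff_of_true trivial (lex_root_inside _)
    · exact iff_of_false (fun h => h trivial) (not_lex_root _)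
    · exact (lex_inside _ _).symm

theorem Cov.letter (a : A) (s : Forest A) :
    Cov (plug (letterS a) s.str) (Forest.tree a s).str := by
  refine ⟨_, ?_, isEmb_letterS a s⟩
  intro x
  cases x with
  | root => exact ⟨.inl ⟨⟩, rfl⟩
  | inside x => exact ⟨.inr x, rfl⟩
  | after x => exact (nomatch x)

/-- Associativity of `plug` moves the forest to the innermost place, where the layers `l + □`, `a □`
and `□ + r` absorb it one at a time. Games on `p • s` can then be played on a disjoint sum. -/
theorem Cov.smul (p : Context A) (s : Forest A) : Cov (plug p.str s.str) (p • s).str := by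
  induction p with
  | hole l r =>
    rw [Context.hole_smul, add_assoc]
    exact (Cov.plug_assoc _ _ _).trans ((Cov.plug_map (.refl _) (.right s r)).trans (.left _ _))
  | node l a p r ih =>
    rw [Context.node_smul, add_assoc]
    refine (Cov.plug_assoc _ _ _).trans ((Cov.plug_assoc _ _ _).trans ?_)
    refine (Cov.plug_map (.refl _) (Cov.plug_map (.refl _) ?_)).trans
      ((Cov.plug_map (.refl _) (.right _ r)).trans (.left _ _))
    exact (Cov.plug_assoc _ _ _).trans ((Cov.plug_map (.refl _) ih).trans (.letter _ _))

theorem CCov.hole_mul (l r l' r' : Forest A) :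
    CCov (cplug (cplug (leftS l) (rightS r))
      (cplug (leftS l') (rightS r')))
      (cplug (leftS (l + l')) (rightS (r' + r))) := by
  refine (CCov.cplug_assoc _ _ _).trans ?_
  refine (CCov.cplug_map (.refl _) ((CCov.cplug_assoc_symm _ _ _).trans
    ((CCov.cplug_map (.swap _ _) (.refl _)).trans (CCov.cplug_assoc _ _ _)))).trans ?_
  exact (CCov.cplug_assoc_symm _ _ _).trans (CCov.cplug_map (.left_add _ _) (.right_add _ _))

theorem CCov.mul (p q : Context A) : CCov (cplug p.str q.str) (p * q).str := by
  induction p with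
  | hole l r =>
    cases q with
    | hole l' r' => exact .hole_mul l r l' r'
    | node l' a q r' =>
      rw [Context.hole_mul_node]
      exact (CCov.cplug_assoc_symm _ _ _).trans (CCov.cplug_map (.hole_mul l r l' r') (.refl _))
  | node l a p r ih =>
    rw [Context.node_mul]
    exact (CCov.cplug_assoc _ _ _).trans (CCov.cplug_map (.refl _)
      ((CCov.cplug_assoc _ _ _).trans (CCov.cplug_map (.refl _) ih)))

instance : IsEmpty (0 : Forest A).str := inferInstanceAs (IsEmpty (Node (0 : Forest A)))
instance : IsEmpty (leftS (0 : Forest A)) := inferInstanceAs (IsEmpty (Node (0 : Forest A)))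
instance : IsEmpty (rightS (0 : Forest A)) := inferInstanceAs (IsEmpty (Node (0 : Forest A)))
instance : IsEmpty (1 : Context A).str :=
  inferInstanceAs (IsEmpty (Node (0 : Forest A) ⊕ Node (0 : Forest A)))

theorem CCov.empty_left {C D : CStr A} [IsEmpty C] : CCov (cplug C D) D := by
  refine ⟨Sum.elim isEmptyElim _root_.id, fun x => ⟨Sum.inr x, rfl⟩, ⟨?_, ?_, ?_⟩, ?_, ?_⟩
  · rintro (i | i)
    · exact isEmptyElim i
    · rfl
  · rintro (i | i) (j | j)
    · exact isEmptyElim i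
    · exact isEmptyElim i
    · exact isEmptyElim j
    · exact Iff.rfl
  · rintro (i | i) (j | j)
    · exact isEmptyElim i
    · exact isEmptyElim i
    · exact isEmptyElim j
    · exact Iff.rfl
  · rintro (i | i)
    · exact isEmptyElim i
    · exact Iff.rfl
  · rintro (i | i)
    · exact isEmptyElim i
    · exact Iff.rfl

theorem CCov.empty_right {C D : CStr A} [IsEmpty D] : CCov (cplug C D) C := by
  refine ⟨Sum.elim _root_.id isEmptyElim, fun x => ⟨Sum.inl x, rfl⟩, ⟨?_, ?_, ?_⟩, ?_, ?_⟩
  · rintro (i | i)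
    · rfl
    · exact isEmptyElim i
  · rintro (i | i) (j | j)
    · exact Iff.rfl
    · exact isEmptyElim j
    · exact isEmptyElim i
    · exact isEmptyElim j
  · rintro (i | i) (j | j)
    · exact Iff.rfl
    · exact isEmptyElim j
    · exact isEmptyElim i
    · exact isEmptyElim j
  · rintro (i | i)
    · exact Iff.rfl
    · exact isEmptyElim i
  · rintro (i | i)
    · exact Iff.rfl
    · exact isEmptyElim i

theorem Context.hole_eq (l r : Forest A) :
    Context.hole l r = Context.leftOf l * Context.rightOf r := by
  simp [Context.leftOf, Context.rightOf, Context.hole_mul_hole]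

theorem CCov.leftOf (l : Forest A) : CCov (Context.leftOf l).str (leftS l) :=
  CCov.empty_right
theorem CCov.rightOf (r : Forest A) : CCov (Context.rightOf r).str (rightS r) :=
  CCov.empty_left

/-! ### Embeddings of forests and contexts -/

theorem IsCEmb.inr (C D : CStr A) : IsCEmb (C := D) (D := cplug C D) Sum.inr :=
  ⟨⟨fun _ => rfl, fun _ _ => Iff.rfl, fun _ _ => Iff.rfl⟩, fun _ => Iff.rfl, fun _ => Iff.rfl⟩
theorem IsEmb.inr (C : CStr A) (S : Str A) : IsEmb (S := S) (T := plug C S) Sum.inr :=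
  ⟨fun _ => rfl, fun _ _ => Iff.rfl, fun _ _ => Iff.rfl⟩

theorem CEmb.of_isEmpty (C D : CStr A) [IsEmpty C] : CEmb C D :=
  ⟨isEmptyElim, ⟨fun i => isEmptyElim i, fun i => isEmptyElim i, fun i => isEmptyElim i⟩,
    fun i => isEmptyElim i, fun i => isEmptyElim i⟩

theorem CEmb.mul {p q p' q' : Context A} (hp : CEmb p.str p'.str) (hq : CEmb q.str q'.str) :
    CEmb (p * q).str (p' * q').str :=
  (CCov.mul p q).emb_symm.trans ((CEmb.cplug_map hp hq).trans (CCov.mul p' q').emb)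

theorem Emb.smul {p p' : Context A} {s s' : Forest A} (hp : CEmb p.str p'.str)
    (hs : Emb s.str s'.str) : Emb (p • s).str (p' • s').str :=
  (Cov.smul p s).emb_symm.trans ((Emb.plug_map hp hs).trans (Cov.smul p' s').emb)

theorem CEmb.one (p : Context A) : CEmb (1 : Context A).str p.str := .of_isEmpty _ _

theorem CEmb.leftOf {s s' : Forest A} : Emb s.str s'.str →
    CEmb (Context.leftOf s).str (Context.leftOf s').str := by
  rintro ⟨f, hf⟩
  exact (CCov.leftOf s).emb.trans (CEmb.trans (T := leftS s')
    ⟨f, hf, fun _ => Iff.rfl, fun _ => Iff.rfl⟩ (CCov.leftOf s').emb_symm)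

theorem CEmb.rightOf {s s' : Forest A} : Emb s.str s'.str →
    CEmb (Context.rightOf s).str (Context.rightOf s').str := by
  rintro ⟨f, hf⟩
  exact (CCov.rightOf s).emb.trans (CEmb.trans (T := rightS s')
    ⟨f, hf, fun _ => Iff.rfl, fun _ => Iff.rfl⟩ (CCov.rightOf s').emb_symm)

/-! ### Games -/

/-- Every tuple of size at most `k` of `T` has the same atomic type over `x'` as some tuple of `S`
over `x`. -/
def Match (k : ℕ) {S T : Str A} {ι : Type*} (x : ι → S) (x' : ι → T) : Prop :=
  ∀ (κ : Type u) [Finite κ], Nat.card κ ≤ k → ∀ y' : κ → T, ∃ y : κ → S,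
    Same (Sum.elim x y) (Sum.elim x' y')

/-- The analogue of `Match` for structures with a hole. -/
def CMatch (k : ℕ) {C D : CStr A} {ι : Type*} (x : ι → C) (x' : ι → D) : Prop :=
  ∀ (κ : Type u) [Finite κ], Nat.card κ ≤ k → ∀ y' : κ → D, ∃ y : κ → C,
    CSame (Sum.elim x y) (Sum.elim x' y')

/-- Sentences `∃ x₁ ⋯ xₖ ∀ y₁ ⋯ yₖ γ` carry over from `S` to `T`. -/
def Le (k : ℕ) (S T : Str A) : Prop :=
  ∀ (ι : Type u) [Finite ι], Nat.card ι ≤ k → ∀ x : ι → S, ∃ x' : ι → T, Match k x x'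

theorem Match.mono {k m : ℕ} (h : k ≤ m) {S T : Str A} {ι : Type*} {x : ι → S} {x' : ι → T}
    (hm : Match m x x') : Match k x x' := fun κ _ hκ y' => hm κ (hκ.trans h) y'

theorem Match.refl (k : ℕ) {S : Str A} {ι : Type*} (x : ι → S) : Match k x x :=
  fun _ _ _ y => ⟨y, .refl _⟩

theorem CMatch.refl (k : ℕ) {S : CStr A} {ι : Type*} (x : ι → S) : CMatch k x x :=
  fun _ _ _ y => ⟨y, .refl _⟩

theorem Match.same {k : ℕ} {S T : Str A} {ι : Type*} {x : ι → S} {x' : ι → T}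
    (h : Match k x x') : Same x x' := by
  obtain ⟨y, hy⟩ := h PEmpty (by simp) PEmpty.elim
  exact hy.comp Sum.inl

/-- The tuple is sorted by the side on which its entries lie. The sizes add up, which is what the
pigeonhole arguments on marked nodes count. -/
theorem exists_factor {ι C S : Type u} [Finite ι] (x : ι → C ⊕ S) :
    ∃ (K₁ K₂ : Type u) (_ : Finite K₁) (_ : Finite K₂) (g : ι → K₁ ⊕ K₂) (xc : K₁ → C)
      (xs : K₂ → S), Nat.card K₁ + Nat.card K₂ = Nat.card ι ∧ x = Sum.map xc xs ∘ g := by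
  let e := Equiv.sumCompl (fun i => (x i).isLeft = true)
  refine ⟨_, _, inferInstance, inferInstance, e.symm, fun i => (x i.1).getLeft i.2,
    fun i => (x i.1).getRight (by simpa using i.2), ?_, ?_⟩
  · rw [← Nat.card_sum]
    exact Nat.card_congr e
  · rw [Equiv.eq_comp_symm]
    funext i
    rcases i with i | i
    · exact (Sum.inl_getLeft (x i.1) i.2).symm
    · exact (Sum.inr_getRight (x i.1) (by simpa using i.2)).symm

theorem elim_map_comp {C S K₁ K₂ L₁ L₂ ι κ : Type*} (xc : K₁ → C) (xs : K₂ → S) (yc : L₁ → C)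
    (ys : L₂ → S) (g : ι → K₁ ⊕ K₂) (h : κ → L₁ ⊕ L₂) :
    Sum.elim (Sum.map xc xs ∘ g) (Sum.map yc ys ∘ h) =
      Sum.map (Sum.elim xc yc) (Sum.elim xs ys) ∘
        Sum.elim (Sum.map Sum.inl Sum.inl ∘ g) (Sum.map Sum.inr Sum.inr ∘ h) := by
  ext (i | i)
  · rcases hi : g i with j | j <;> simp [hi]
  · rcases hi : h i with j | j <;> simp [hi]

/-- A challenge splits into a part in the context and a part in the forest, each of size at most
`k`, and the two are answered independently. -/
theorem Match.plug {k : ℕ} {C D : CStr A} {S T : Str A} {K₁ K₂ ι : Type*} {xc : K₁ → C}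
    {xc' : K₁ → D} {xs : K₂ → S} {xs' : K₂ → T} (hc : CMatch k xc xc') (hs : Match k xs xs')
    (g : ι → K₁ ⊕ K₂) :
    Match k (S := plug C S) (T := plug D T) (Sum.map xc xs ∘ g) (Sum.map xc' xs' ∘ g) := by
  intro κ _ hκ y'
  obtain ⟨L₁, L₂, _, _, g₂, yc', ys', hcard, rfl⟩ := exists_factor y'
  obtain ⟨yc, hyc⟩ := hc L₁ (by omega) yc'
  obtain ⟨ys, hys⟩ := hs L₂ (by omega) ys'
  refine ⟨Sum.map yc ys ∘ g₂, ?_⟩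
  have := Same.plug_map hyc hys
    (Sum.elim (Sum.map Sum.inl Sum.inl ∘ g) (Sum.map Sum.inr Sum.inr ∘ g₂))
  convert this using 1 <;> exact elim_map_comp _ _ _ _ _ _

theorem Match.map {k : ℕ} {S S' T T' : Str A} {f : S → S'} {h : T → T'} (hf : IsEmb f)
    (hs : h.Surjective) (hh : IsEmb h) {ι : Type*} {x : ι → S} {x' : ι → T}
    (hx : Match k x x') : Match k (f ∘ x) (h ∘ x') := by
  intro κ _ hκ y'
  obtain ⟨y, hy⟩ := hx κ hκ (Function.surjInv hs ∘ y')
  refine ⟨f ∘ y, ?_⟩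
  have := ((hf.same _).symm.trans hy).trans (hh.same _)
  rwa [Sum.comp_elim, Sum.comp_elim, ← Function.comp_assoc,
    (Function.rightInverse_surjInv hs).comp_eq_id, Function.id_comp] at this

theorem Le.plug {k : ℕ} (C : CStr A) {S T : Str A} (h : Le k S T) :
    Le k (plug C S) (plug C T) := by
  intro ι _ hι x
  obtain ⟨K₁, K₂, _, _, g, xc, xs, hcard, rfl⟩ := exists_factor x
  obtain ⟨xs', hxs⟩ := h K₂ (by omega) xs
  exact ⟨_, Match.plug (.refl k xc) hxs g⟩

theorem Le.cov {k : ℕ} {S S' T T' : Str A} (hS : Cov S S') (hT : Cov T T') (h : Le k S T) :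
    Le k S' T' := by
  obtain ⟨f, sf, hf⟩ := hS
  obtain ⟨g, sg, hg⟩ := hT
  intro ι _ hι x
  obtain ⟨x', hx⟩ := h ι hι (Function.surjInv sf ∘ x)
  have := Match.map hf sg hg hx
  rw [← Function.comp_assoc, (Function.rightInverse_surjInv sf).comp_eq_id,
    Function.id_comp] at this
  exact ⟨_, this⟩

theorem Le.smul {k : ℕ} (p : Context A) {s t : Forest A} (h : Le k s.str t.str) :
    Le k (p • s).str (p • t).str :=
  (h.plug p.str).cov (.smul _ _) (.smul _ _)

theorem Le.mono {k m : ℕ} (hkm : k ≤ m) {S T : Str A} (h : Le m S T) : Le k S T := by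
  intro ι _ hι x
  obtain ⟨x', hx⟩ := h ι (hι.trans hkm) x
  exact ⟨x', hx.mono hkm⟩

/-! ### Pumping powers of a context -/

/-- Every tuple of size at most `k` of `D` has the same atomic type as some tuple of `C`. -/
def SubC (k : ℕ) (D C : CStr A) : Prop :=
  ∀ (κ : Type u) [Finite κ], Nat.card κ ≤ k → ∀ y' : κ → D, ∃ y : κ → C, CSame y y'

theorem SubC.cmatch {k : ℕ} {D C : CStr A} (h : SubC k D C) {ι : Type*} [IsEmpty ι] (x : ι → C)
    (x' : ι → D) : CMatch k x x' := by
  intro κ _ hκ y'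
  obtain ⟨y, hy⟩ := h κ hκ y'
  refine ⟨y, ⟨?_, ?_, ?_⟩, ?_, ?_⟩
  · rintro (i | i)
    · exact isEmptyElim i
    · exact hy.same.lab i
  · rintro (i | i) (j | j)
    · exact isEmptyElim i
    · exact isEmptyElim i
    · exact isEmptyElim j
    · exact hy.same.anc i j
  · rintro (i | i) (j | j)
    · exact isEmptyElim i
    · exact isEmptyElim i
    · exact isEmptyElim j
    · exact hy.same.lex i j
  · rintro (i | i)
    · exact isEmptyElim i
    · exact hy.up i
  · rintro (i | i)
    · exact isEmptyElim i
    · exact hy.bef i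

theorem CEmb.subC {D C : CStr A} (h : CEmb D C) (k : ℕ) : SubC k D C := by
  obtain ⟨f, hf⟩ := h
  exact fun κ _ _ y' => ⟨f ∘ y', (hf.csame y').symm⟩

theorem SubC.trans {k : ℕ} {D C E : CStr A} (h : SubC k D C) (h' : SubC k C E) : SubC k D E := by
  intro κ _ hκ y'
  obtain ⟨y, hy⟩ := h κ hκ y'
  obtain ⟨z, hz⟩ := h' κ hκ y
  exact ⟨z, hz.trans hy⟩

/-- At most `k` copies of `q` contain an entry of the tuple, and the empty copies can be dropped. If
the outermost copy holds an entry it is kept, and at most `k - 1` entries remain for the other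
copies. -/
theorem SubC.pow (q : Context A) (n : ℕ) : ∀ k, SubC k (q ^ n).str (q ^ k).str := by
  induction n with
  | zero => exact fun k => CEmb.subC (by rw [pow_zero]; exact .one _) k
  | succ n ih =>
    intro k
    suffices h : SubC k (cplug q.str (q ^ n).str) (q ^ k).str by
      refine (CEmb.subC ?_ k).trans h
      rw [pow_succ']
      exact (CCov.mul _ _).emb_symm
    intro κ _ hκ y'
    obtain ⟨K₁, K₂, _, _, g, yc, ys, hcard, rfl⟩ := exists_factor y'
    rcases isEmpty_or_nonempty K₁ with hK | hK
    · obtain ⟨z, hz⟩ := ih k K₂ (by omega) ys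
      have hg : ∃ g₂ : κ → K₂, g = Sum.inr ∘ g₂ := by
        refine ⟨fun i => (g i).elim isEmptyElim id, funext fun i => ?_⟩
        rcases hgi : g i with j | j
        · exact isEmptyElim j
        · simp [hgi]
      obtain ⟨g₂, rfl⟩ := hg
      exact ⟨z ∘ g₂, (hz.comp g₂).trans ((IsCEmb.inr q.str (q ^ n).str).csame (ys ∘ g₂))⟩
    · have : 0 < Nat.card K₁ := Finite.card_pos
      obtain ⟨k, rfl⟩ : ∃ m, k = m + 1 := ⟨k - 1, by omega⟩
      obtain ⟨z, hz⟩ := ih k K₂ (by omega) ys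
      obtain ⟨f, hf⟩ : CEmb (cplug q.str (q ^ k).str) (q ^ (k + 1)).str := by
        rw [pow_succ']
        exact (CCov.mul q (q ^ k)).emb
      exact ⟨_, (hf.csame _).symm.trans (CSame.cplug_map (.refl yc) hz g)⟩

theorem exists_factor_smul (p : Context A) (s : Forest A) {ι : Type u} [Finite ι]
    (x : ι → (p • s).str) :
    ∃ (K₁ K₂ : Type u) (_ : Finite K₁) (_ : Finite K₂) (xc : K₁ → p.str) (xs : K₂ → s.str),
      Nat.card K₁ + Nat.card K₂ = Nat.card ι ∧ ∀ (m : ℕ) (p' : Context A) (s' : Forest A)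
        (xc' : K₁ → p'.str) (xs' : K₂ → s'.str), CMatch m xc xc' → Match m xs xs' →
          ∃ x' : ι → (p' • s').str, Match m x x' := by
  obtain ⟨f, sf, hf⟩ := Cov.smul p s
  obtain ⟨K₁, K₂, _, _, g, xc, xs, hcard, hx⟩ := exists_factor (Function.surjInv sf ∘ x)
  refine ⟨K₁, K₂, inferInstance, inferInstance, xc, xs, hcard, fun m p' s' xc' xs' hc hs => ?_⟩
  obtain ⟨h, sh, hh⟩ := Cov.smul p' s'
  refine ⟨h ∘ Sum.map xc' xs' ∘ g, ?_⟩
  convert Match.map hf sh hh (Match.plug hc hs g) using 1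
  exact funext fun i => (Function.surjInv_eq sf (x i)).symm.trans (congrArg f (congrFun hx i))

/-- Pigeonhole: `k` marks leave one of the `k + 1` copies of `Q` free, and with no marks to respect
there, `M` only needs its small tuples to occur in `Q`. The forests `t` and `t'` are variables tied
by equations, so that tuples of their nodes need not be transported. -/
theorem exists_unmarked (Q : Context A) (s : Forest A) (m k : ℕ) : ∀ t : Forest A,
    t = Q ^ (k + 1) • s → ∀ (ι : Type u) [Finite ι], Nat.card ι ≤ k → ∀ x : ι → t.str,
      ∃ a b, a + b = k ∧ ∀ M t', SubC m M.str Q.str → t' = (Q ^ a * M * Q ^ b) • s →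
        ∃ x' : ι → t'.str, Match m x x' := by
  induction k with
  | zero =>
    rintro t rfl ι _ hι
    rw [zero_add, pow_one]
    intro x
    obtain ⟨K₁, K₂, _, _, xc, xs, hcard, H⟩ := exists_factor_smul Q s x
    have : IsEmpty K₁ := Finite.card_eq_zero_iff.1 (by omega)
    refine ⟨0, 0, rfl, ?_⟩
    rintro M t' hM rfl
    rw [pow_zero, one_mul, mul_one]
    exact H m M s isEmptyElim xs (hM.cmatch _ _) (.refl _ _)
  | succ k ih =>
    rintro t rfl ι _ hι
    rw [pow_succ', mul_smul]
    intro x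
    obtain ⟨K₁, K₂, _, _, xc, xs, hcard, H⟩ := exists_factor_smul Q (Q ^ (k + 1) • s) x
    rcases isEmpty_or_nonempty K₁ with hK | hK
    · refine ⟨0, k + 1, by omega, ?_⟩
      rintro M t' hM rfl
      rw [pow_zero, one_mul, mul_smul]
      exact H m M _ isEmptyElim xs (hM.cmatch _ _) (.refl _ _)
    · have : 0 < Nat.card K₁ := Finite.card_pos
      obtain ⟨a, b, hab, h⟩ := ih _ rfl K₂ (by omega) xs
      refine ⟨a + 1, b, by omega, ?_⟩
      rintro M t' hM rfl
      obtain ⟨xs', hxs⟩ := h M _ hM rfl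
      rw [pow_succ', mul_assoc, mul_assoc, mul_smul, ← mul_assoc]
      exact H m Q _ xc xs' (.refl _ _) hxs

/-- Inserting a piece of `q` into a large power of `q` preserves sentences
`∃ x₁ ⋯ xₖ ∀ y₁ ⋯ yₖ γ`. -/
theorem Le.insert {p q : Context A} (h : CEmb p.str q.str) (k : ℕ) (s : Forest A) :
    Le k (q ^ (k * (k + 1)) • s).str
      ((q ^ (k * (k + 1)) * p * q ^ (k * (k + 1))) • s).str := by
  intro ι _ hι x
  obtain ⟨a, b, hab, H⟩ := exists_unmarked (q ^ k) s k k _ (by rw [← pow_mul]) ι hι x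
  -- Since `a + b = k`, the exponents `k * (b + 1)` and `k * (a + 1)` complete the `k * a` on the
  -- left and the `k * b` on the right to `k * (k + 1)`. Replacing `p` by `q` embeds the inserted
  -- context into a power of `q`, whose `k`-tuples occur in `q ^ k`.
  refine H (q ^ (k * (b + 1)) * p * q ^ (k * (a + 1))) _ ?_ ?_
  · refine (CEmb.subC (CEmb.mul (CEmb.mul (.refl _) h) (.refl _)) k).trans ?_
    rw [← pow_succ, ← pow_add]
    exact SubC.pow q _ k
  · congr 1
    rw [← pow_mul, ← pow_mul]
    simp only [← mul_assoc]
    rw [← pow_add, mul_assoc _ (q ^ _) (q ^ _), ← pow_add]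
    congr 3 <;> subst hab <;> ring

/-! ### `Σ₂` sentences and games -/

theorem Match.comp {k : ℕ} {S T : Str A} {ι ι' : Type*} {x : ι → S} {x' : ι → T}
    (h : Match k x x') (g : ι' → ι) : Match k (x ∘ g) (x' ∘ g) := by
  intro κ _ hκ y'
  obtain ⟨y, hy⟩ := h κ hκ y'
  refine ⟨y, ?_⟩
  have := hy.comp (Sum.map g id)
  rwa [Sum.elim_comp_map, Sum.elim_comp_map] at this

theorem exists_eq_var {n : ℕ} (t : (forestLanguage A).Term (Empty ⊕ Fin n)) :
    ∃ i, t = Term.var (Sum.inr i) := by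
  cases t with
  | var i =>
    rcases i with i | i
    · exact i.elim
    · exact ⟨i, rfl⟩
  | func f ts => exact nomatch f

/-- On forests `Lex` is irreflexive and total, so equality is the absence of `Lex` in both
directions. This is why `Same` has no clause for equality. -/
theorem Same.eq_iff {s t : Forest A} {ι : Type*} {x : ι → s.str} {y : ι → t.str}
    (h : Same x y) (i j : ι) : x i = x j ↔ y i = y j := by
  constructor
  · intro e
    refine Node.eq_of_not_lex _ _ (fun hl => ?_) (fun hl => ?_)
    · have := (h.lex i j).2 hl
      rw [e] at this
      exact Node.lex_irrefl _ this
    · have := (h.lex j i).2 hl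
      rw [e] at this
      exact Node.lex_irrefl _ this
  · intro e
    refine Node.eq_of_not_lex _ _ (fun hl => ?_) (fun hl => ?_)
    · have := (h.lex i j).1 hl
      rw [e] at this
      exact Node.lex_irrefl _ this
    · have := (h.lex j i).1 hl
      rw [e] at this
      exact Node.lex_irrefl _ this

theorem realize_iff_of_same {n : ℕ} {φ : (forestLanguage A).BoundedFormula Empty n}
    (hφ : φ.IsQF) {s t : Forest A} {v : Fin n → s.str} {v' : Fin n → t.str} (h : Same v v') :
    φ.Realize (M := s.Node) default v ↔ φ.Realize (M := t.Node) default v' := by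
  induction hφ with
  | falsum => exact Iff.rfl
  | of_isAtomic ha =>
    cases ha with
    | equal t₁ t₂ =>
      obtain ⟨i, rfl⟩ := exists_eq_var t₁
      obtain ⟨j, rfl⟩ := exists_eq_var t₂
      exact h.eq_iff i j
    | rel R ts =>
      choose g hg using fun i => exists_eq_var (ts i)
      obtain rfl : ts = fun i => Term.var (Sum.inr (g i)) := funext hg
      cases R with
      | label a =>
        change s.str.lab (v (g 0)) = a ↔ t.str.lab (v' (g 0)) = a
        rw [h.lab]
      | anc => exact h.anc (g 0) (g 1)
      | lex => exact h.lex (g 0) (g 1)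
  | imp _ _ ih₁ ih₂ => exact imp_congr ih₁ ih₂

/-- Adding a variable to a tuple. -/
def snocIndex (n : ℕ) (κ : Type*) : Fin (n + 1) ⊕ κ → Fin n ⊕ Option κ :=
  Sum.elim (Fin.lastCases (Sum.inr none) Sum.inl) (Sum.inr ∘ some)

theorem elim_comp_snocIndex {n : ℕ} {κ M : Type*} (v : Fin n → M) (y : Option κ → M) :
    Sum.elim v y ∘ snocIndex n κ = Sum.elim (Fin.snoc v (y none)) (y ∘ some) := by
  ext (i | i)
  · refine Fin.lastCases ?_ (fun i => ?_) i <;> simp [snocIndex]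
  · rfl

/-- A universal formula fails because of boundedly many nodes, and any tuple of the same atomic type
is again a counterexample. The bound `k` counts the quantifiers. -/
theorem exists_witness_of_isUniversal {n : ℕ} {φ : (forestLanguage A).BoundedFormula Empty n}
    (hφ : φ.IsUniversal) : ∃ k : ℕ, ∀ (t : Forest A) (v' : Fin n → t.str),
      ¬ φ.Realize (M := t.Node) default v' → ∃ (κ : Type u) (_ : Finite κ) (y' : κ → t.str),
        Nat.card κ ≤ k ∧ ∀ (s : Forest A) (v : Fin n → s.str) (y : κ → s.str),
          Same (Sum.elim v y) (Sum.elim v' y') → ¬ φ.Realize (M := s.Node) default v := by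
  induction hφ with
  | of_isQF h =>
    refine ⟨0, fun t v' hv => ⟨PEmpty, inferInstance, PEmpty.elim, by simp, ?_⟩⟩
    intro s v y hs
    exact fun hr => hv ((realize_iff_of_same h (hs.comp Sum.inl)).1 hr)
  | @all n φ _ ih =>
    obtain ⟨k, ih⟩ := ih
    refine ⟨k + 1, fun t v' hv => ?_⟩
    obtain ⟨b, hb⟩ := not_forall.1 fun hh => hv (BoundedFormula.realize_all.2 hh)
    obtain ⟨κ, _, y', hκ, H⟩ := ih t _ hb
    refine ⟨Option κ, inferInstance, fun o => o.elim b y', ?_, ?_⟩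
    · rw [Finite.card_option]
      omega
    · intro s v y hs hall
      have h1 := hs.comp (snocIndex n κ)
      rw [elim_comp_snocIndex, elim_comp_snocIndex] at h1
      exact H s _ _ h1 (BoundedFormula.realize_all.1 hall (y none))

theorem exists_marks_of_isExistsForall {n : ℕ}
    {φ : (forestLanguage A).BoundedFormula Empty n} (hφ : IsExistsForall φ) :
    ∃ k : ℕ, ∀ (s : Forest A) (v : Fin n → s.str), φ.Realize (M := s.Node) default v →
      ∃ (ι : Type u) (_ : Finite ι) (x : ι → s.str), Nat.card ι ≤ k ∧
        ∀ (t : Forest A) (v' : Fin n → t.str) (x' : ι → t.str),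
          Match k (Sum.elim v x) (Sum.elim v' x') → φ.Realize (M := t.Node) default v' := by
  induction hφ with
  | of_isUniversal h =>
    obtain ⟨k, H⟩ := exists_witness_of_isUniversal h
    refine ⟨k, fun s v hv => ⟨PEmpty, inferInstance, PEmpty.elim, by simp, ?_⟩⟩
    intro t v' x' hm
    by_contra hcon
    obtain ⟨κ, _, y', hκ, H⟩ := H t v' hcon
    obtain ⟨y, hy⟩ := hm κ hκ y'
    refine H s v y ?_ hv
    have := hy.comp (Sum.map Sum.inl id)
    rwa [Sum.elim_comp_map, Sum.elim_comp_map] at this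
  | @ex n φ _ ih =>
    obtain ⟨k, ih⟩ := ih
    refine ⟨k + 1, fun s v hv => ?_⟩
    obtain ⟨b, hb⟩ := BoundedFormula.realize_ex.1 hv
    obtain ⟨ι, _, x, hι, H⟩ := ih s _ hb
    refine ⟨Option ι, inferInstance, fun o => o.elim b x, ?_, ?_⟩
    · rw [Finite.card_option]
      omega
    · intro t v' x' hm
      have h1 := (hm.mono (Nat.le_succ k)).comp (snocIndex n ι)
      rw [elim_comp_snocIndex, elim_comp_snocIndex] at h1
      exact BoundedFormula.realize_ex.2 ⟨x' none, H t _ _ h1⟩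

theorem IsSigmaTwo.exists_le {φ : (forestLanguage A).Sentence} (hφ : IsSigmaTwo φ) :
    ∃ k : ℕ, ∀ s t : Forest A, Le k s.str t.str → s.Node ⊨ φ → t.Node ⊨ φ := by
  induction hφ with
  | prenex h =>
    obtain ⟨k, H⟩ := exists_marks_of_isExistsForall h
    refine ⟨k, fun s t hst hs => ?_⟩
    obtain ⟨ι, _, x, hι, H⟩ := H s default hs
    obtain ⟨x', hx⟩ := hst ι hι x
    refine H t default x' ?_
    have := hx.comp (Sum.elim Fin.elim0 id : Fin 0 ⊕ ι → ι)
    have e : ∀ {M : Type u} (v : Fin 0 → M) (y : ι → M),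
        y ∘ (Sum.elim Fin.elim0 id : Fin 0 ⊕ ι → ι) = Sum.elim v y := by
      intro M v y
      ext (i | i)
      · exact i.elim0
      · rfl
    rwa [e default x, e default x'] at this
  | or _ _ ih₁ ih₂ =>
    obtain ⟨k₁, H₁⟩ := ih₁
    obtain ⟨k₂, H₂⟩ := ih₂
    refine ⟨max k₁ k₂, fun s t hst hs => ?_⟩
    exact BoundedFormula.realize_sup.2 ((BoundedFormula.realize_sup.1 hs).imp
      (H₁ s t (hst.mono (le_max_left _ _))) (H₂ s t (hst.mono (le_max_right _ _))))
  | and _ _ ih₁ ih₂ =>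
    obtain ⟨k₁, H₁⟩ := ih₁
    obtain ⟨k₂, H₂⟩ := ih₂
    refine ⟨max k₁ k₂, fun s t hst hs => ?_⟩
    exact BoundedFormula.realize_inf.2 ((BoundedFormula.realize_inf.1 hs).imp
      (H₁ s t (hst.mono (le_max_left _ _))) (H₂ s t (hst.mono (le_max_right _ _))))

/-- The first sentence carries membership from `s` to `t`. The `Σ₂` sentence negated in the `Π₂` one
carries non-membership. The one-sided relation `Le` therefore gives an equivalence. -/
theorem DeltaTwoDefinable.exists_le {L : Set (Forest A)} (h : DeltaTwoDefinable L) :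
    ∃ k : ℕ, ∀ s t : Forest A, Le k s.str t.str → (s ∈ L ↔ t ∈ L) := by
  obtain ⟨⟨φ, hφ, rfl⟩, ⟨_, ⟨ψ, hψ, rfl⟩, hL⟩⟩ := h
  obtain ⟨k₁, H₁⟩ := hφ.exists_le
  obtain ⟨k₂, H₂⟩ := hψ.exists_le
  refine ⟨max k₁ k₂, fun s t hst => ⟨H₁ s t (hst.mono (le_max_left _ _)), fun ht => ?_⟩⟩
  rw [hL] at ht ⊢
  exact fun hs => ht (H₂ s t (hst.mono (le_max_right _ _)) hs)

theorem DeltaTwoDefinable.exists_le_forestCon {L : Set (Forest A)} (h : DeltaTwoDefinable L) :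
    ∃ k : ℕ, ∀ s t : Forest A, Le k s.str t.str → forestCon L s t := by
  obtain ⟨k, H⟩ := h.exists_le
  exact ⟨k, fun s t hst p => H _ _ (hst.smul p)⟩

/-! ### Finiteness of the syntactic forest algebra -/

/-- Atomic types of tuples indexed by `J`. -/
abbrev AtomType (A : Type u) (J : Type) : Type u :=
  (J → A) × (J → J → Prop) × (J → J → Prop)

/-- The atomic type of a tuple. -/
def atomType {S : Str A} {J : Type} (z : J → S) : AtomType A J :=
  (fun i => S.lab (z i), fun i j => S.anc (z i) (z j), fun i j => S.lex (z i) (z j))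

theorem atomType_eq_iff {S T : Str A} {J : Type} {z : J → S} {z' : J → T} :
    atomType z = atomType z' ↔ Same z z' := by
  simp only [atomType, Prod.mk.injEq, funext_iff, eq_iff_iff]
  exact ⟨fun h => ⟨h.1, h.2.1, h.2.2⟩, fun h => ⟨h.1, h.2, h.3⟩⟩

/-- The atomic types realized over a tuple. -/
def extTypes (k : ℕ) {S : Str A} {n : ℕ} (x : Fin n → S) :
    (m : Fin (k + 1)) → Set (AtomType A (Fin n ⊕ Fin m)) :=
  fun m => Set.range fun y : Fin m → S => atomType (Sum.elim x y)

/-- A finite invariant of structures that determines the truth of all sentences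
`∃ x₁ ⋯ xₖ ∀ y₁ ⋯ yₖ γ`. -/
def gameType (k : ℕ) (S : Str A) :
    (n : Fin (k + 1)) → Set ((m : Fin (k + 1)) → Set (AtomType A (Fin n ⊕ Fin m))) :=
  fun _ => Set.range fun x => extTypes k (S := S) x

theorem match_of_extTypes_eq {k n : ℕ} {S T : Str A} {x : Fin n → S} {x' : Fin n → T}
    (h : extTypes k x = extTypes k x') : Match k x x' := by
  intro κ _ hκ y'
  let e := Finite.equivFin κ
  have h1 : atomType (Sum.elim x' (y' ∘ e.symm)) ∈ extTypes k x' ⟨Nat.card κ, by omega⟩ :=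
    ⟨_, rfl⟩
  rw [← h] at h1
  obtain ⟨y, hy⟩ := h1
  refine ⟨y ∘ e, ?_⟩
  have := (atomType_eq_iff.1 hy).comp (Sum.map id e)
  rw [Sum.elim_comp_map, Sum.elim_comp_map, Function.comp_assoc, e.symm_comp_self] at this
  exact this

theorem le_of_gameType_eq {k : ℕ} {S T : Str A} (h : gameType k S = gameType k T) : Le k S T := by
  intro ι _ hι x
  let e := Finite.equivFin ι
  have h1 : extTypes k (x ∘ e.symm) ∈ gameType k S ⟨Nat.card ι, by omega⟩ := ⟨_, rfl⟩
  rw [h] at h1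
  obtain ⟨x', hx⟩ := h1
  refine ⟨x' ∘ e, ?_⟩
  have := (match_of_extTypes_eq hx.symm).comp e
  rwa [Function.comp_assoc, e.symm_comp_self] at this

/-- Over a finite alphabet `gameType k` has finitely many values, and forests with the same value
are syntactically equivalent. -/
theorem DeltaTwoDefinable.finite_forestType [Finite A] {L : Set (Forest A)}
    (h : DeltaTwoDefinable L) : Finite (ForestType L) := by
  classical
  obtain ⟨k, H⟩ := h.exists_le_forestCon
  let f : ForestType L → _ := fun h => gameType k (Quotient.out h).str
  refine Finite.of_injective f fun x y hxy => ?_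
  rw [← Quotient.out_eq x, ← Quotient.out_eq y]
  exact Quotient.sound (H _ _ (le_of_gameType_eq hxy))

theorem finite_contextType {L : Set (Forest A)} [Finite (ForestType L)] :
    Finite (ContextType L) :=
  Finite.of_injective (fun (v : ContextType L) (h : ForestType L) => v • h) fun _ _ h =>
    FaithfulSMul.eq_of_smul_eq_smul fun a : ForestType L => congrFun h a

theorem ForestAlgebraHom.map_hole {H : Type w} {V : Type x} [AddMonoid H] [Monoid V]
    [ForestAlgebra H V] (α : ForestAlgebraHom (Forest A) (Context A) H V) (l r : Forest A) :
    α.onContexts (Context.hole l r) =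
      ForestAlgebra.leftOf (α.onForests l) * ForestAlgebra.rightOf (α.onForests r) := by
  rw [Context.hole_eq, map_mul]
  exact congrArg₂ _ (α.map_leftOf l) (α.map_rightOf r)

/-! ### The identity -/

section Subst

variable {B : Type v} (c : B → Context A)

/-- Substitution of the contexts `c b` for the letters `b`. -/
def Forest.subst : Forest B → Forest A
  | .nil => 0
  | .cons b s t => c b • subst s + subst t

theorem Forest.subst_add (s t : Forest B) : (s + t).subst c = s.subst c + t.subst c := by
  induction s with
  | nil => exact (zero_add _).symm
  | cons b s u _ ih => simp only [Forest.cons_add, Forest.subst, ih, add_assoc]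

/-- Substitution of the contexts `c b` for the letters `b`. -/
def Context.subst : Context B → Context A
  | .hole l r => .hole (l.subst c) (r.subst c)
  | .node l b p r => .hole (l.subst c) (r.subst c) * (c b * subst p)

theorem Forest.subst_smul (p : Context B) (s : Forest B) :
    (p • s).subst c = p.subst c • s.subst c := by
  induction p with
  | hole l r => simp [Context.hole_smul, Context.subst, Forest.subst_add]
  | node l b p r ih =>
    simp [Context.node_smul, Context.subst, Forest.subst_add, mul_smul, Context.hole_smul,
      Forest.tree, Forest.subst, ih, ← Forest.nil_eq_zero]
    simp

theorem Context.subst_mul (p q : Context B) : (p * q).subst c = p.subst c * q.subst c := by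
  induction p with
  | hole l r =>
    cases q with
    | hole l' r' => simp [Context.hole_mul_hole, Context.subst, Forest.subst_add]
    | node l' b q r' =>
      rw [Context.hole_mul_node, Context.subst, Context.subst, Context.subst,
        ← mul_assoc (Context.hole _ _) (Context.hole _ _), Context.hole_mul_hole,
        Forest.subst_add, Forest.subst_add]
  | node l b p r ih => simp only [Context.node_mul, Context.subst, ih, mul_assoc]

/-- Removing a node labelled `b` replaces the inserted context `c b` by `1`, which has no nodes and
embeds anywhere. -/
theorem CEmb.of_isPiece_subst {p q : Context B} (h : p.IsPiece q) :
    CEmb (p.subst c).str (q.subst c).str := by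
  have hf : ∀ s s' : Forest B, s.IsImmediatePiece s' →
      Emb (s.subst c).str (s'.subst c).str := by
    rintro _ _ ⟨p, a, t, rfl, rfl⟩
    rw [Forest.subst_smul, Forest.subst_smul, Context.subst_mul]
    refine Emb.smul ?_ (.refl _)
    nth_rewrite 1 [← mul_one (p.subst c)]
    exact CEmb.mul (.refl _) (.one _)
  induction h with
  | refl => exact .refl _
  | tail _ h ih =>
    refine ih.trans ?_
    cases h with
    | path p q a =>
      rw [Context.subst_mul, Context.subst_mul, Context.subst_mul]
      refine CEmb.mul ?_ (.refl _)
      nth_rewrite 1 [← mul_one (p.subst c)]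
      exact CEmb.mul (.refl _) (.one _)
    | left p q h =>
      simp only [Context.subst_mul]
      exact CEmb.mul (CEmb.mul (.refl _) (CEmb.leftOf (hf _ _ h))) (.refl _)
    | right p q h =>
      simp only [Context.subst_mul]
      exact CEmb.mul (CEmb.mul (.refl _) (CEmb.rightOf (hf _ _ h))) (.refl _)

variable {L : Set (Forest A)}
  (α : ForestAlgebraHom (Forest B) (Context B) (ForestType L) (ContextType L))

theorem mk_forest_subst (hc : ∀ b, ((c b : Context A) : ContextType L) =
      α.onContexts (Context.letter b)) (s : Forest B) :
    ((s.subst c : Forest A) : ForestType L) = α.onForests s := by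
  induction s with
  | nil => exact (map_zero α.onForests).symm
  | cons b s t ihs iht =>
    have h1 : Forest.cons b s t = Context.letter b • s + t := by
      simp [Context.letter, Context.node_smul, Forest.tree, ← Forest.nil_eq_zero]
    rw [h1, map_add, α.map_smul, ← hc, ← ihs, ← iht, ← h1]
    rfl

theorem mk_context_subst (hc : ∀ b, ((c b : Context A) : ContextType L) =
      α.onContexts (Context.letter b)) (p : Context B) :
    ((p.subst c : Context A) : ContextType L) = α.onContexts p := by
  have hole : ∀ l r : Forest B, ((Context.hole (l.subst c) (r.subst c) : Context A) :
      ContextType L) = α.onContexts (Context.hole l r) := by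
    intro l r
    rw [α.map_hole, Context.hole_eq, ← mk_forest_subst c α hc, ← mk_forest_subst c α hc]
    rfl
  induction p with
  | hole l r => exact hole l r
  | node l b p r ih =>
    have h1 : Context.node l b p r = Context.hole l r * (Context.letter b * p) := by
      simp [Context.letter, Context.node_mul, Context.hole_mul_node]
    rw [h1, map_mul, map_mul, ← hole, ← hc, ← ih, ← h1]
    rfl

end Subst

theorem DeltaTwoDefinable.identity {L : Set (Forest A)} (h : DeltaTwoDefinable L)
    [Finite (ContextType L)] : SatisfiesDeltaTwoIdentity (ForestType L) (ContextType L) := by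
  obtain ⟨k, H⟩ := h.exists_le_forestCon
  obtain ⟨n, hn⟩ := exists_isOmega (ContextType L)
  refine ⟨n, hn, ?_⟩
  rintro v w ⟨B, _, α, p, q, hpq, rfl, rfl⟩
  -- A morphism from the free algebra over `B` lifts to a substitution of contexts over `A` for the
  -- letters of `B`, which turns pieces into embeddings of contexts over `A`.
  choose c hc using fun b => Quotient.exists_rep (α.onContexts (Context.letter b))
  have key : ∀ p' q' : Context A, CEmb p'.str q'.str →
      (q' : ContextType L) ^ ((k + 1) * (k + 2)) * p' * (q' : ContextType L) ^ ((k + 1) * (k + 2)) =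
        (q' : ContextType L) ^ ((k + 1) * (k + 2)) := by
    intro p' q' hpq
    refine Eq.symm (Quotient.sound fun s => H _ _ ?_)
    exact (Le.insert hpq (k + 1) s).mono (Nat.le_succ k)
  rw [← mk_context_subst c α hc, ← mk_context_subst c α hc]
  have h1 := key _ _ (CEmb.of_isPiece_subst c hpq)
  -- Inserting the piece `1` shows that this power of `v` is idempotent, so it equals `v ^ n`.
  -- Working with `k + 1` keeps the exponent positive.
  have h2 := key _ _ (CEmb.one (q.subst c))
  set v := ((q.subst c : Context A) : ContextType L)
  have h3 : IsIdempotentElem (v ^ ((k + 1) * (k + 2))) := by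
    simpa [IsIdempotentElem] using h2
  have h4 : v ^ ((k + 1) * (k + 2)) = v ^ n := by
    rw [← h3.pow_eq hn.1.ne', ← (hn.2 v).pow_eq (n := (k + 1) * (k + 2)) (by positivity),
      ← pow_mul, ← pow_mul, mul_comm]
  rwa [h4] at h1

/-! ### Embedded forests are pieces -/

theorem Emb.of_range {S T U : Str A} {f : S → U} {g : T → U} (hf : IsEmb f) (hg : IsEmb g)
    (h : ∀ a, ∃ b, g b = f a) : Emb S T := by
  choose k hk using h
  refine ⟨k, Same.trans hf ?_⟩
  have := (hg.same k).symm
  rwa [show g ∘ k = f from funext hk] at this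

theorem CEmb.of_range {S T U : CStr A} {f : S → U} {g : T → U} (hf : IsCEmb f) (hg : IsCEmb g)
    (h : ∀ a, ∃ b, g b = f a) : CEmb S T := by
  choose k hk using h
  refine ⟨k, CSame.trans hf ?_⟩
  have := (hg.csame k).symm
  rwa [show g ∘ k = f from funext hk] at this

/-- The piece relation on forests. -/
def Forest.IsPiece (s t : Forest A) : Prop := Relation.ReflTransGen Forest.IsImmediatePiece s t

theorem Forest.cons_eq_inside (a : A) (s t : Forest A) :
    Forest.cons a s t = (Context.rightOf t * Context.letter a) • s := by
  simp [Context.letter, Context.rightOf, mul_smul, Context.node_smul, Context.hole_smul,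
    Forest.tree, ← Forest.nil_eq_zero]

theorem Forest.cons_eq_after (a : A) (s t : Forest A) :
    Forest.cons a s t = Context.leftOf (Forest.tree a s) • t := by
  simp [Context.leftOf, Context.hole_smul, Forest.tree]

theorem Context.rightOf_smul (s t : Forest A) : Context.rightOf t • s = s + t := by
  simp [Context.rightOf, Context.hole_smul]

theorem Forest.IsPiece.smul {s t : Forest A} (h : s.IsPiece t) (p : Context A) :
    (p • s).IsPiece (p • t) := by
  refine Relation.ReflTransGen.lift (fun s => p • s) ?_ _ _ h
  rintro _ _ ⟨q, a, r, rfl, rfl⟩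
  exact ⟨p * q, a, r, by rw [mul_smul], by simp [mul_smul]⟩

theorem Forest.IsPiece.cons {a : A} {s t s' t' : Forest A} (hs : s.IsPiece s')
    (ht : t.IsPiece t') : (Forest.cons a s t).IsPiece (Forest.cons a s' t') := by
  refine Relation.ReflTransGen.trans (b := Forest.cons a s' t) ?_ ?_
  · rw [Forest.cons_eq_inside, Forest.cons_eq_inside]
    exact hs.smul _
  · rw [Forest.cons_eq_after, Forest.cons_eq_after]
    exact ht.smul _

theorem Forest.isImmediatePiece_add_cons (a : A) (s t : Forest A) :
    (s + t).IsImmediatePiece (Forest.cons a s t) :=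
  ⟨Context.rightOf t, a, s, (Context.rightOf_smul s t).symm, Forest.cons_eq_inside a s t⟩

theorem isEmb_inside (a : A) (s t : Forest A) :
    IsEmb (S := s.str) (T := (Forest.cons a s t).str) inside :=
  ⟨fun _ => rfl, fun _ _ => Iff.rfl, fun i j => (Forest.Node.lex_inside i j).symm⟩

theorem isEmb_after (a : A) (s t : Forest A) :
    IsEmb (S := t.str) (T := (Forest.cons a s t).str) after :=
  ⟨fun _ => rfl, fun _ _ => Iff.rfl, fun i j => (Forest.Node.lex_after i j).symm⟩

theorem isEmb_inside_after (a : A) (s t : Forest A) :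
    IsEmb (S := plug (leftS s) t.str) (T := (Forest.cons a s t).str)
      (Sum.elim inside after) := by
  refine ⟨?_, ?_, ?_⟩
  · rintro (i | i) <;> rfl
  · rintro (i | i) (j | j) <;> exact Iff.rfl
  · rintro (i | i) (j | j)
    · exact (Forest.Node.lex_inside i j).symm
    · exact iff_of_true trivial (lex_inside_after i j)
    · exact iff_of_false (fun h => h trivial) (not_lex_after_inside i j)
    · exact (Forest.Node.lex_after i j).symm

/-- The first root of `t` is its `Lex`-minimum. If the embedding hits it, the preimage is the first
root of `s`; descendants of the root go to descendants and the other nodes to other nodes, so the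
two parts are treated separately. If the embedding misses it, that root can be removed from `t`. -/
theorem Forest.isPiece_of_emb (n : ℕ) : ∀ {s t : Forest A}, t.size = n → Emb s.str t.str →
    s.IsPiece t := by
  induction n using Nat.strong_induction_on with
  | _ n ih =>
  rintro s t rfl ⟨f, hf⟩
  cases t with
  | nil =>
    cases s with
    | nil => exact .refl
    | cons b s₁ s₂ => exact isEmptyElim (show (0 : Forest A).str from f root)
  | cons a t₁ t₂ =>
    by_cases hz : ∃ z, f z = root
    · obtain ⟨z, hz⟩ := hz
      cases s with
      | nil => exact isEmptyElim (show (0 : Forest A).str from z)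
      | cons b s₁ s₂ =>
        obtain rfl : z = root := by
          refine Node.eq_of_not_lex _ _ (not_lex_root _) fun h => ?_
          have := (hf.lex _ _).1 h
          rw [hz] at this
          exact not_lex_root _ this
        obtain rfl : b = a := by
          have := hf.lab root
          rw [hz] at this
          exact this
        refine Forest.IsPiece.cons (ih t₁.size ?_ rfl ?_) (ih t₂.size ?_ rfl ?_)
        · simp only [Forest.size]; omega
        · refine Emb.of_range (hf.comp (isEmb_inside b s₁ s₂)) (isEmb_inside b t₁ t₂) fun x => ?_
          have := (hf.anc root (inside x)).1 trivial
          rw [hz] at this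
          rcases hfx : f (inside x) with _ | y | y
          · rw [hfx] at this
            exact (not_ancestor_root _ this).elim
          · exact ⟨y, hfx.symm⟩
          · rw [hfx] at this
            exact (not_ancestor_root_after _ this).elim
        · simp only [Forest.size]; omega
        · refine Emb.of_range (hf.comp (isEmb_after b s₁ s₂)) (isEmb_after b t₁ t₂) fun x => ?_
          have h1 := (hf.lex root (after x)).1 (lex_root_after x)
          have h2 := (hf.anc root (after x)).2
          rw [hz] at h1 h2
          rcases hfx : f (after x) with _ | y | y
          · rw [hfx] at h1
            exact (not_lex_root _ h1).elim
          · rw [hfx] at h2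
            exact (h2 trivial).elim
          · exact ⟨y, hfx.symm⟩
    · push Not at hz
      refine Relation.ReflTransGen.tail (ih (t₁ + t₂).size ?_ rfl ?_)
        (Forest.isImmediatePiece_add_cons a t₁ t₂)
      · rw [Forest.size_add]
        simp only [Forest.size]; omega
      · refine Emb.trans (Emb.of_range hf (isEmb_inside_after a t₁ t₂) fun x => ?_)
          (Cov.left t₁ t₂).emb
        rcases hfx : f x with _ | y | y
        · exact (hz x hfx).elim
        · exact ⟨.inl y, rfl⟩
        · exact ⟨.inr y, rfl⟩

theorem Emb.isPiece {s t : Forest A} (h : Emb s.str t.str) : s.IsPiece t :=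
  Forest.isPiece_of_emb _ rfl h

/-! ### Embedded contexts are pieces -/

theorem Context.IsPiece.mul_left {p q : Context A} (h : p.IsPiece q) (c : Context A) :
    (c * p).IsPiece (c * q) := by
  refine Relation.ReflTransGen.lift (fun p => c * p) ?_ _ _ h
  rintro _ _ (⟨p, q, a⟩ | ⟨p, q, h⟩ | ⟨p, q, h⟩)
  · simpa only [mul_assoc, Function.onFun] using Context.IsImmediatePiece.path (c * p) q a
  · simpa only [mul_assoc, Function.onFun] using Context.IsImmediatePiece.left (c * p) q h
  · simpa only [mul_assoc, Function.onFun] using Context.IsImmediatePiece.right (c * p) q h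

theorem Context.IsPiece.mul_right {p q : Context A} (h : p.IsPiece q) (c : Context A) :
    (p * c).IsPiece (q * c) := by
  refine Relation.ReflTransGen.lift (fun p => p * c) ?_ _ _ h
  rintro _ _ (⟨p, q, a⟩ | ⟨p, q, h⟩ | ⟨p, q, h⟩)
  · simpa only [mul_assoc, Function.onFun] using Context.IsImmediatePiece.path p (q * c) a
  · simpa only [mul_assoc, Function.onFun] using Context.IsImmediatePiece.left p (q * c) h
  · simpa only [mul_assoc, Function.onFun] using Context.IsImmediatePiece.right p (q * c) h

theorem Context.IsPiece.mul {p q p' q' : Context A} (h : p.IsPiece q) (h' : p'.IsPiece q') :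
    (p * p').IsPiece (q * q') :=
  (h.mul_right p').trans (h'.mul_left q)

theorem Context.isPiece_leftOf {s t : Forest A} (h : s.IsPiece t) :
    (Context.leftOf s).IsPiece (Context.leftOf t) := by
  refine Relation.ReflTransGen.lift Context.leftOf ?_ _ _ h
  intro s t h
  simpa using Context.IsImmediatePiece.left 1 1 h

theorem Context.isPiece_rightOf {s t : Forest A} (h : s.IsPiece t) :
    (Context.rightOf s).IsPiece (Context.rightOf t) := by
  refine Relation.ReflTransGen.lift Context.rightOf ?_ _ _ h
  intro s t h
  simpa using Context.IsImmediatePiece.right 1 1 h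

/-- The case distinction on the first root of a context. -/
theorem Context.first_cases (p : Context A) :
    (∃ r, p = Context.rightOf r) ∨
      (∃ a l p', p = Context.leftOf (Forest.tree a l) * p') ∨
        ∃ r a p', p = Context.rightOf r * (Context.letter a * p') := by
  cases p with
  | hole l r =>
    cases l with
    | nil => exact Or.inl ⟨r, rfl⟩
    | cons a s t =>
      refine Or.inr (Or.inl ⟨a, s, .hole t r, ?_⟩)
      simp [Context.leftOf, Context.hole_mul_hole, Forest.tree]
  | node l a p r =>
    cases l with
    | nil =>
      refine Or.inr (Or.inr ⟨r, a, p, ?_⟩)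
      simp [Context.rightOf, Context.letter, Context.hole_mul_node, Context.node_mul]
    | cons b s t =>
      refine Or.inr (Or.inl ⟨b, s, .node t a p r, ?_⟩)
      simp [Context.leftOf, Context.hole_mul_node, Forest.tree]

theorem Context.size_mul (p q : Context A) : (p * q).size = p.size + q.size := by
  induction p with
  | hole l r =>
    cases q <;> simp only [Context.hole_mul_hole, Context.hole_mul_node, Context.size,
      Forest.size_add] <;> omega
  | node l a p r ih =>
    simp only [Context.node_mul, Context.size, ih]
    omega

@[simp] theorem Forest.size_zero : (0 : Forest A).size = 0 := rfl
@[simp] theorem Context.size_leftOf (l : Forest A) : (Context.leftOf l).size = l.size := rfl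
@[simp] theorem Context.size_rightOf (r : Forest A) : (Context.rightOf r).size = r.size := by
  simp [Context.rightOf, Context.size]
@[simp] theorem Context.size_letter (a : A) : (Context.letter a).size = 1 := rfl
@[simp] theorem Forest.size_tree (a : A) (s : Forest A) : (Forest.tree a s).size = s.size + 1 :=
  rfl

theorem CCov.leftOf_symm (l : Forest A) : CCov (leftS l) (Context.leftOf l).str := by
  refine ⟨Sum.inl, ?_, ⟨⟨fun _ => rfl, fun _ _ => Iff.rfl, fun _ _ => Iff.rfl⟩,
    fun _ => Iff.rfl, fun _ => Iff.rfl⟩⟩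
  rintro (x | x)
  exacts [⟨x, rfl⟩, isEmptyElim (show (0 : Forest A).str from x)]

/-- The structure of `a s + □`. -/
def treeS (a : A) (s : Forest A) : CStr A :=
  ⟨plug (letterS a) s.str, fun _ => False, fun _ => True⟩

theorem CCov.treeOf (a : A) (s : Forest A) :
    CCov (treeS a s) (Context.leftOf (Forest.tree a s)).str := by
  obtain ⟨f, sf, hf⟩ := Cov.letter a s
  exact CCov.trans (T := leftS (Forest.tree a s)) ⟨f, sf, hf, fun _ => Iff.rfl, fun _ => Iff.rfl⟩
    (CCov.leftOf_symm _)

theorem CCov.leftOf_tree_mul (a : A) (l : Forest A) (p : Context A) :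
    CCov (cplug (treeS a l) p.str) (Context.leftOf (Forest.tree a l) * p).str :=
  (CCov.cplug_map (.treeOf a l) (.refl _)).trans (.mul _ _)

theorem CCov.rightOf_symm (r : Forest A) : CCov (rightS r) (Context.rightOf r).str := by
  refine ⟨Sum.inr, ?_, IsCEmb.inr _ _⟩
  rintro (x | x)
  exacts [isEmptyElim (show (0 : Forest A).str from x), ⟨x, rfl⟩]

theorem CCov.letterOf_symm (a : A) : CCov (letterS a) (Context.letter a).str := by
  refine ⟨fun x => .inr (.inl x), ?_, ⟨⟨fun _ => rfl, fun _ _ => Iff.rfl, fun _ _ => Iff.rfl⟩,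
      fun _ => Iff.rfl, fun _ => Iff.rfl⟩⟩
  rintro ((x | x) | (x | (x | x)))
  · exact isEmptyElim (show (0 : Forest A).str from x)
  · exact isEmptyElim (show (0 : Forest A).str from x)
  · exact ⟨x, rfl⟩
  · exact isEmptyElim (show (0 : Forest A).str from x)
  · exact isEmptyElim (show (0 : Forest A).str from x)

theorem CCov.rightOf_letter_mul (r : Forest A) (a : A) (p : Context A) :
    CCov (cplug (rightS r) (cplug (letterS a) p.str))
      (Context.rightOf r * (Context.letter a * p)).str :=
  (CCov.cplug_map (.rightOf_symm r)
    ((CCov.cplug_map (.letterOf_symm a) (.refl _)).trans (.mul _ _))).trans (.mul _ _)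

theorem Context.isImmediatePiece_leftOf_tree (a : A) (l : Forest A) (p : Context A) :
    (Context.leftOf l * p).IsImmediatePiece (Context.leftOf (Forest.tree a l) * p) := by
  have h : l.IsImmediatePiece (Forest.tree a l) := by
    have := Forest.isImmediatePiece_add_cons a l 0
    rwa [add_zero] at this
  simpa using Context.IsImmediatePiece.left 1 p h

/-- An embedding that hits the minimum `r` must send the minimum `y` there, since otherwise the
image of `y` would lie before `r`. The covering `Q` replaces `q` by a structure in which the first
node is visible. -/
theorem CEmb.exists_apply_first {q Q P : CStr A} (h : CEmb q P) (r : P)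
    (hr : ∀ z, ¬ P.lex z r) (hz : ∀ f : q → P, IsCEmb f → ∃ z, f z = r) (hQ : CCov Q q) (y : Q)
    (hy : ∀ z : Q, z = y ∨ Q.lex y z) : ∃ f : Q → P, IsCEmb f ∧ f y = r := by
  obtain ⟨g, hg⟩ := hQ.emb
  obtain ⟨k, hk⟩ := hQ.emb_symm
  obtain ⟨f, hf⟩ := h
  refine ⟨f ∘ g, hf.comp hg, ?_⟩
  obtain ⟨z, hz⟩ := hz (f ∘ g ∘ k) (hf.comp (hg.comp hk))
  rcases hy (k z) with e | e
  · rw [← e]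
    exact hz
  · have := ((hf.comp hg).same.lex _ _).1 e
    simp only [Function.comp_apply] at hz this
    rw [hz] at this
    exact (hr _ this).elim

theorem treeS_first (a : A) (l : Forest A) (p : Context A) (z : cplug (treeS a l) p.str) :
    z = .inl (.inl ⟨⟩) ∨ (cplug (treeS a l) p.str).lex (.inl (.inl ⟨⟩)) z := by
  rcases z with (z | z) | z
  exacts [Or.inl rfl, Or.inr trivial, Or.inr trivial]

theorem not_lex_treeS_first (a : A) (l : Forest A) (p : Context A)
    (z : cplug (treeS a l) p.str) :
    ¬ (cplug (treeS a l) p.str).lex z (.inl (.inl ⟨⟩)) := by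
  rcases z with (z | z) | z
  exacts [id, fun h => h trivial, fun h => h trivial]

theorem letterS_first (r : Forest A) (a : A) (p : Context A)
    (z : cplug (rightS r) (cplug (letterS a) p.str)) :
    z = .inr (.inl ⟨⟩) ∨
      (cplug (rightS r) (cplug (letterS a) p.str)).lex (.inr (.inl ⟨⟩)) z := by
  rcases z with z | z | z
  exacts [Or.inr id, Or.inl rfl, Or.inr trivial]

theorem not_lex_letterS_first (r : Forest A) (a : A) (p : Context A)
    (z : cplug (rightS r) (cplug (letterS a) p.str)) :
    ¬ (cplug (rightS r) (cplug (letterS a) p.str)).lex z (.inr (.inl ⟨⟩)) := by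
  rcases z with z | z | z
  exacts [id, id, fun h => h trivial]

theorem IsEmb.inl (C : CStr A) (S : Str A) : IsEmb (S := C.toStr) (T := plug C S) Sum.inl :=
  ⟨fun _ => rfl, fun _ _ => Iff.rfl, fun _ _ => Iff.rfl⟩

/-- As for forests, by removing or matching the first node of `p`, which now is either the root of a
tree to the left of the hole or an ancestor of the hole. If `p` has neither, all its nodes come
after the hole, so the same holds for `q` and the forest case applies. -/
theorem Context.isPiece_of_cemb (n : ℕ) : ∀ {q p : Context A}, p.size = n → CEmb q.str p.str →
    q.IsPiece p := by
  induction n using Nat.strong_induction_on with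
  | _ n ih =>
  rintro q p rfl h
  rcases p.first_cases with ⟨r, rfl⟩ | ⟨a, l, p, rfl⟩ | ⟨r, a, p, rfl⟩
  · replace h := h.trans (CCov.rightOf_symm r).emb_symm
    rcases q.first_cases with ⟨r', rfl⟩ | ⟨b, l', q, rfl⟩ | ⟨r', b, q, rfl⟩
    · obtain ⟨f, hf⟩ := (CCov.rightOf_symm r').emb.trans h
      exact Context.isPiece_rightOf (Emb.isPiece ⟨f, hf.same⟩)
    · obtain ⟨f, hf⟩ := (CCov.leftOf_tree_mul b l' q).emb.trans h
      exact ((hf.bef (.inl (.inl ⟨⟩))).1 trivial).elim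
    · obtain ⟨f, hf⟩ := (CCov.rightOf_letter_mul r' b q).emb.trans h
      exact ((hf.bef (.inr (.inl ⟨⟩))).1 trivial).elim
  · replace h := h.trans (CCov.leftOf_tree_mul a l p).emb_symm
    by_cases hz : ∃ f : q.str → cplug (treeS a l) p.str, IsCEmb f ∧
        ∀ z, f z ≠ .inl (.inl ⟨⟩)
    · obtain ⟨f, hf, hz⟩ := hz
      refine Relation.ReflTransGen.tail (ih (Context.leftOf l * p).size ?_ rfl ?_)
        (Context.isImmediatePiece_leftOf_tree a l p)
      · simp [Context.size_mul]
      · refine CEmb.trans (T := cplug (leftS l) p.str) ?_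
          ((CEmb.cplug_map (CCov.leftOf l).emb_symm (.refl _)).trans (CCov.mul _ _).emb)
        have hg : IsCEmb (C := leftS l) (D := treeS a l) Sum.inr :=
          ⟨IsEmb.inr _ _, fun _ => Iff.rfl, fun _ => Iff.rfl⟩
        refine CEmb.of_range hf (IsCEmb.cplug_map hg (.id p.str)) fun x => ?_
        rcases hfx : f x with (y | y) | y
        · exact (hz x hfx).elim
        · exact ⟨.inl y, rfl⟩
        · exact ⟨.inr y, rfl⟩
    · push Not at hz
      -- Every embedding now hits the first node of `p`. Comparing `bef` and `up` at that node
      -- excludes all shapes of `q` but the one of `p`.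
      rcases q.first_cases with ⟨r', rfl⟩ | ⟨b, l', q, rfl⟩ | ⟨r', b, q, rfl⟩
      · obtain ⟨f, hf⟩ := h
        obtain ⟨z, hz⟩ := hz f hf
        have h1 := (hf.bef z).2 (by rw [hz]; exact trivial)
        rcases z with z | z
        · exact isEmptyElim (show (0 : Forest A).str from z)
        · exact h1.elim
      · obtain ⟨f, hf, hfy⟩ := h.exists_apply_first _ (not_lex_treeS_first a l p) hz
          (.leftOf_tree_mul b l' q) _ (treeS_first b l' q)
        obtain rfl : b = a := by
          have := hf.same.lab (.inl (.inl ⟨⟩))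
          rw [hfy] at this
          exact this
        refine Context.IsPiece.mul (Context.isPiece_leftOf
          (Forest.IsPiece.cons (Emb.isPiece ?_) .refl)) (ih p.size ?_ rfl ?_)
        · refine Emb.of_range (IsEmb.comp (hf.same : IsEmb f)
            ((IsEmb.inl (treeS b l') q.str.toStr).comp (IsEmb.inr (letterS b) l'.str)))
            ((IsEmb.inl (treeS b l) p.str.toStr).comp (IsEmb.inr (letterS b) l.str)) fun x => ?_
          have := (hf.same.anc (.inl (.inl ⟨⟩)) (.inl (.inr x))).1 trivial
          rw [hfy] at this
          rcases hfx : f (.inl (.inr x)) with (y | y) | y <;> rw [hfx] at this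
          · exact this.elim
          · exact ⟨y, hfx.symm⟩
          · exact this.elim
        · simp [Context.size_mul]
        · refine CEmb.of_range (hf.comp (IsCEmb.inr _ _)) (IsCEmb.inr (treeS b l) p.str)
            fun x => ?_
          have h1 := (hf.same.anc (.inl (.inl ⟨⟩)) (.inr x)).2
          have h2 := (hf.same.lex (.inl (.inl ⟨⟩)) (.inr x)).1 trivial
          rw [hfy] at h1 h2
          rcases hfx : f (.inr x) with (y | y) | y <;> rw [hfx] at h1 h2
          · exact h2.elim
          · exact (h1 trivial).elim
          · exact ⟨y, hfx.symm⟩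
      · obtain ⟨f, hf, hfy⟩ := h.exists_apply_first _ (not_lex_treeS_first a l p) hz
          (.rightOf_letter_mul r' b q) _ (letterS_first r' b q)
        have := (hf.up (.inr (.inl ⟨⟩))).1 trivial
        rw [hfy] at this
        exact this.elim
  · replace h := h.trans (CCov.rightOf_letter_mul r a p).emb_symm
    by_cases hz : ∃ f : q.str → cplug (rightS r) (cplug (letterS a) p.str), IsCEmb f ∧
        ∀ z, f z ≠ .inr (.inl ⟨⟩)
    · obtain ⟨f, hf, hz⟩ := hz
      refine Relation.ReflTransGen.tail (ih (Context.rightOf r * p).size ?_ rfl ?_)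
        (by simpa only [mul_assoc] using Context.IsImmediatePiece.path (Context.rightOf r) p a)
      · simp [Context.size_mul]
      · refine CEmb.trans (T := cplug (rightS r) p.str) ?_
          ((CEmb.cplug_map (CCov.rightOf r).emb_symm (.refl _)).trans (CCov.mul _ _).emb)
        refine CEmb.of_range hf (IsCEmb.cplug_map (.id (rightS r))
          (IsCEmb.inr (letterS a) p.str)) fun x => ?_
        rcases hfx : f x with y | y | y
        · exact ⟨.inl y, rfl⟩
        · exact (hz x hfx).elim
        · exact ⟨.inr y, rfl⟩
    · push Not at hz
      rcases q.first_cases with ⟨r', rfl⟩ | ⟨b, l', q, rfl⟩ | ⟨r', b, q, rfl⟩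
      · obtain ⟨f, hf⟩ := h
        obtain ⟨z, hz⟩ := hz f hf
        have h1 := (hf.bef z).2 (by rw [hz]; exact trivial)
        rcases z with z | z
        · exact isEmptyElim (show (0 : Forest A).str from z)
        · exact h1.elim
      · obtain ⟨f, hf, hfy⟩ := h.exists_apply_first _ (not_lex_letterS_first r a p) hz
          (.leftOf_tree_mul b l' q) _ (treeS_first b l' q)
        have := (hf.up (.inl (.inl ⟨⟩))).2 (by rw [hfy]; exact trivial)
        exact this.elim
      · obtain ⟨f, hf, hfy⟩ := h.exists_apply_first _ (not_lex_letterS_first r a p) hz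
          (.rightOf_letter_mul r' b q) _ (letterS_first r' b q)
        obtain rfl : b = a := by
          have := hf.same.lab (.inr (.inl ⟨⟩))
          rw [hfy] at this
          exact this
        refine Context.IsPiece.mul (Context.isPiece_rightOf (Emb.isPiece ?_))
          (Context.IsPiece.mul_left (ih p.size ?_ rfl ?_) _)
        · refine Emb.of_range (IsEmb.comp (hf.same : IsEmb f)
            (IsEmb.inl (rightS r') (cplug (letterS b) q.str).toStr))
            (IsEmb.inl (rightS r) (cplug (letterS b) p.str).toStr) fun x => ?_
          have h1 := (hf.same.anc (.inr (.inl ⟨⟩)) (.inl x)).2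
          have h2 := (hf.same.lex (.inr (.inl ⟨⟩)) (.inl x)).1 id
          rw [hfy] at h1 h2
          rcases hfx : f (.inl x) with y | y | y <;> rw [hfx] at h1 h2
          · exact ⟨y, hfx.symm⟩
          · exact h2.elim
          · exact (h1 trivial).elim
        · simp [Context.size_mul]
          omega
        · refine CEmb.of_range (hf.comp ((IsCEmb.inr (rightS r') _).comp (IsCEmb.inr _ _)))
            ((IsCEmb.inr (rightS r) _).comp (IsCEmb.inr (letterS b) p.str)) fun x => ?_
          have h1 := (hf.same.anc (.inr (.inl ⟨⟩)) (.inr (.inr x))).1 trivial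
          rw [hfy] at h1
          rcases hfx : f (.inr (.inr x)) with y | y | y <;> rw [hfx] at h1
          · exact h1.elim
          · exact h1.elim
          · exact ⟨y, hfx.symm⟩

theorem CEmb.isPiece {p q : Context A} (h : CEmb p.str q.str) : p.IsPiece q :=
  Context.isPiece_of_cemb _ rfl h

/-! ### Small pieces of the same type -/

section SmallPieces

variable {H : Type v} {V : Type w} [AddMonoid H] [Monoid V] [ForestAlgebra H V]
  (α : ForestAlgebraHom (Forest A) (Context A) H V)

/-- The forest is read as a binary tree whose two branches at `cons a s t` are `s` and `t`. The set
`S` collects the values met on the way down; by the last hypothesis no value repeats, so at most `n`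
values are left and the depth is at most `n`. -/
theorem Forest.size_lt_two_pow [Fintype V] [DecidableEq V] (n : ℕ) :
    ∀ (S : Finset V) (v : V) (s : Forest A), Fintype.card V ≤ S.card + n →
      (∀ (p : Context A) (r : Forest A), s = p • r → v * α.onContexts p ∉ S) →
      (∀ (p d : Context A) (r : Forest A), s = (p * d) • r → 0 < d.size →
        v * α.onContexts (p * d) ≠ v * α.onContexts p) → s.size + 1 ≤ 2 ^ n := by
  induction n with
  | zero =>
    intro S v s hS h1 _
    have : S = Finset.univ := (Finset.card_eq_iff_eq_univ S).1
      (le_antisymm (Finset.card_le_univ S) hS)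
    exact (h1 1 s (one_smul _ _).symm (this ▸ Finset.mem_univ _)).elim
  | succ n ih =>
    intro S v s hS h1 h2
    have hv : v ∉ S := by
      have := h1 1 s (one_smul _ _).symm
      rwa [map_one, mul_one] at this
    have key : ∀ (e : Context A) (r : Forest A), s = e • r → 0 < e.size →
        r.size + 1 ≤ 2 ^ n := by
      rintro e r rfl he
      refine ih (insert v S) (v * α.onContexts e) r ?_ ?_ ?_
      · rw [Finset.card_insert_of_notMem hv]
        omega
      · rintro p r rfl hp
        rw [mul_assoc, ← map_mul] at hp
        rcases Finset.mem_insert.1 hp with hp | hp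
        · refine h2 1 (e * p) r (by rw [one_mul, mul_smul]) ?_ ?_
          · rw [Context.size_mul]
            omega
          · rw [one_mul, map_one, mul_one, hp]
        · exact h1 (e * p) r (by rw [mul_smul]) hp
      · rintro p d r rfl hd hp
        refine h2 (e * p) d r (by simp only [mul_assoc, mul_smul]) hd ?_
        rwa [mul_assoc, mul_assoc, ← map_mul, ← map_mul, ← mul_assoc] at hp
    cases s with
    | nil => exact Nat.one_le_two_pow
    | cons a s t =>
      have hs := key _ s (Forest.cons_eq_inside a s t) (by simp [Context.size_mul])
      have ht := key _ t (Forest.cons_eq_after a s t) (by simp)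
      simp only [Forest.size]
      rw [pow_succ]
      omega

/-- A smallest embedded forest of the same type has no repeated value on any branch, since the part
`d` between two equal values could be cut out. -/
theorem exists_small_forest [Finite V] : ∃ k : ℕ, ∀ s : Forest A, ∃ r : Forest A,
    Emb r.str s.str ∧ r.size ≤ k ∧ α.onForests r = α.onForests s := by
  classical
  have := Fintype.ofFinite V
  refine ⟨2 ^ Fintype.card V, fun s => ?_⟩
  have hex : ∃ n, ∃ r : Forest A, r.size = n ∧ Emb r.str s.str ∧
      α.onForests r = α.onForests s := ⟨_, s, rfl, .refl _, rfl⟩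
  obtain ⟨r, hr, hrs, hα⟩ := Nat.find_spec hex
  refine ⟨r, hrs, ?_, hα⟩
  refine (Nat.le_succ _).trans (Forest.size_lt_two_pow α _ ∅ 1 r (by simp) (by simp) ?_)
  rintro p d t rfl hd he
  rw [one_mul, one_mul] at he
  have := Nat.find_min' hex ⟨p • t, rfl, (Emb.smul ?_ (.refl _)).trans hrs, ?_⟩
  · rw [← hr, Context.size_smul, Context.size_smul, Context.size_mul] at this
    omega
  · nth_rewrite 1 [← mul_one p]
    exact CEmb.mul (.refl _) (.one _)
  · rw [← hα, α.map_smul, α.map_smul, he]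

/-- The same count along the path to the hole: there are at most `n` levels, and each consists of at
most one node on the path and side forests of size at most `k`. -/
theorem Context.size_le_of_reduced [Fintype V] [DecidableEq V] (k n : ℕ) :
    ∀ (S : Finset V) (v : V) (p : Context A), Fintype.card V ≤ S.card + n →
      (∀ p₁ p₂ : Context A, p = p₁ * p₂ → v * α.onContexts p₁ ∉ S) →
      (∀ p₁ d p₂ : Context A, p = p₁ * d * p₂ → 0 < d.size →
        v * α.onContexts (p₁ * d) ≠ v * α.onContexts p₁) →
      (∀ (p₁ : Context A) (l r : Forest A) (p₂ : Context A), p = p₁ * (Context.hole l r * p₂) →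
        l.size ≤ k ∧ r.size ≤ k) →
      p.size ≤ n * (2 * k + 1) := by
  induction n with
  | zero =>
    intro S v p hS h1 _ _
    have : S = Finset.univ := (Finset.card_eq_iff_eq_univ S).1
      (le_antisymm (Finset.card_le_univ S) hS)
    exact (h1 1 p (one_mul _).symm (this ▸ Finset.mem_univ _)).elim
  | succ n ih =>
    intro S v p hS h1 h2 h3
    have hv : v ∉ S := by
      have := h1 1 p (one_mul _).symm
      rwa [map_one, mul_one] at this
    cases p with
    | hole l r =>
      obtain ⟨hl, hr⟩ := h3 1 l r 1 (by simp)
      simp only [Context.size]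
      nlinarith
    | node l a p r =>
      have hp : Context.node l a p r = Context.hole l r * (Context.letter a * p) := by
        simp [Context.letter, Context.node_mul, Context.hole_mul_node]
      obtain ⟨hl, hr⟩ := h3 1 l r _ (by rw [one_mul, hp])
      have : p.size ≤ n * (2 * k + 1) := by
        refine ih (insert v S) (v * α.onContexts (Context.hole l r * Context.letter a)) p
          ?_ ?_ ?_ ?_
        · rw [Finset.card_insert_of_notMem hv]
          omega
        · rintro p₁ p₂ rfl hp₁
          rw [mul_assoc, ← map_mul] at hp₁
          rcases Finset.mem_insert.1 hp₁ with hp₁ | hp₁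
          · refine h2 1 (Context.hole l r * Context.letter a * p₁) p₂ ?_ ?_
              (by rwa [one_mul, map_one, mul_one])
            · rw [one_mul, hp]
              simp only [mul_assoc]
            · rw [Context.size_mul, Context.size_mul, Context.size_letter]
              omega
          · refine h1 _ p₂ ?_ hp₁
            rw [hp]
            simp only [mul_assoc]
        · rintro p₁ d p₂ rfl hd he
          refine h2 (Context.hole l r * Context.letter a * p₁) d p₂ ?_ hd ?_
          · rw [hp]
            simp only [mul_assoc]
          · simpa only [mul_assoc, ← map_mul] using he
        · rintro p₁ l' r' p₂ rfl
          refine h3 (Context.hole l r * Context.letter a * p₁) l' r' p₂ ?_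
          rw [hp]
          simp only [mul_assoc]
      simp only [Context.size]
      nlinarith

theorem CEmb.hole {l r l' r' : Forest A} (hl : Emb l.str l'.str) (hr : Emb r.str r'.str) :
    CEmb (Context.hole l r).str (Context.hole l' r').str := by
  rw [Context.hole_eq, Context.hole_eq]
  exact CEmb.mul (CEmb.leftOf hl) (CEmb.rightOf hr)

theorem exists_small_context [Finite V] : ∃ k : ℕ, ∀ p : Context A, ∃ q : Context A,
    CEmb q.str p.str ∧ q.size ≤ k ∧ α.onContexts q = α.onContexts p := by
  classical
  have := Fintype.ofFinite V
  obtain ⟨k, hk⟩ := exists_small_forest α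
  refine ⟨Fintype.card V * (2 * k + 1), fun p => ?_⟩
  have hex : ∃ n, ∃ q : Context A, q.size = n ∧ CEmb q.str p.str ∧
      α.onContexts q = α.onContexts p := ⟨_, p, rfl, .refl _, rfl⟩
  obtain ⟨q, hq, hqp, hα⟩ := Nat.find_spec hex
  refine ⟨q, hqp, ?_, hα⟩
  refine Context.size_le_of_reduced α k _ ∅ 1 q (by simp) (by simp) ?_ ?_
  · rintro p₁ d p₂ rfl hd he
    rw [one_mul, one_mul] at he
    have := Nat.find_min' hex ⟨p₁ * p₂, rfl, (CEmb.mul ?_ (.refl _)).trans hqp, ?_⟩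
    · rw [← hq, Context.size_mul, Context.size_mul, Context.size_mul] at this
      omega
    · nth_rewrite 1 [← mul_one p₁]
      exact CEmb.mul (.refl _) (.one _)
    · rw [← hα, map_mul, map_mul, he]
  · rintro p₁ l r p₂ rfl
    obtain ⟨l', hl, hlk, hlα⟩ := hk l
    obtain ⟨r', hr, hrk, hrα⟩ := hk r
    -- Since `q` is smallest, replacing its side forests by pieces of the same type cannot reduce
    -- their total size. Shrinking one side at a time shows that each already has size at most `k`.
    have key : ∀ l₀ r₀ : Forest A, Emb l₀.str l.str → Emb r₀.str r.str →
        α.onForests l₀ = α.onForests l → α.onForests r₀ = α.onForests r →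
        l.size + r.size ≤ l₀.size + r₀.size := by
      intro l₀ r₀ hl₀ hr₀ el er
      have := Nat.find_min' hex ⟨p₁ * (Context.hole l₀ r₀ * p₂), rfl,
        (CEmb.mul (.refl _) (CEmb.mul (CEmb.hole hl₀ hr₀) (.refl _))).trans hqp, ?_⟩
      · rw [← hq] at this
        simp only [Context.size_mul, Context.size] at this
        omega
      · rw [← hα]
        simp only [map_mul, α.map_hole, el, er]
    have h1 := key l' r hl (.refl _) hlα rfl
    have h2 := key l r' (.refl _) hr rfl hrα
    omega

/-! ### The piece relation on types -/

/-- `w` and `v` are the types of two contexts over `A`, the first one a piece of the second. -/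
def PieceStep (w v : V) : Prop :=
  ∃ p q : Context A, p.IsPiece q ∧ α.onContexts p = w ∧ α.onContexts q = v

/-- The transitive closure of `PieceStep`. -/
def PieceLe : V → V → Prop := Relation.ReflTransGen (PieceStep α)

variable {α}

theorem PieceLe.refl (v : V) : PieceLe α v v := Relation.ReflTransGen.refl
theorem PieceLe.trans {v w z : V} : PieceLe α v w → PieceLe α w z → PieceLe α v z :=
  Relation.ReflTransGen.trans

theorem PieceLe.of_cemb {p q : Context A} (h : CEmb p.str q.str) :
    PieceLe α (α.onContexts p) (α.onContexts q) := .single ⟨p, q, h.isPiece, rfl, rfl⟩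

theorem PieceStep.mul_left (hα : Function.Surjective α.onContexts) {w v : V}
    (h : PieceStep α w v) (z : V) : PieceStep α (z * w) (z * v) := by
  obtain ⟨p, q, hpq, rfl, rfl⟩ := h
  obtain ⟨c, rfl⟩ := hα z
  exact ⟨c * p, c * q, hpq.mul_left c, map_mul _ _ _, map_mul _ _ _⟩

theorem PieceStep.mul_right (hα : Function.Surjective α.onContexts) {w v : V}
    (h : PieceStep α w v) (z : V) : PieceStep α (w * z) (v * z) := by
  obtain ⟨p, q, hpq, rfl, rfl⟩ := h
  obtain ⟨c, rfl⟩ := hα z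
  exact ⟨p * c, q * c, hpq.mul_right c, map_mul _ _ _, map_mul _ _ _⟩

theorem PieceLe.mul (hα : Function.Surjective α.onContexts) {w v w' v' : V}
    (h : PieceLe α w v) (h' : PieceLe α w' v') : PieceLe α (w * w') (v * v') :=
  (Relation.ReflTransGen.lift (fun x => x * w') (fun _ _ h => h.mul_right hα w') _ _ h).trans
    (Relation.ReflTransGen.lift (fun x => v * x) (fun _ _ h => h.mul_left hα v) _ _ h')

theorem PieceLe.one_le (hα : Function.Surjective α.onContexts) (v : V) : PieceLe α 1 v := by
  obtain ⟨p, rfl⟩ := hα v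
  rw [← map_one α.onContexts]
  exact .of_cemb (.one p)

/-- `PieceStep` is not known to be transitive, so the identity is carried along a chain. With `e = v
^ n` and `e * z * e = e`, the element `e * z` is idempotent and `e * w` is a piece of it. The
hypothesis gives `e * z * e * w * e * z = e * z`, and multiplying by `e` on the right turns this
into `e * w * e = e`. -/
theorem PieceLe.identity (hα : Function.Surjective α.onContexts) {n : ℕ} (hn : IsOmega V n)
    (hid : ∀ v w : V, PieceStep α w v → v ^ n * w * v ^ n = v ^ n) {v w : V}
    (h : PieceLe α w v) : v ^ n * w * v ^ n = v ^ n := by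
  have he : v ^ n * v ^ n = v ^ n := hn.2 v
  induction h using Relation.ReflTransGen.head_induction_on with
  | refl =>
    obtain ⟨p, rfl⟩ := hα v
    exact hid _ _ ⟨p, p, .refl, rfl, rfl⟩
  | @head w z h _ ih =>
    have h1 : IsIdempotentElem (v ^ n * z) := by
      rw [IsIdempotentElem, ← mul_assoc, ih]
    have h2 := hid _ _ (h.mul_left hα (v ^ n))
    rw [h1.pow_eq hn.1.ne'] at h2
    have h3 := congrArg (· * v ^ n) h2
    simp only [mul_assoc] at h3 ih
    rw [ih] at h3
    simp only [← mul_assoc] at h3 ih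
    rwa [ih] at h3

end SmallPieces

/-! ### Properties of forests forced by finitely many marked nodes -/

/-- Some `N` marked nodes of `t` force `P`: it holds for all forests `t'` with marks such that
every tuple of size `N` of `t'` has the same atomic type over the marks as some tuple of `t`. -/
def Det (N : ℕ) (t : Forest A) (P : Forest A → Prop) : Prop :=
  ∃ (ι : Type u) (_ : Finite ι) (x : ι → t.str), Nat.card ι ≤ N ∧
    ∀ (t' : Forest A) (x' : ι → t'.str), Match N x x' → P t'

theorem Det.mono {N M : ℕ} (h : N ≤ M) {t : Forest A} {P Q : Forest A → Prop}
    (hPQ : ∀ t', P t' → Q t') (hd : Det N t P) : Det M t Q := by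
  obtain ⟨ι, _, x, hι, H⟩ := hd
  exact ⟨ι, inferInstance, x, hι.trans h, fun t' x' hm => hPQ _ (H t' x' (hm.mono h))⟩

/-- The marks for the different `y` are used side by side. The extra `N` keeps the number of
universal variables at least `N`, even when `Y` is empty. -/
theorem Det.forall {Y : Type u} [Finite Y] {N : ℕ} {t : Forest A} {P : Y → Forest A → Prop}
    (h : ∀ y, Det N t (P y)) : Det (Nat.card Y * N + N) t (fun t' => ∀ y, P y t') := by
  have := Fintype.ofFinite Y
  choose ι hι x hcard H using h
  refine ⟨Σ y, ι y, inferInstance, fun i => x i.1 i.2, ?_, fun t' x' hm y => ?_⟩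
  · rw [Nat.card_sigma]
    refine (Finset.sum_le_card_nsmul _ _ N fun y _ => hcard y).trans ?_
    rw [smul_eq_mul, Finset.card_univ, ← Nat.card_eq_fintype_card]
    omega
  · exact H y t' (fun i => x' ⟨y, i⟩) ((hm.mono (Nat.le_add_left _ _)).comp fun i => ⟨y, i⟩)

theorem Det.and {N : ℕ} {t : Forest A} {P Q : Forest A → Prop} (hP : Det N t P)
    (hQ : Det N t Q) : Det (3 * N) t (fun t' => P t' ∧ Q t') := by
  have h := Det.forall (Y := ULift Bool) (P := fun b => if b.down then P else Q)
    (by rintro ⟨_ | _⟩ <;> simpa)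
  refine h.mono (by simp; omega) fun t' h => ⟨?_, ?_⟩
  · simpa using h ⟨true⟩
  · simpa using h ⟨false⟩

theorem Det.nil {N : ℕ} (hN : 1 ≤ N) {P : Forest A → Prop} (h : P 0) : Det N 0 P := by
  refine ⟨PEmpty, inferInstance, PEmpty.elim, by simp, fun t' x' hm => ?_⟩
  cases t' with
  | nil => exact h
  | cons a s t =>
    obtain ⟨y, -⟩ := hm PUnit (by simpa) (fun _ => root)
    exact isEmptyElim (y ⟨⟩)

theorem Forest.card_str (s : Forest A) : Nat.card s.str = s.size := Node.card_eq_size s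

instance Forest.finite_str (s : Forest A) : Finite s.str := Node.instFinite s

theorem Det.emb_right {N : ℕ} {s r : Forest A} (hr : r.size ≤ N) (h : Emb r.str s.str) :
    Det N s (fun t' => Emb r.str t'.str) := by
  obtain ⟨f, hf⟩ := h
  exact ⟨r.str, inferInstance, f, by rwa [Forest.card_str], fun t' x' hm =>
    ⟨x', Same.trans hf hm.same⟩⟩

/-- This is a purely universal condition, so no marks are needed. With `Det.emb_right`, which is
existential, it controls the small pieces of a forest from both sides. -/
theorem Det.emb_left {N : ℕ} (s : Forest A) :
    Det N s (fun t' => ∀ r : Forest A, r.size ≤ N → Emb r.str t'.str → Emb r.str s.str) := by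
  refine ⟨PEmpty, inferInstance, PEmpty.elim, by simp, fun t' x' hm => ?_⟩
  rintro r hr ⟨f, hf⟩
  obtain ⟨y, hy⟩ := hm r.str (by rwa [Forest.card_str]) f
  exact ⟨y, Same.trans hf (hy.symm.comp Sum.inr)⟩

/-- The first root is marked in addition. Its counterpart has no node before it, as such a node
would have to be matched by a node before the root, so it is the first root of `t'`. Being a
descendant of that root separates the two parts, hence answers to challenges in one part stay in
that part. -/
theorem Det.cons {N : ℕ} {a : A} {s t : Forest A} {P Q : Forest A → Prop} (hs : Det N s P)
    (ht : Det N t Q) : Det (2 * N + 1) (Forest.cons a s t)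
      (fun t' => ∃ s₁ t₁, t' = Forest.cons a s₁ t₁ ∧ P s₁ ∧ Q t₁) := by
  obtain ⟨ι, _, m, hι, Hs⟩ := hs
  obtain ⟨κ, _, n, hκ, Ht⟩ := ht
  refine ⟨Option (ι ⊕ κ), inferInstance,
    fun o => o.elim root (Sum.elim (inside ∘ m) (after ∘ n)), ?_, ?_⟩
  · rw [Finite.card_option, Nat.card_sum]
    omega
  intro t' x' hm
  have hmin : ∀ z, ¬ t'.str.lex z (x' none) := by
    intro z hz
    obtain ⟨y, hy⟩ := hm PUnit (by simp) (fun _ => z)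
    exact not_lex_root _ ((hy.lex (.inr ⟨⟩) (.inl none)).2 hz)
  have h0 := hm.same
  cases t' with
  | nil => exact isEmptyElim (show (0 : Forest A).str from x' none)
  | cons b s' t' =>
  have hx : x' none = root := by
    have := hmin root
    rcases hxn : x' none with _ | z | z <;> rw [hxn] at this
    · exact (this (lex_root_inside _)).elim
    · exact (this (lex_root_after _)).elim
  obtain rfl : a = b := by
    have := h0.lab none
    rw [hx] at this
    exact this
  have hm' : ∀ i, ∃ z, inside z = x' (some (.inl i)) := by
    intro i
    have := (h0.anc none (some (.inl i))).1 trivial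
    rw [hx] at this
    rcases hxn : x' (some (.inl i)) with _ | z | z <;> rw [hxn] at this
    exacts [(not_ancestor_root _ this).elim, ⟨z, rfl⟩, (not_ancestor_root_after _ this).elim]
  have hn' : ∀ i, ∃ z, after z = x' (some (.inr i)) := by
    intro i
    have h1 := (h0.anc none (some (.inr i))).2
    have h2 := (h0.lex none (some (.inr i))).1 (lex_root_after _)
    rw [hx] at h1 h2
    rcases hxn : x' (some (.inr i)) with _ | z | z <;> rw [hxn] at h1 h2
    exacts [(not_lex_root _ h2).elim, (not_ancestor_root_after _ (h1 trivial)).elim, ⟨z, rfl⟩]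
  choose m' hm' using hm'
  choose n' hn' using hn'
  refine ⟨s', t', rfl, Hs s' m' ?_, Ht t' n' ?_⟩
  · intro ρ _ hρ y'
    obtain ⟨y, hy⟩ := hm ρ (by omega) (inside ∘ y')
    have hy' : ∀ i, ∃ z, inside z = y i := by
      intro i
      have := (hy.anc (.inl none) (.inr i)).2 (by
        simp only [Sum.elim_inl, Sum.elim_inr, hx]
        trivial)
      simp only [Sum.elim_inl, Sum.elim_inr, Option.elim] at this
      rcases hxn : y i with _ | z | z <;> rw [hxn] at this
      exacts [(not_ancestor_root _ this).elim, ⟨z, rfl⟩, (not_ancestor_root_after _ this).elim]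
    choose z hz using hy'
    refine ⟨z, ?_⟩
    refine ((isEmb_inside a s t).same _).trans (Same.trans ?_ ((isEmb_inside a s' t').same _).symm)
    convert hy.comp (Sum.map (fun i => some (.inl i)) id : ι ⊕ ρ → _) using 1
    · ext (i | i)
      exacts [rfl, hz i]
    · ext (i | i)
      exacts [hm' i, rfl]
  · intro ρ _ hρ y'
    obtain ⟨y, hy⟩ := hm ρ (by omega) (after ∘ y')
    have hy' : ∀ i, ∃ z, after z = y i := by
      intro i
      have h1 := (hy.anc (.inl none) (.inr i)).1
      have h2 := (hy.lex (.inl none) (.inr i)).2 (by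
        simp only [Sum.elim_inl, Sum.elim_inr, hx]
        exact lex_root_after _)
      simp only [Sum.elim_inl, Sum.elim_inr, Option.elim, hx] at h1 h2
      rcases hxn : y i with _ | z | z <;> rw [hxn] at h1 h2
      exacts [(not_lex_root _ h2).elim, (not_ancestor_root_after _ (h1 trivial)).elim, ⟨z, rfl⟩]
    choose z hz using hy'
    refine ⟨z, ?_⟩
    refine ((isEmb_after a s t).same _).trans (Same.trans ?_ ((isEmb_after a s' t').same _).symm)
    convert hy.comp (Sum.map (fun i => some (.inr i)) id : κ ⊕ ρ → _) using 1
    · ext (i | i)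
      exacts [rfl, hz i]
    · ext (i | i)
      exacts [hn' i, rfl]

/-! ### Cutting a forest at a node -/

/-- The contexts that are left when a node is removed from a forest with its right siblings and
all their descendants. -/
inductive IsCut : Context A → Prop
  | one : IsCut 1
  | inside (a : A) (t : Forest A) {p : Context A} (h : IsCut p) :
      IsCut (Context.rightOf t * Context.letter a * p)
  | after (a : A) (s : Forest A) {p : Context A} (h : IsCut p) :
      IsCut (Context.leftOf (Forest.tree a s) * p)

theorem IsCut.mul {p q : Context A} (hp : IsCut p) (hq : IsCut q) : IsCut (p * q) := by
  induction hp with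
  | one => rwa [one_mul]
  | inside a t _ ih => rw [mul_assoc]; exact ih.inside a t
  | after a s _ ih => rw [mul_assoc]; exact ih.after a s

/-- `C` has the same shape as the cut context `p`. -/
structure CutShape (p : Context A) (C : CStr A) : Prop where
  emb : CEmb p.str C
  emb_symm : CEmb C p.str
  exists_up : ∀ c, ¬ C.bef c → ∃ y, C.up y ∧ ¬ C.anc y c

theorem CutShape.one : CutShape (1 : Context A) (1 : Context A).str :=
  ⟨.refl _, .refl _, fun c => isEmptyElim c⟩

theorem CutShape.inside {p : Context A} {C : CStr A} (h : CutShape p C) (a : A) (t : Forest A) :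
    CutShape (Context.rightOf t * Context.letter a * p)
      (cplug (rightS t) (cplug (letterS a) C)) := by
  refine ⟨?_, ?_, ?_⟩
  · rw [mul_assoc]
    exact (CCov.rightOf_letter_mul t a p).emb_symm.trans
      (CEmb.cplug_map (.refl _) (CEmb.cplug_map (.refl _) h.emb))
  · rw [mul_assoc]
    exact (CEmb.cplug_map (.refl _) (CEmb.cplug_map (.refl _) h.emb_symm)).trans
      (CCov.rightOf_letter_mul t a p).emb
  · rintro (c | c | c) hc
    · exact ⟨.inr (.inl ⟨⟩), trivial, id⟩
    · exact (hc trivial).elim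
    · obtain ⟨y, hy, hyc⟩ := h.exists_up c hc
      exact ⟨.inr (.inr y), hy, hyc⟩

theorem CutShape.after {p : Context A} {C : CStr A} (h : CutShape p C) (a : A) (s : Forest A) :
    CutShape (Context.leftOf (Forest.tree a s) * p) (cplug (treeS a s) C) := by
  refine ⟨?_, ?_, ?_⟩
  · exact (CCov.leftOf_tree_mul a s p).emb_symm.trans (CEmb.cplug_map (.refl _) h.emb)
  · exact (CEmb.cplug_map (.refl _) h.emb_symm).trans (CCov.leftOf_tree_mul a s p).emb
  · rintro (c | c) hc
    · exact (hc trivial).elim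
    · obtain ⟨y, hy, hyc⟩ := h.exists_up c hc
      exact ⟨.inr y, hy, hyc⟩

/-- The last clause tracks the nodes of the forest in the hole, so that `exists_cut` can say which
node has been cut. The explicit structure is used instead of that of the product of contexts because
its maps can be written down. -/
theorem exists_isEmb_plug_inside {C : CStr A} {S : Str A} {t₁ : Forest A} {f : plug C S → t₁.str}
    (hf : IsEmb f) (sf : f.Surjective) (a : A) (t : Forest A) :
    ∃ g : plug (cplug (rightS t) (cplug (letterS a) C)) S → (Forest.cons a t₁ t).str,
      g.Surjective ∧ IsEmb g ∧ ∀ z : S, g (.inr z) = inside (f (.inr z)) := by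
  refine ⟨Sum.elim (Sum.elim after (Sum.elim (fun _ => root) (fun c => inside (f (.inl c)))))
    (fun z => inside (f (.inr z))), ?_, ⟨?_, ?_, ?_⟩, fun _ => rfl⟩
  · rintro (_ | z | z)
    · exact ⟨.inl (.inr (.inl ⟨⟩)), rfl⟩
    · obtain ⟨y | y, rfl⟩ := sf z
      · exact ⟨.inl (.inr (.inr y)), rfl⟩
      · exact ⟨.inr y, rfl⟩
    · exact ⟨.inl (.inl z), rfl⟩
  · rintro ((i | i | i) | i)
    exacts [rfl, rfl, hf.lab (.inl i), hf.lab (.inr i)]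
  · rintro ((i | i | i) | i) ((j | j | j) | j)
    · exact Iff.rfl
    · exact iff_of_false not_false (not_ancestor_root _)
    · exact Iff.rfl
    · exact Iff.rfl
    · exact Iff.rfl
    · exact iff_of_false not_false (not_ancestor_root _)
    · exact Iff.rfl
    · exact Iff.rfl
    · exact Iff.rfl
    · exact iff_of_false not_false (not_ancestor_root _)
    · exact hf.anc (.inl i) (.inl j)
    · exact hf.anc (.inl i) (.inr j)
    · exact Iff.rfl
    · exact iff_of_false not_false (not_ancestor_root _)
    · exact hf.anc (.inr i) (.inl j)
    · exact hf.anc (.inr i) (.inr j)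
  · rintro ((i | i | i) | i) ((j | j | j) | j)
    · exact (Forest.Node.lex_after _ _).symm
    · exact iff_of_false not_false (not_lex_root _)
    · exact iff_of_false not_false (not_lex_after_inside _ _)
    · exact iff_of_false not_false (not_lex_after_inside _ _)
    · exact iff_of_true not_false (lex_root_after _)
    · exact iff_of_false not_false (not_lex_root _)
    · exact iff_of_true trivial (lex_root_inside _)
    · exact iff_of_true trivial (lex_root_inside _)
    · exact iff_of_true not_false (lex_inside_after _ _)
    · exact iff_of_false (fun h => h trivial) (not_lex_root _)
    · exact (hf.lex (.inl i) (.inl j)).trans (Forest.Node.lex_inside _ _).symm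
    · exact (hf.lex (.inl i) (.inr j)).trans (Forest.Node.lex_inside _ _).symm
    · exact iff_of_true not_false (lex_inside_after _ _)
    · exact iff_of_false (fun h => h trivial) (not_lex_root _)
    · exact (hf.lex (.inr i) (.inl j)).trans (Forest.Node.lex_inside _ _).symm
    · exact (hf.lex (.inr i) (.inr j)).trans (Forest.Node.lex_inside _ _).symm

theorem exists_isEmb_plug_after {C : CStr A} {S : Str A} {t₁ : Forest A} {f : plug C S → t₁.str}
    (hf : IsEmb f) (sf : f.Surjective) (a : A) (s : Forest A) :
    ∃ g : plug (cplug (treeS a s) C) S → (Forest.cons a s t₁).str,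
      g.Surjective ∧ IsEmb g ∧ ∀ z : S, g (.inr z) = after (f (.inr z)) := by
  refine ⟨Sum.elim (Sum.elim (Sum.elim (fun _ => root) inside) (fun c => after (f (.inl c))))
    (fun z => after (f (.inr z))), ?_, ⟨?_, ?_, ?_⟩, fun _ => rfl⟩
  · rintro (_ | z | z)
    · exact ⟨.inl (.inl (.inl ⟨⟩)), rfl⟩
    · exact ⟨.inl (.inl (.inr z)), rfl⟩
    · obtain ⟨y | y, rfl⟩ := sf z
      · exact ⟨.inl (.inr y), rfl⟩
      · exact ⟨.inr y, rfl⟩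
  · rintro (((i | i) | i) | i)
    exacts [rfl, rfl, hf.lab (.inl i), hf.lab (.inr i)]
  · rintro (((i | i) | i) | i) (((j | j) | j) | j)
    · exact iff_of_false not_false (not_ancestor_root _)
    · exact Iff.rfl
    · exact Iff.rfl
    · exact Iff.rfl
    · exact iff_of_false not_false (not_ancestor_root _)
    · exact Iff.rfl
    · exact Iff.rfl
    · exact Iff.rfl
    · exact iff_of_false not_false (not_ancestor_root _)
    · exact Iff.rfl
    · exact hf.anc (.inl i) (.inl j)
    · exact hf.anc (.inl i) (.inr j)
    · exact iff_of_false not_false (not_ancestor_root _)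
    · exact Iff.rfl
    · exact hf.anc (.inr i) (.inl j)
    · exact hf.anc (.inr i) (.inr j)
  · rintro (((i | i) | i) | i) (((j | j) | j) | j)
    · exact iff_of_false not_false (not_lex_root _)
    · exact iff_of_true trivial (lex_root_inside _)
    · exact iff_of_true trivial (lex_root_after _)
    · exact iff_of_true trivial (lex_root_after _)
    · exact iff_of_false (fun h => h trivial) (not_lex_root _)
    · exact (Forest.Node.lex_inside _ _).symm
    · exact iff_of_true trivial (lex_inside_after _ _)
    · exact iff_of_true trivial (lex_inside_after _ _)
    · exact iff_of_false (fun h => h trivial) (not_lex_root _)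
    · exact iff_of_false (fun h => h trivial) (not_lex_after_inside _ _)
    · exact (hf.lex (.inl i) (.inl j)).trans (Forest.Node.lex_after _ _).symm
    · exact (hf.lex (.inl i) (.inr j)).trans (Forest.Node.lex_after _ _).symm
    · exact iff_of_false (fun h => h trivial) (not_lex_root _)
    · exact iff_of_false (fun h => h trivial) (not_lex_after_inside _ _)
    · exact (hf.lex (.inr i) (.inl j)).trans (Forest.Node.lex_after _ _).symm
    · exact (hf.lex (.inr i) (.inr j)).trans (Forest.Node.lex_after _ _).symm

theorem plug_one_emb (S : Str A) : ∃ g : plug (1 : Context A).str S → S, g.Surjective ∧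
    IsEmb g ∧ ∀ z : S, g (.inr z) = z := by
  refine ⟨Sum.elim isEmptyElim id, fun z => ⟨.inr z, rfl⟩, ⟨?_, ?_, ?_⟩, fun _ => rfl⟩
  · rintro (i | i)
    exacts [isEmptyElim i, rfl]
  · rintro (i | i) (j | j)
    exacts [isEmptyElim i, isEmptyElim i, isEmptyElim j, Iff.rfl]
  · rintro (i | i) (j | j)
    exacts [isEmptyElim i, isEmptyElim i, isEmptyElim j, Iff.rfl]

theorem IsCut.exists_shape {p : Context A} (hp : IsCut p) (s t : Forest A) (ht : t = p • s) :
    ∃ (C : CStr A) (f : plug C s.str → t.str), CutShape p C ∧ f.Surjective ∧ IsEmb f := by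
  induction hp generalizing t with
  | one =>
    rw [one_smul] at ht
    subst ht
    obtain ⟨g, sg, hg, -⟩ := plug_one_emb t.str
    exact ⟨_, g, .one, sg, hg⟩
  | @inside a r p _ ih =>
    obtain ⟨C, f, hC, sf, hf⟩ := ih (p • s) rfl
    rw [mul_smul, ← Forest.cons_eq_inside] at ht
    subst ht
    obtain ⟨g, sg, hg, -⟩ := exists_isEmb_plug_inside hf sf a r
    exact ⟨_, g, hC.inside a r, sg, hg⟩
  | @after a r p _ ih =>
    obtain ⟨C, f, hC, sf, hf⟩ := ih (p • s) rfl
    rw [mul_smul, ← Forest.cons_eq_after] at ht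
    subst ht
    obtain ⟨g, sg, hg, -⟩ := exists_isEmb_plug_after hf sf a r
    exact ⟨_, g, hC.after a r, sg, hg⟩

/-- Every forest can be cut at every node. -/
theorem exists_cut {t : Forest A} (x : Node t) :
    ∃ (p : Context A) (b : A) (s₁ s₂ : Forest A) (C : CStr A)
      (f : plug C (Forest.cons b s₁ s₂).str → t.str), IsCut p ∧ t = p • Forest.cons b s₁ s₂ ∧
        CutShape p C ∧ f.Surjective ∧ IsEmb f ∧ f (.inr root) = x := by
  induction x with
  | @root a s t =>
    obtain ⟨g, sg, hg, e⟩ := plug_one_emb (Forest.cons a s t).str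
    exact ⟨1, a, s, t, _, g, .one, (one_smul _ _).symm, .one, sg, hg, e _⟩
  | @inside a s t x ih =>
    obtain ⟨p, b, s₁, s₂, C, f, hp, rfl, hC, sf, hf, rfl⟩ := ih
    obtain ⟨g, sg, hg, e⟩ := exists_isEmb_plug_inside hf sf a t
    exact ⟨_, b, s₁, s₂, _, g, hp.inside a t, by rw [mul_smul, ← Forest.cons_eq_inside],
      hC.inside a t, sg, hg, e _⟩
  | @after a s t x ih =>
    obtain ⟨p, b, s₁, s₂, C, f, hp, rfl, hC, sf, hf, rfl⟩ := ih
    obtain ⟨g, sg, hg, e⟩ := exists_isEmb_plug_after hf sf a s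
    exact ⟨_, b, s₁, s₂, _, g, hp.after a s, by rw [mul_smul, ← Forest.cons_eq_after],
      hC.after a s, sg, hg, e _⟩

/-! ### The region of a cut -/

theorem Forest.Node.ancestor_total {s : Forest A} {x y z : Node s} :
    Ancestor x z → Ancestor y z → x = y ∨ Ancestor x y ∨ Ancestor y x := by
  induction x with
  | root => cases y <;> cases z <;> simp
  | inside x ih =>
    cases y <;> cases z <;> simp
    exact ih
  | after x ih =>
    cases y <;> cases z <;> simp
    exact ih

/-- `y` is the parent of `x`, or `x` is a root. -/
def IsParent {s : Forest A} (x y : Node s) : Prop :=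
  ∀ w, Ancestor w x → Ancestor y x ∧ (w = y ∨ Ancestor w y)

theorem exists_isParent {s : Forest A} (x : Node s) : ∃ y, IsParent x y := by
  by_cases h : ∃ w, Ancestor w x
  · have : IsTrans (Node s) (fun a b => Ancestor b a) := ⟨fun _ _ _ h h' => ancestor_trans h' h⟩
    have : Std.Irrefl (fun a b : Node s => Ancestor b a) := ⟨fun a => ancestor_irrefl a⟩
    obtain ⟨y, hy, hmin⟩ := (Finite.wellFounded_of_trans_of_irrefl
      (fun a b : Node s => Ancestor b a)).has_min {w | Ancestor w x} h
    refine ⟨y, fun w hw => ⟨hy, ?_⟩⟩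
    rcases ancestor_total hw hy with e | e | e
    · exact Or.inl e
    · exact Or.inr e
    · exact (hmin w hw e).elim
  · exact ⟨x, fun w hw => (h ⟨w, hw⟩).elim⟩

/-- The node `z` is `x`, or a right sibling of `x`, or a descendant of one of these, where `y` is
the parent of `x`. -/
def Region {s : Forest A} (x y z : Node s) : Prop :=
  ¬ Lex z x ∧ (Ancestor y x → Ancestor y z)

/-- A node of the context that is not before the hole avoids, by `exists_up`, some ancestor of the
hole. It is then not below the parent `y`, whereas everything in the hole is. The marks on the cut
node and its parent thus separate the two parts without quantifiers. -/
theorem CutShape.region {p : Context A} {C : CStr A} (hC : CutShape p C) {t : Forest A} {b : A}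
    {s₁ s₂ : Forest A} {f : plug C (Forest.cons b s₁ s₂).str → t.str} (hf : IsEmb f)
    (sf : f.Surjective) {y : Node t} (hy : IsParent (f (.inr root)) y) :
    (∀ c, Region (f (.inr root)) y (f (.inr c))) ∧
      ∀ c, ¬ Region (f (.inr root)) y (f (.inl c)) := by
  refine ⟨fun c => ⟨fun h => ?_, fun h => ?_⟩, fun c hc => ?_⟩
  · exact not_lex_root _ ((hf.lex (.inr c) (.inr root)).2 h)
  · obtain ⟨y | y, rfl⟩ := sf y
    · exact (hf.anc (.inl y) (.inr c)).1 ((hf.anc (.inl y) (.inr root)).2 h)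
    · exact (not_ancestor_root _ ((hf.anc (.inr y) (.inr root)).2 h)).elim
  · obtain ⟨z, hz, hzc⟩ := hC.exists_up c fun h => hc.1 ((hf.lex (.inl c) (.inr root)).1 h)
    obtain ⟨h1, h2⟩ := hy (f (.inl z)) ((hf.anc (.inl z) (.inr root)).1 hz)
    refine hzc ((hf.anc (.inl z) (.inl c)).2 ?_)
    rcases h2 with h2 | h2
    · rw [h2]
      exact hc.2 h1
    · exact ancestor_trans h2 (hc.2 h1)

theorem Same.region_iff {s t : Forest A} {ι : Type*} {m : ι → s.str} {m' : ι → t.str}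
    (h : Same m m') (i j k : ι) :
    Region (m i) (m j) (m k) ↔ Region (m' i) (m' j) (m' k) :=
  and_congr (not_congr (h.lex k i)) (imp_congr (h.anc j i) (h.anc j k))

/-- `IsParent` is a universal condition in one variable, so one challenge node suffices. -/
theorem Match.isParent {N : ℕ} (hN : 1 ≤ N) {s t : Forest A} {ι : Type*} {m : ι → s.str}
    {m' : ι → t.str} (h : Match N m m') {i j : ι} (hp : IsParent (m i) (m j)) :
    IsParent (m' i) (m' j) := by
  intro w hw
  obtain ⟨z, hz⟩ := h PUnit (by simpa) (fun _ => w)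
  obtain ⟨h1, h2⟩ := hp (z ⟨⟩) ((hz.anc (.inr ⟨⟩) (.inl i)).2 hw)
  refine ⟨(h.same.anc j i).1 h1, h2.imp (fun e => ?_) fun e => ?_⟩
  · exact (hz.eq_iff (.inr ⟨⟩) (.inl j)).1 e
  · exact (hz.anc (.inr ⟨⟩) (.inl j)).1 e

instance Context.finite_str (p : Context A) : Finite p.str := by
  induction p with
  | hole l r => exact inferInstanceAs (Finite (l.str ⊕ r.str))
  | node l a p r ih => exact inferInstanceAs (Finite ((l.str ⊕ r.str) ⊕ (PUnit ⊕ p.str)))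

theorem Context.card_str (p : Context A) : Nat.card p.str = p.size := by
  induction p with
  | hole l r =>
    change Nat.card (l.str ⊕ r.str) = _
    rw [Nat.card_sum, Forest.card_str, Forest.card_str, Context.size]
  | node l a p r ih =>
    change Nat.card ((l.str ⊕ r.str) ⊕ (PUnit ⊕ p.str)) = _
    rw [Nat.card_sum, Nat.card_sum, Nat.card_sum, Forest.card_str, Forest.card_str, ih,
      Context.size]
    simp
    omega

/-- If a node is the first root of `s` in `p s`, then in every similar forest `p' s'` all small
pieces of `p'` are pieces of `p`. -/
theorem Det.smul {N : ℕ} (hN : 1 ≤ N) {p : Context A} (hp : IsCut p) {b : A} {s₁ s₂ : Forest A}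
    {P : Forest A → Prop} (h : Det N (Forest.cons b s₁ s₂) P) :
    Det (N + 2) (p • Forest.cons b s₁ s₂) (fun t' => ∃ p' s', IsCut p' ∧ t' = p' • s' ∧ P s' ∧
      ∀ q : Context A, q.size ≤ N → CEmb q.str p'.str → CEmb q.str p.str) := by
  obtain ⟨C, f, hC, sf, hf⟩ := hp.exists_shape (Forest.cons b s₁ s₂) _ rfl
  obtain ⟨ι, _, m, hι, H⟩ := h
  obtain ⟨y, hy⟩ := exists_isParent (f (.inr root))
  obtain ⟨r1, r2⟩ := hC.region hf sf hy
  -- The two additional marks are the cut node and its parent. Membership in `Region` is read off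
  -- from the atomic type over them, so answers stay on the side of the challenge.
  refine ⟨Option (Option ι), inferInstance,
    fun o => o.elim y fun o => o.elim (f (.inr root)) fun i => f (.inr (m i)), ?_, ?_⟩
  · rw [Finite.card_option, Finite.card_option]
    omega
  intro t' x' hm
  obtain ⟨p', b', s₁', s₂', C', f', hp', rfl, hC', sf', hf', hx⟩ := exists_cut (x' (some none))
  have hy' : IsParent (x' (some none)) (x' none) := hm.isParent (by omega) hy
  rw [← hx] at hy'
  obtain ⟨r1', r2'⟩ := hC'.region hf' sf' hy'
  have hreg : ∀ {κ : Type u} {z : κ → _} {z' : κ → _}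
      (_ : Same (Sum.elim (fun o : Option (Option ι) => o.elim y fun o =>
        o.elim (f (.inr root)) fun i => f (.inr (m i))) z) (Sum.elim x' z')) (k : κ),
      Region (f (.inr root)) y (z k) ↔ Region (f' (.inr root)) (x' none) (z' k) := by
    intro κ z z' hz k
    rw [hx]
    exact hz.region_iff (.inl (some none)) (.inl none) (.inr k)
  have hm' : ∀ i, ∃ c, f' (.inr c) = x' (some (some i)) := by
    intro i
    have h1 := (hm.same.region_iff (some none) none (some (some i))).1 (r1 (m i))
    obtain ⟨c | c, hc⟩ := sf' (x' (some (some i)))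
    · rw [← hc, ← hx] at h1
      exact (r2' c h1).elim
    · exact ⟨c, hc⟩
  choose m' hm' using hm'
  refine ⟨p', _, hp', rfl, H _ m' ?_, ?_⟩
  · intro κ _ hκ y'
    obtain ⟨z, hz⟩ := hm κ (by omega) (f' ∘ Sum.inr ∘ y')
    have hz' : ∀ k, ∃ c, f (.inr c) = z k := by
      intro k
      have h1 := (hreg hz k).2 (r1' _)
      obtain ⟨c | c, hc⟩ := sf (z k)
      · rw [← hc] at h1
        exact (r2 c h1).elim
      · exact ⟨c, hc⟩
    choose z' hz' using hz'
    refine ⟨z', ((hf.comp (IsEmb.inr C _)).same _).trans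
      (Same.trans ?_ ((hf'.comp (IsEmb.inr C' _)).same _).symm)⟩
    convert hz.comp (Sum.map (fun i => some (some i)) id : ι ⊕ κ → _) using 1
    · ext (i | i)
      exacts [rfl, hz' i]
    · ext (i | i)
      exacts [hm' i, rfl]
  -- The nodes of a small `q` form a challenge outside the region. Their position relative to the
  -- hole is their position relative to the marked cut node, so the answer embeds `q` into `p` as a
  -- context.
  · rintro q hq hqp
    obtain ⟨g, hg⟩ := hqp.trans hC'.emb
    refine CEmb.trans ?_ hC.emb_symm
    obtain ⟨z, hz⟩ := hm q.str (by rw [Context.card_str]; omega) (f' ∘ Sum.inl ∘ g)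
    have hz' : ∀ k, ∃ c, f (.inl c) = z k := by
      intro k
      have h1 := (hreg hz k).not.2 (r2' _)
      obtain ⟨c | c, hc⟩ := sf (z k)
      · exact ⟨c, hc⟩
      · rw [← hc] at h1
        exact (h1 (r1 c)).elim
    choose z' hz' using hz'
    refine ⟨z', ?_, fun k => ?_, fun k => ?_⟩
    · refine Same.trans ?_ ((hf.comp (IsEmb.inl C _)).same z').symm
      rw [show (f ∘ Sum.inl) ∘ z' = z from funext hz']
      exact Same.trans (hg.same.trans ((hf'.comp (IsEmb.inl C' _)).same g))
        (hz.symm.comp Sum.inr)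
    · have h1 := hz.anc (.inr k) (.inl (some none))
      have h2 := hf.anc (.inl (z' k)) (.inr root)
      have h3 := hf'.anc (.inl (g k)) (.inr root)
      rw [hz'] at h2
      rw [hx] at h3
      exact (hg.up k).trans (h3.trans (h1.symm.trans h2.symm))
    · have h1 := hz.lex (.inr k) (.inl (some none))
      have h2 := hf.lex (.inl (z' k)) (.inr root)
      have h3 := hf'.lex (.inl (g k)) (.inr root)
      rw [hz'] at h2
      rw [hx] at h3
      exact (hg.bef k).trans (h3.trans (h1.symm.trans h2.symm))

/-! ### Types forced by finitely many marked nodes -/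

section Cap

variable {H V : Type u} [AddMonoid H] [Monoid V] [ForestAlgebra H V]
  (α : ForestAlgebraHom (Forest A) (Context A) H V)

/-- Some `N` marked nodes of `t` force the type of `t` in the context `u`. -/
def Cap (N : ℕ) (u : V) (t : Forest A) : Prop :=
  Det N t (fun t' => u • α.onForests t' = u • α.onForests t)

/-- Each of the two types is a piece of the other one. -/
def PieceEq (v w : V) : Prop := PieceLe α v w ∧ PieceLe α w v

variable {α}

theorem PieceEq.refl (v : V) : PieceEq α v v := ⟨.refl v, .refl v⟩
theorem PieceEq.mul (hα : Function.Surjective α.onContexts) {v w v' w' : V}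
    (h : PieceEq α v w) (h' : PieceEq α v' w') : PieceEq α (v * v') (w * w') :=
  ⟨h.1.mul hα h'.1, h.2.mul hα h'.2⟩

theorem Cap.mono {N M : ℕ} (h : N ≤ M) {u : V} {t : Forest A} (hc : Cap α N u t) : Cap α M u t :=
  Det.mono h (fun _ => id) hc

theorem Cap.nil {N : ℕ} (hN : 1 ≤ N) (u : V) : Cap α N u 0 := Det.nil hN rfl

theorem ForestAlgebraHom.map_cons_inside (a : A) (s t : Forest A) :
    α.onForests (Forest.cons a s t) =
      α.onContexts (Context.rightOf t * Context.letter a) • α.onForests s := by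
  rw [Forest.cons_eq_inside, α.map_smul]

theorem ForestAlgebraHom.map_cons_after (a : A) (s t : Forest A) :
    α.onForests (Forest.cons a s t) =
      α.onContexts (Context.leftOf (Forest.tree a s)) • α.onForests t := by
  rw [Forest.cons_eq_after, α.map_smul]

/-- Forcing the small pieces of `t` from both sides fixes the type of `a □ + t` only up to
`PieceEq`. This is why `s` has to be forced under all equivalent `y`, whereas the context for `t` is
exact because `s` is settled first. -/
theorem exists_cap_cons [Finite V] (N : ℕ) : ∃ N' : ℕ, ∀ (u : V) (a : A) (s t : Forest A),
    (∀ y, PieceEq α y (α.onContexts (Context.rightOf t * Context.letter a)) →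
      Cap α N (u * y) s) →
    Cap α N (u * α.onContexts (Context.leftOf (Forest.tree a s))) t →
      Cap α N' u (Forest.cons a s t) := by
  obtain ⟨k, hk⟩ := exists_small_forest α
  refine ⟨2 * (Nat.card V * N + N + 3 * (3 * (N + k))) + 1, fun u a s t hs ht => ?_⟩
  have h1 : ∀ y : V, Det N s (fun s' =>
      PieceEq α y (α.onContexts (Context.rightOf t * Context.letter a)) →
        (u * y) • α.onForests s' = (u * y) • α.onForests s) := by
    intro y
    by_cases hy : PieceEq α y (α.onContexts (Context.rightOf t * Context.letter a))
    · exact Det.mono le_rfl (fun _ h _ => h) (hs y hy)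
    · exact ⟨PEmpty, inferInstance, PEmpty.elim, by simp, fun _ _ _ h => (hy h).elim⟩
  have h2 := Det.forall h1
  obtain ⟨r, hr, hrk, hrα⟩ := hk t
  have h3 := Det.and (Det.mono (Nat.le_add_right N k) (fun _ => id) ht)
    (Det.mono (by omega : _ ≤ N + k) (fun _ => id) (Det.emb_right hrk hr))
  have h4 := Det.and h3 (Det.mono (by omega : k ≤ 3 * (N + k)) (fun _ => id)
    (Det.emb_left (N := k) t))
  refine Det.mono le_rfl ?_ (Det.cons (a := a)
    (Det.mono (by omega : _ ≤ Nat.card V * N + N + 3 * (3 * (N + k))) (fun _ => id) h2)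
    (Det.mono (by omega : _ ≤ Nat.card V * N + N + 3 * (3 * (N + k))) (fun _ => id) h4))
  rintro _ ⟨s', t', rfl, hs', ⟨ht', hrt⟩, hl⟩
  have hle : ∀ {t₁ t₂ : Forest A}, Emb t₁.str t₂.str →
      PieceLe α (α.onContexts (Context.rightOf t₁ * Context.letter a))
        (α.onContexts (Context.rightOf t₂ * Context.letter a)) := fun h =>
    .of_cemb (CEmb.mul (CEmb.rightOf h) (.refl _))
  have hty : ∀ {t₁ t₂ : Forest A}, α.onForests t₁ = α.onForests t₂ →
      α.onContexts (Context.rightOf t₁ * Context.letter a) =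
        α.onContexts (Context.rightOf t₂ * Context.letter a) := by
    intro t₁ t₂ h
    have hR : ∀ t : Forest A, α.onContexts (Context.rightOf t) =
        ForestAlgebra.rightOf (α.onForests t) := fun t => α.map_rightOf t
    rw [map_mul, map_mul, hR, hR, h]
  obtain ⟨r', hr', hrk', hrα'⟩ := hk t'
  have hy : PieceEq α (α.onContexts (Context.rightOf t' * Context.letter a))
      (α.onContexts (Context.rightOf t * Context.letter a)) := by
    constructor
    · rw [← hty hrα']
      exact hle (hl r' hrk' hr')
    · rw [← hty hrα]
      exact hle hrt
  -- First `s'` is exchanged for `s` while `t'` is still beside it, then `t'` for `t` beside the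
  -- tree `a s`.
  rw [ForestAlgebraHom.map_cons_inside, ← mul_smul, hs' _ hy, mul_smul,
    ← ForestAlgebraHom.map_cons_inside, ForestAlgebraHom.map_cons_after, ← mul_smul, ht',
    mul_smul, ← ForestAlgebraHom.map_cons_after]

/-- In a similar forest `p' • s'` a small piece of `p'` of the same type is a piece of `p`, so the
type of `p'` lies in `X`. Nothing more about it is needed, since `s` has the same value under `u *
x` for all `x` in `X`. -/
theorem exists_cap_smul [Finite V] (N : ℕ) : ∃ N' : ℕ, ∀ (X : Set V) (u : V) (p : Context A)
    (b : A) (s₁ s₂ : Forest A), (∀ x ∈ X, ∀ w, PieceLe α w x → w ∈ X) → IsCut p →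
    α.onContexts p ∈ X → (∀ x ∈ X, Cap α N (u * x) (Forest.cons b s₁ s₂)) →
    (∀ x ∈ X, (u * x) • α.onForests (Forest.cons b s₁ s₂) =
      u • α.onForests (Forest.cons b s₁ s₂)) →
    Cap α N' u (p • Forest.cons b s₁ s₂) := by
  obtain ⟨k, hk⟩ := exists_small_context α
  refine ⟨Nat.card V * N + N + k + 1 + 2, fun X u p b s₁ s₂ hX hp hpX hcap heq => ?_⟩
  have h1 : ∀ y : V, Det N (Forest.cons b s₁ s₂) (fun s' => y ∈ X →
        (u * y) • α.onForests s' = (u * y) • α.onForests (Forest.cons b s₁ s₂)) := by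
    intro y
    by_cases hy : y ∈ X
    · exact Det.mono le_rfl (fun _ h _ => h) (hcap y hy)
    · exact ⟨PEmpty, inferInstance, PEmpty.elim, by simp, fun _ _ _ h => (hy h).elim⟩
  refine Det.mono le_rfl ?_ (Det.smul (by omega) hp
    (Det.mono (by omega : _ ≤ Nat.card V * N + N + k + 1) (fun _ => id) (Det.forall h1)))
  rintro _ ⟨p', s', -, rfl, hs', hq⟩
  obtain ⟨q, hqp, hqk, hqα⟩ := hk p'
  have hp' : α.onContexts p' ∈ X := by
    refine hX _ hpX _ ?_
    rw [← hqα]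
    exact .of_cemb (hq q (by omega) hqp)
  rw [α.map_smul, α.map_smul, ← mul_smul, ← mul_smul, hs' _ hp', heq _ hp', heq _ hpX]

/-! ### The induction on the sets `X` and `U` -/

/-- `X` bounds the types of the contexts that lead to parts `s` of `t` not forced by `N` nodes. -/
def Reg (α : ForestAlgebraHom (Forest A) (Context A) H V) (X U : Set V) (N : ℕ) (u : V)
    (t : Forest A) : Prop :=
  ∀ (p : Context A) (s : Forest A) (y : V), IsCut p → t = p • s → PieceEq α y (α.onContexts p) →
    (y ∈ X ∧ u * y ∈ U) ∨ Cap α N (u * y) s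

theorem Reg.smul (hα : Function.Surjective α.onContexts) {X U : Set V}
    (hX : ∀ x ∈ X, ∀ w, PieceLe α w x → w ∈ X) {N : ℕ} {u : V}
    {p : Context A} {s : Forest A} (h : Reg α X U N u (p • s)) (hp : IsCut p) {y : V}
    (hy : PieceEq α y (α.onContexts p)) : Reg α X U N (u * y) s := by
  rintro p' s' y' hp' rfl hy'
  refine (h (p * p') s' (y * y') (hp.mul hp') (by rw [mul_smul]) ?_).imp ?_ ?_
  · rw [map_mul]
    exact hy.mul hα hy'
  · rintro ⟨h1, h2⟩
    refine ⟨hX _ h1 _ ?_, by rwa [mul_assoc]⟩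
    have := PieceLe.mul hα (PieceLe.one_le hα y) (PieceLe.refl y')
    rwa [one_mul] at this
  · intro h
    rwa [mul_assoc]

theorem Reg.mem {X U : Set V} {N : ℕ} {u : V} {t : Forest A} (h : Reg α X U N u t)
    (hc : ¬ Cap α N u t) : 1 ∈ X ∧ u ∈ U := by
  have := h 1 t 1 .one (one_smul _ _).symm (by rw [map_one]; exact .refl 1)
  rw [mul_one] at this
  exact this.resolve_right hc

/-- If `t` is not forced with a large bound, `ihX` says that `Reg` fails for the elements of `X` not
above `w`. A counterexample is a cut through some `y₁` above `w` with a remainder that is still not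
forced. Cuts for the several `w` are composed, and a product is above both of its factors because
`1` is below every type. -/
theorem Reg.exists_full [Finite V] (hα : Function.Surjective α.onContexts) {X U : Set V}
    (hX : ∀ x ∈ X, ∀ w, PieceLe α w x → w ∈ X) {N : ℕ}
    (ihX : ∀ w ∈ X, ∀ N, ∃ B, ∀ u t, Reg α {x ∈ X | ¬ PieceLe α w x} U N u t → Cap α B u t)
    (W : Set V) (hW : W ⊆ X) (N' : ℕ) : ∃ B, ∀ u t, Reg α X U N u t → ¬ Cap α B u t →
      ∃ (p : Context A) (s : Forest A) (y : V), IsCut p ∧ t = p • s ∧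
        PieceEq α y (α.onContexts p) ∧ y ∈ X ∧ (∀ w ∈ W, PieceLe α w y) ∧
          ¬ Cap α N' (u * y) s := by
  induction W, W.toFinite using Set.Finite.induction_on generalizing N' with
  | empty =>
    refine ⟨max N N', fun u t h hc => ⟨1, t, 1, .one, (one_smul _ _).symm, ?_, ?_, by simp, ?_⟩⟩
    · rw [map_one]
      exact .refl 1
    · exact (h.mem fun h' => hc (h'.mono (le_max_left _ _))).1
    · rw [mul_one]
      exact fun h' => hc (h'.mono (le_max_right _ _))
  | @insert w W _ _ ih =>
    obtain ⟨B, hB⟩ := ih (fun x hx => hW (Set.mem_insert_of_mem w hx)) (max N N')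
    obtain ⟨B', hB'⟩ := ihX w (hW (Set.mem_insert w W)) (max N B)
    refine ⟨B', fun u t h hc => ?_⟩
    have h1 : ¬ Reg α {x ∈ X | ¬ PieceLe α w x} U (max N B) u t := fun h => hc (hB' u t h)
    simp only [Reg, not_forall, not_or] at h1
    obtain ⟨p₁, s₁, y₁, hp₁, rfl, hy₁, hn, hc₁⟩ := h1
    obtain ⟨hx, hu⟩ := (h p₁ s₁ y₁ hp₁ rfl hy₁).resolve_right
      fun h' => hc₁ (h'.mono (le_max_left _ _))
    have hw : PieceLe α w y₁ := by
      by_contra hcon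
      exact hn ⟨⟨hx, hcon⟩, hu⟩
    obtain ⟨p₂, s₂, y₂, hp₂, rfl, hy₂, hx₂, hW₂, hc₂⟩ := hB _ _ (h.smul hα hX hp₁ hy₁)
      fun h' => hc₁ (h'.mono (le_max_right _ _))
    rw [mul_assoc] at hc₂
    have hy : PieceEq α (y₁ * y₂) (α.onContexts (p₁ * p₂)) := by
      rw [map_mul]
      exact hy₁.mul hα hy₂
    refine ⟨p₁ * p₂, s₂, y₁ * y₂, hp₁.mul hp₂, by rw [mul_smul], hy, ?_, ?_,
      fun h' => hc₂ (h'.mono (le_max_right _ _))⟩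
    · exact ((h (p₁ * p₂) s₂ _ (hp₁.mul hp₂) (by rw [mul_smul]) hy).resolve_right
        fun h' => hc₂ (h'.mono (le_max_left _ _))).1
    · intro z hz
      rcases Set.mem_insert_iff.1 hz with rfl | hz
      · have := hw.mul hα (PieceLe.one_le hα y₂)
        rwa [mul_one] at this
      · have := PieceLe.mul hα (PieceLe.one_le hα y₁) (hW₂ z hz)
        rwa [one_mul] at this

/-- After a full cut, `ihU` for `U \ {u₀}` yields another cut that can only lead to the left context
`u₀`. The product is still full. -/
theorem Reg.exists_reach [Finite V] (hα : Function.Surjective α.onContexts) {X U : Set V}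
    (hX : ∀ x ∈ X, ∀ w, PieceLe α w x → w ∈ X) {N : ℕ}
    (ihX : ∀ w ∈ X, ∀ N, ∃ B, ∀ u t, Reg α {x ∈ X | ¬ PieceLe α w x} U N u t → Cap α B u t)
    (ihU : ∀ w ∈ U, ∀ N, ∃ B, ∀ u t, Reg α X (U \ {w}) N u t → Cap α B u t) (N' : ℕ) :
    ∃ B, ∀ u t, Reg α X U N u t → ¬ Cap α B u t → ∀ u₀ ∈ U,
      ∃ (p : Context A) (s : Forest A) (y : V), IsCut p ∧ t = p • s ∧
        PieceEq α y (α.onContexts p) ∧ y ∈ X ∧ (∀ w ∈ X, PieceLe α w y) ∧ u * y = u₀ ∧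
          ¬ Cap α N' u₀ s := by
  have h1 : ∀ u₀ : V, ∃ B, u₀ ∈ U → ∀ u t, Reg α X (U \ {u₀}) (max N N') u t → Cap α B u t := by
    intro u₀
    by_cases hu : u₀ ∈ U
    · obtain ⟨B, hB⟩ := ihU u₀ hu (max N N')
      exact ⟨B, fun _ => hB⟩
    · exact ⟨0, fun h => (hu h).elim⟩
  choose B hB using h1
  have := Fintype.ofFinite V
  obtain ⟨B₁, hB₁⟩ := Reg.exists_full hα hX ihX X subset_rfl (max N (Finset.univ.sup B))
  refine ⟨B₁, fun u t h hc u₀ hu₀ => ?_⟩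
  obtain ⟨p₁, s₁, y₁, hp₁, rfl, hy₁, hx₁, hf₁, hc₁⟩ := hB₁ u t h hc
  have h2 : ¬ Reg α X (U \ {u₀}) (max N N') (u * y₁) s₁ := fun h' => hc₁ ((hB u₀ hu₀ _ _ h').mono
    ((Finset.le_sup (Finset.mem_univ u₀)).trans (le_max_right _ _)))
  simp only [Reg, not_forall, not_or] at h2
  obtain ⟨p₂, s₂, y₂, hp₂, rfl, hy₂, hn, hc₂⟩ := h2
  have hy : PieceEq α (y₁ * y₂) (α.onContexts (p₁ * p₂)) := by
    rw [map_mul]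
    exact hy₁.mul hα hy₂
  obtain ⟨hx, hu⟩ := ((h (p₁ * p₂) s₂ _ (hp₁.mul hp₂) (by rw [mul_smul]) hy).resolve_right
    fun h' => hc₂ ((mul_assoc u y₁ y₂ ▸ h' : Cap α N (u * y₁ * y₂) s₂).mono (le_max_left _ _)))
  have hx₂ : y₂ ∈ X := by
    refine hX _ hx _ ?_
    have := PieceLe.mul hα (PieceLe.one_le hα y₁) (PieceLe.refl y₂)
    rwa [one_mul] at this
  have he : u * (y₁ * y₂) = u₀ := by
    by_contra hne
    exact hn ⟨hx₂, by rw [mul_assoc]; exact ⟨hu, hne⟩⟩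
  refine ⟨p₁ * p₂, s₂, y₁ * y₂, hp₁.mul hp₂, by rw [mul_smul], hy, hx, ?_, he, ?_⟩
  · intro w hw
    have := (hf₁ w hw).mul hα (PieceLe.one_le hα y₂)
    rwa [mul_one] at this
  · rw [← he, ← mul_assoc]
    exact fun h' => hc₂ (h'.mono (le_max_right _ _))

/-- Long parts of a forest can be left only through full contexts. -/
def Reach (α : ForestAlgebraHom (Forest A) (Context A) H V) (X U : Set V) (N N' B : ℕ) : Prop :=
  ∀ u t, Reg α X U N u t → ¬ Cap α B u t → ∀ u₀ ∈ U,
      ∃ (p : Context A) (s : Forest A) (y : V), IsCut p ∧ t = p • s ∧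
        PieceEq α y (α.onContexts p) ∧ y ∈ X ∧ (∀ w ∈ X, PieceLe α w y) ∧ u * y = u₀ ∧
          ¬ Cap α N' u₀ s

/-- `S` collects prefixes `m'` from which the present `m` is reached through a full factor. Each
round cuts off one more full context that preserves `u`; after at most `|V|` rounds `m` belongs to
`S` and is fixed by a full `d`. Closure of `X` under products stands after the choice of `B`,
because `Reach.exists_cap` obtains it from a failure at a bound that depends on `B`. -/
theorem Reach.exists_loop [Fintype V] [DecidableEq V] (hα : Function.Surjective α.onContexts)
    {X U : Set V} (hX : ∀ x ∈ X, ∀ w, PieceLe α w x → w ∈ X) {N : ℕ}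
    (hreach : ∀ N', ∃ B, Reach α X U N N' B) (k : ℕ) :
    ∃ B, (∀ x ∈ X, ∀ y ∈ X, x * y ∈ X) → ∀ S : Finset V, Fintype.card V ≤ S.card + k →
      ∀ u ∈ U, ∀ s, ∀ m ∈ X, Reg α X U N u s → ¬ Cap α B u s →
        (∀ m' ∈ S, ∃ d ∈ X, (∀ w ∈ X, PieceLe α w d) ∧ m' * d = m) →
          ∃ m' ∈ X, ∃ d ∈ X, (∀ w ∈ X, PieceLe α w d) ∧ m' * d = m' ∧
            ∃ G : H, m • α.onForests s = m' • G := by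
  induction k with
  | zero =>
    refine ⟨0, fun hmul S hS u hu s m hm _ _ h => ?_⟩
    have : S = Finset.univ := (Finset.card_eq_iff_eq_univ S).1
      (le_antisymm (Finset.card_le_univ S) hS)
    obtain ⟨d, hd, hfull, e⟩ := h m (this ▸ Finset.mem_univ m)
    exact ⟨m, hm, d, hd, hfull, e, _, rfl⟩
  | succ k ih =>
    obtain ⟨B, hB⟩ := ih
    obtain ⟨B', hB'⟩ := hreach B
    refine ⟨B', fun hmul S hS u hu s m hm hr hc h => ?_⟩
    by_cases hmS : m ∈ S
    · obtain ⟨d, hd, hfull, e⟩ := h m hmS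
      exact ⟨m, hm, d, hd, hfull, e, _, rfl⟩
    · obtain ⟨p, s, y, hp, rfl, hy, hyX, hyf, huy, hcs⟩ := hB' u s hr hc u hu
      have hpX : α.onContexts p ∈ X := hX _ hyX _ hy.2
      have hpf : ∀ w ∈ X, PieceLe α w (α.onContexts p) := fun w hw => (hyf w hw).trans hy.1
      have hr' := hr.smul hα hX hp hy
      rw [huy] at hr'
      obtain ⟨m', hm', d, hd, hdf, hm'd, G, hG⟩ := hB hmul (insert m S)
        (by rw [Finset.card_insert_of_notMem hmS]; omega) u hu s (m * α.onContexts p)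
        (hmul _ hm _ hpX) hr' hcs (by
          intro m' hm'
          rcases Finset.mem_insert.1 hm' with rfl | hm'
          · exact ⟨_, hpX, hpf, rfl⟩
          · obtain ⟨d, hd, hdf, rfl⟩ := h m' hm'
            refine ⟨d * α.onContexts p, hmul _ hd _ hpX, fun w hw => ?_, (mul_assoc _ _ _).symm⟩
            have := PieceLe.mul hα (PieceLe.one_le hα d) (hpf w hw)
            rwa [one_mul] at this)
      exact ⟨m', hm', d, hd, hdf, hm'd, G, by rw [← hG, α.map_smul, mul_smul]⟩

/-- By contradiction: a resisting `t` provides the idempotent `e`, a smallest resisting remainder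
`s`, and a factorization of the type of `s` that makes `u * x` act on it independently of `x`. -/
theorem Reach.exists_cap [Finite V] (hα : Function.Surjective α.onContexts) {n : ℕ}
    (hn : IsOmega V n) (hid : ∀ v w : V, PieceStep α w v → v ^ n * w * v ^ n = v ^ n)
    {X U : Set V} (hX : ∀ x ∈ X, ∀ w, PieceLe α w x → w ∈ X) {N : ℕ}
    (hreach : ∀ N', ∃ B, Reach α X U N N' B) :
    ∃ B, ∀ u t, Reg α X U N u t → Cap α B u t := by
  classical
  have := Fintype.ofFinite V
  obtain ⟨Bl, hBl⟩ := Reach.exists_loop hα hX hreach (Fintype.card V)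
  set Ns := max (max Bl N) 1 with hNs
  have hNsN : N ≤ Ns := (le_max_right _ _).trans (le_max_left _ _)
  have hNsB : Bl ≤ Ns := (le_max_left _ _).trans (le_max_left _ _)
  obtain ⟨N₅, hN₅⟩ := exists_cap_cons (α := α) Ns
  obtain ⟨N₆, hN₆⟩ := exists_cap_smul (α := α) N₅
  obtain ⟨B₁, hB₁⟩ := hreach Ns
  obtain ⟨B₂, hB₂⟩ := hreach B₁
  refine ⟨max B₂ (max N₆ N), fun u t h => ?_⟩
  by_contra hc
  obtain ⟨h1X, huU⟩ := h.mem fun h' => hc (h'.mono ((le_max_right _ _).trans (le_max_right _ _)))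
  obtain ⟨p₁, s₁, y₁, hp₁, rfl, hy₁, hy₁X, hy₁f, huy₁, hc₁⟩ :=
    hB₂ u t h (fun h' => hc (h'.mono (le_max_left _ _))) u huU
  have hr₁ := h.smul hα hX hp₁ hy₁
  rw [huy₁] at hr₁
  obtain ⟨p₂, s₂, y₂, hp₂, rfl, hy₂, hy₂X, hy₂f, huy₂, hc₂⟩ := hB₁ u s₁ hr₁ hc₁ u huU
  have hy₁₂ : PieceEq α (y₁ * y₂) (α.onContexts (p₁ * p₂)) := by
    rw [map_mul]
    exact hy₁.mul hα hy₂
  -- Two full cuts in a row stay in `X`. Any product of two elements of `X` is below `y₁ * y₂`, so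
  -- `X` is closed under multiplication.
  have hyX : y₁ * y₂ ∈ X := ((h (p₁ * p₂) s₂ _ (hp₁.mul hp₂) (by rw [mul_smul]) hy₁₂).resolve_right
    (by
      rw [← mul_assoc, huy₁, huy₂]
      exact fun h' => hc₂ (h'.mono hNsN))).1
  have hmul : ∀ x ∈ X, ∀ y ∈ X, x * y ∈ X := fun x hx y hy =>
    hX _ hyX _ ((hy₁f x hx).mul hα (hy₂f y hy))
  have hmul_full : ∀ x y, (∀ w ∈ X, PieceLe α w x) → ∀ w ∈ X, PieceLe α w (x * y) := by
    intro x y hx w hw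
    have := (hx w hw).mul hα (PieceLe.one_le hα y)
    rwa [mul_one] at this
  have hpow : ∀ d ∈ X, (∀ w ∈ X, PieceLe α w d) → d ^ n ∈ X ∧ (∀ w ∈ X, PieceLe α w (d ^ n)) ∧
      ∀ w ∈ X, d ^ n * w * d ^ n = d ^ n := by
    intro d hd hdf
    refine ⟨?_, ?_, fun w hw => PieceLe.identity hα hn hid (hdf w hw)⟩
    · clear * - hd h1X hmul
      induction n with
      | zero => rwa [pow_zero]
      | succ n ih => rw [pow_succ]; exact hmul _ ih _ hd
    · obtain ⟨k, rfl⟩ : ∃ k, n = k + 1 := ⟨n - 1, by have := hn.1; omega⟩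
      rw [pow_succ']
      exact hmul_full _ _ hdf
  obtain ⟨heX, hef, hexe⟩ := hpow y₁ hy₁X hy₁f
  have hue : u * y₁ ^ n = u := by
    clear * - huy₁
    induction n with
    | zero => rw [pow_zero, mul_one]
    | succ n ih => rw [pow_succ', ← mul_assoc, huy₁, ih]
  set e := y₁ ^ n with he
  -- Minimality is over all cuts with a full type in `X` and over all `x` in `X` at once, since
  -- `exists_cap_smul` needs every `u * x`.
  have hex : ∃ m, ∃ (p : Context A) (s : Forest A), s.size = m ∧ IsCut p ∧
      p₁ • p₂ • s₂ = p • s ∧ α.onContexts p ∈ X ∧ (∀ w ∈ X, PieceLe α w (α.onContexts p)) ∧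
        ∃ x ∈ X, ¬ Cap α Ns (u * x) s := by
    refine ⟨_, p₁ * p₂, s₂, rfl, hp₁.mul hp₂, by rw [mul_smul], hX _ hyX _ hy₁₂.2, ?_, 1, h1X,
      by rwa [mul_one]⟩
    exact fun w hw => (hmul_full _ _ hy₁f w hw).trans hy₁₂.1
  obtain ⟨p, s, hs, hp, ht, hpX, hpf, x₁, hx₁, hcs⟩ := Nat.find_spec hex
  rw [ht] at h hc
  have heq : ∀ x ∈ X, PieceEq α (e * x) (α.onContexts p) := fun x hx =>
    ⟨hpf _ (hmul _ heX _ hx), hmul_full _ _ hef _ hpX⟩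
  have hux : ∀ x, u * (e * x) = u * x := fun x => by rw [← mul_assoc, hue]
  have hreg : ∀ x ∈ X, Reg α X U N (u * x) s := by
    intro x hx
    have := h.smul hα hX hp (heq x hx)
    rwa [hux] at this
  -- `e * x` is equivalent to the type of `p`, so `Reg` for the whole forest can be read at `e * x *
  -- y`. As `u * e = u`, a smaller remainder not forced under `u * x * y` would contradict
  -- minimality.
  have hsmall : ∀ x ∈ X, ∀ q s' y, IsCut q → s = q • s' → s'.size < s.size →
      PieceEq α y (α.onContexts q) → Cap α Ns (u * x * y) s' := by
    rintro x hx q s' y hq rfl hlt hy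
    by_contra hcon
    have hxy : PieceEq α (e * x * y) (α.onContexts (p * q)) := by
      rw [map_mul]
      exact (heq x hx).mul hα hy
    have hxyX := ((h (p * q) s' _ (hp.mul hq) (by rw [mul_smul]) hxy).resolve_right (by
      rw [← mul_assoc, hux]
      exact fun h' => hcon (h'.mono hNsN))).1
    rw [hs] at hlt
    refine Nat.find_min hex hlt ⟨p * q, s', rfl, hp.mul hq, by rw [ht, mul_smul],
      hX _ hxyX _ hxy.2, ?_, e * x * y, hxyX, ?_⟩
    · rw [map_mul]
      exact hmul_full _ _ hpf
    · rwa [← mul_assoc, hux]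
  cases s with
  | nil => exact hcs (Cap.nil (le_max_right _ _) _)
  | cons b s₁ s₂ =>
    refine hc ((hN₆ X u p b s₁ s₂ hX hp hpX ?_ ?_).mono
      ((le_max_left _ _).trans (le_max_right _ _)))
    · intro x hx
      refine hN₅ (u * x) b s₁ s₂ (fun y hy => ?_) ?_
      · refine hsmall x hx _ s₁ y (mul_one (Context.rightOf s₂ * Context.letter b) ▸
          IsCut.one.inside b s₂) (Forest.cons_eq_inside b s₁ s₂) ?_ hy
        simp only [Forest.size]
        omega
      · refine hsmall x hx _ s₂ _ (mul_one (Context.leftOf (Forest.tree b s₁)) ▸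
          IsCut.one.after b s₁) (Forest.cons_eq_after b s₁ s₂) ?_ (.refl _)
        simp only [Forest.size]
        omega
    · obtain ⟨m, hm, d, hd, hdf, hmd, G, hG⟩ := hBl hmul ∅ (by simp) (u * x₁)
        ((hreg x₁ hx₁).mem fun h' => hcs (h'.mono hNsN)).2 _ 1 h1X (hreg x₁ hx₁)
        (fun h' => hcs (h'.mono hNsB)) (by simp)
      rw [one_smul] at hG
      obtain ⟨hfX, -, hfxf⟩ := hpow d hd hdf
      have hmf : m * d ^ n = m := by
        clear * - hmd
        induction n with
        | zero => rw [pow_zero, mul_one]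
        | succ n ih => rw [pow_succ', ← mul_assoc, hmd, ih]
      -- With `f = d ^ n`: insert `e` after `u`, replace `m` by `m * f * e * f`, and contract `e *
      -- (x * m * f) * e` to `e`.
      have key : ∀ x ∈ X, u * x * m = u * e * d ^ n := by
        intro x hx
        have h1 := hexe _ (hmul _ (hmul _ hx _ hm) _ hfX)
        have h2 := hfxf _ heX
        calc u * x * m = u * (e * x) * (m * (d ^ n * e * d ^ n)) := by rw [hux, h2, hmf]
          _ = u * (e * (x * m * d ^ n) * e) * d ^ n := by simp only [mul_assoc]
          _ = u * e * d ^ n := by rw [h1]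
      intro x hx
      rw [hG, ← mul_smul, ← mul_smul, key x hx]
      have := key 1 h1X
      rw [mul_one] at this
      rw [this]

/-- Both reductions lower `|X| + |U|`: removing all elements above `w` removes `w` itself and leaves
`X` downward closed, and the other reduction removes `w` from `U`. -/
theorem exists_cap_of_reg [Finite V] (hα : Function.Surjective α.onContexts) {n : ℕ}
    (hn : IsOmega V n) (hid : ∀ v w : V, PieceStep α w v → v ^ n * w * v ^ n = v ^ n) (k : ℕ) :
    ∀ X U : Set V, X.ncard + U.ncard = k → (∀ x ∈ X, ∀ w, PieceLe α w x → w ∈ X) → ∀ N : ℕ,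
      ∃ B, ∀ u t, Reg α X U N u t → Cap α B u t := by
  induction k using Nat.strong_induction_on with
  | _ k ih =>
    rintro X U rfl hX N
    refine Reach.exists_cap hα hn hid hX (Reg.exists_reach hα hX ?_ ?_)
    · intro w hw N
      refine ih _ ?_ _ U rfl ?_ N
      · have : {x ∈ X | ¬ PieceLe α w x}.ncard < X.ncard :=
          Set.ncard_lt_ncard ⟨Set.sep_subset _ _, fun h => (h hw).2 (.refl w)⟩ X.toFinite
        omega
      · exact fun x hx z hz => ⟨hX x hx.1 z hz, fun h => hx.2 (h.trans hz)⟩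
    · intro w hw N
      refine ih _ ?_ X _ rfl hX N
      have := Set.ncard_sdiff_singleton_lt_of_mem hw U.toFinite
      omega

theorem exists_cap_of_identity [Finite V] (hα : Function.Surjective α.onContexts) {n : ℕ}
    (hn : IsOmega V n) (hid : ∀ v w : V, PieceStep α w v → v ^ n * w * v ^ n = v ^ n) :
    ∃ B, ∀ (u : V) (t : Forest A), Cap α B u t := by
  -- For the full sets the first alternative in `Reg` always holds.
  obtain ⟨B, hB⟩ := exists_cap_of_reg hα hn hid _ Set.univ Set.univ rfl (by simp) 0
  exact ⟨B, fun u t => hB u t fun _ _ _ _ _ _ => Or.inl ⟨trivial, trivial⟩⟩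

end Cap

/-! ### Quantifier-free formulas for atomic types -/

/-- The property of tuples is defined by a quantifier-free formula. -/
def QFDefinable {n : ℕ} (P : ∀ t : Forest A, (Fin n → t.str) → Prop) : Prop :=
  ∃ φ : (forestLanguage A).BoundedFormula Empty n, φ.IsQF ∧
    ∀ (t : Forest A) (v : Fin n → t.str), φ.Realize (M := t.Node) default v ↔ P t v

theorem QFDefinable.not {n : ℕ} {P : ∀ t : Forest A, (Fin n → t.str) → Prop}
    (h : QFDefinable P) : QFDefinable fun t v => ¬ P t v := by
  obtain ⟨φ, hφ, H⟩ := h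
  exact ⟨_, hφ.not, fun t v => BoundedFormula.realize_not.trans (not_congr (H t v))⟩

theorem QFDefinable.and {n : ℕ} {P Q : ∀ t : Forest A, (Fin n → t.str) → Prop}
    (hP : QFDefinable P) (hQ : QFDefinable Q) : QFDefinable fun t v => P t v ∧ Q t v := by
  obtain ⟨φ, hφ, H⟩ := hP
  obtain ⟨ψ, hψ, H'⟩ := hQ
  exact ⟨_, hφ.inf hψ, fun t v => BoundedFormula.realize_inf.trans
    (and_congr (H t v) (H' t v))⟩

theorem QFDefinable.congr {n : ℕ} {P Q : ∀ t : Forest A, (Fin n → t.str) → Prop}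
    (hP : QFDefinable P) (h : ∀ t v, P t v ↔ Q t v) : QFDefinable Q := by
  obtain ⟨φ, hφ, H⟩ := hP
  exact ⟨φ, hφ, fun t v => (H t v).trans (h t v)⟩

theorem QFDefinable.forall {Y : Type*} [Finite Y] {n : ℕ}
    {P : Y → ∀ t : Forest A, (Fin n → t.str) → Prop} (h : ∀ y, QFDefinable (P y)) :
    QFDefinable fun t v => ∀ y, P y t v := by
  classical
  have := Fintype.ofFinite Y
  suffices H : ∀ S : Finset Y, QFDefinable fun t v => ∀ y ∈ S, P y t v from
    (H Finset.univ).congr fun t v => by simp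
  intro S
  induction S using Finset.induction_on with
  | empty =>
    refine ⟨∼⊥, BoundedFormula.IsQF.falsum.not, fun t v => ?_⟩
    exact iff_of_true (fun h => h) (by simp)
  | insert y S _ ih => exact ((h y).and ih).congr fun t v => by simp

theorem QFDefinable.exists {Y : Type*} [Finite Y] {n : ℕ}
    {P : Y → ∀ t : Forest A, (Fin n → t.str) → Prop} (h : ∀ y, QFDefinable (P y)) :
    QFDefinable fun t v => ∃ y, P y t v :=
  (QFDefinable.forall fun y => (h y).not).not.congr fun t v => by push Not; rfl

theorem QFDefinable.iff_prop {n : ℕ} {P : ∀ t : Forest A, (Fin n → t.str) → Prop}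
    (h : QFDefinable P) (q : Prop) : QFDefinable fun t v => P t v ↔ q := by
  by_cases hq : q
  · exact h.congr fun t v => by simp [hq]
  · exact h.not.congr fun t v => by simp [hq]

theorem qfDefinable_lab {n : ℕ} (i : Fin n) (a : A) :
    QFDefinable fun (t : Forest A) (v : Fin n → t.str) => t.str.lab (v i) = a := by
  refine ⟨Relations.boundedFormula (n := 1) (l := n) (L := forestLanguage A) (α := Empty)
    (ForestRelation.label a) fun _ => Term.var (Sum.inr i),
    (BoundedFormula.IsAtomic.rel _ _).isQF, fun t v => Iff.rfl⟩

theorem qfDefinable_anc {n : ℕ} (i j : Fin n) :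
    QFDefinable fun (t : Forest A) (v : Fin n → t.str) => t.str.anc (v i) (v j) := by
  refine ⟨Relations.boundedFormula (n := 2) (l := n) (L := forestLanguage A) (α := Empty)
    ForestRelation.anc ![Term.var (Sum.inr i), Term.var (Sum.inr j)],
    (BoundedFormula.IsAtomic.rel _ _).isQF, fun t v => Iff.rfl⟩

theorem qfDefinable_lex {n : ℕ} (i j : Fin n) :
    QFDefinable fun (t : Forest A) (v : Fin n → t.str) => t.str.lex (v i) (v j) := by
  refine ⟨Relations.boundedFormula (n := 2) (l := n) (L := forestLanguage A) (α := Empty)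
    ForestRelation.lex ![Term.var (Sum.inr i), Term.var (Sum.inr j)],
    (BoundedFormula.IsAtomic.rel _ _).isQF, fun t v => Iff.rfl⟩

theorem qfDefinable_atomType [Finite A] {n : ℕ} (Γ : Set (AtomType A (Fin n))) :
    QFDefinable fun (t : Forest A) (v : Fin n → t.str) => atomType v ∈ Γ := by
  have h : QFDefinable fun (t : Forest A) (v : Fin n → t.str) => ∃ τ : Γ,
      (∀ i, t.str.lab (v i) = τ.1.1 i) ∧ (∀ i j, t.str.anc (v i) (v j) ↔ τ.1.2.1 i j) ∧
        ∀ i j, t.str.lex (v i) (v j) ↔ τ.1.2.2 i j :=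
    .exists fun τ => (QFDefinable.forall fun i => qfDefinable_lab i _).and
      ((QFDefinable.forall fun i => .forall fun j => (qfDefinable_anc i j).iff_prop _).and
        (QFDefinable.forall fun i => .forall fun j => (qfDefinable_lex i j).iff_prop _))
  refine h.congr fun t v => ⟨?_, fun hv => ⟨⟨_, hv⟩, fun _ => rfl, fun _ _ => Iff.rfl,
    fun _ _ => Iff.rfl⟩⟩
  rintro ⟨τ, h1, h2, h3⟩
  convert τ.2
  refine Prod.ext (funext h1) (Prod.ext ?_ ?_)
  · exact funext fun i => funext fun j => propext (h2 i j)
  · exact funext fun i => funext fun j => propext (h3 i j)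

/-! ### `Σ₂` sentences -/

theorem exists_alls {n : ℕ} (m : ℕ) (φ : (forestLanguage A).BoundedFormula Empty (n + m))
    (hφ : φ.IsUniversal) : ∃ ψ : (forestLanguage A).BoundedFormula Empty n, ψ.IsUniversal ∧
      ∀ (t : Forest A) (v : Fin n → t.str), ψ.Realize (M := t.Node) default v ↔
        ∀ z : Fin (n + m) → t.str, (∀ i, z (Fin.castAdd m i) = v i) →
          φ.Realize (M := t.Node) default z := by
  induction m with
  | zero =>
    refine ⟨φ, hφ, fun t v => ⟨fun h z hz => ?_, fun h => h v fun _ => rfl⟩⟩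
    rwa [show z = v from funext hz]
  | succ m ih =>
    obtain ⟨ψ, hψ, H⟩ := ih φ.all hφ.all
    refine ⟨ψ, hψ, fun t v => (H t v).trans ⟨fun h z hz => ?_, fun h z hz => ?_⟩⟩
    · exact Eq.mp (congrArg (fun z => φ.Realize (M := t.Node) default z)
        (Fin.snoc_init_self (n := n + m) (α := fun _ => t.str.carrier) z))
        (BoundedFormula.realize_all.1 (h (Fin.init z) hz) (z (Fin.last _)))
    · refine BoundedFormula.realize_all.2 fun a => h _ fun i => ?_
      rw [← hz i]
      exact Fin.snoc_castSucc (n := n + m) (α := fun _ => t.str.carrier) a z (Fin.castAdd m i)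

theorem IsExistsForall.exs {n : ℕ} {φ : (forestLanguage A).BoundedFormula Empty n}
    (hφ : IsExistsForall φ) : IsExistsForall φ.exs := by
  induction n with
  | zero => exact hφ
  | succ n ih => exact ih hφ.ex

/-- The property of forests is defined by a `Σ₂` sentence. -/
def SigmaTwoDefinable (P : Forest A → Prop) : Prop :=
  ∃ φ : (forestLanguage A).Sentence, IsSigmaTwo φ ∧ ∀ t : Forest A, t.Node ⊨ φ ↔ P t

theorem sigmaTwoDefinable_false : SigmaTwoDefinable fun _ : Forest A => False :=
  ⟨⊥, .prenex (.of_isUniversal (.of_isQF .falsum)), fun _ => Iff.rfl⟩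

theorem sigmaTwoDefinable_eq_zero : SigmaTwoDefinable fun t : Forest A => t = 0 := by
  refine ⟨BoundedFormula.all ⊥, .prenex (.of_isUniversal (.all (.of_isQF .falsum))), fun t => ?_⟩
  refine BoundedFormula.realize_all.trans ⟨fun h => ?_, ?_⟩
  · cases t with
    | nil => rfl
    | cons a s t => exact (h root).elim
  · rintro rfl x
    exact isEmptyElim x

theorem SigmaTwoDefinable.or {P Q : Forest A → Prop} (hP : SigmaTwoDefinable P)
    (hQ : SigmaTwoDefinable Q) : SigmaTwoDefinable fun t => P t ∨ Q t := by
  obtain ⟨φ, hφ, H⟩ := hP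
  obtain ⟨ψ, hψ, H'⟩ := hQ
  exact ⟨_, hφ.or hψ, fun t => BoundedFormula.realize_sup.trans (or_congr (H t) (H' t))⟩

theorem SigmaTwoDefinable.congr {P Q : Forest A → Prop} (hP : SigmaTwoDefinable P)
    (h : ∀ t, P t ↔ Q t) : SigmaTwoDefinable Q := by
  obtain ⟨φ, hφ, H⟩ := hP
  exact ⟨φ, hφ, fun t => (H t).trans (h t)⟩

theorem SigmaTwoDefinable.const_and {P : Forest A → Prop} (hP : SigmaTwoDefinable P) (q : Prop) :
    SigmaTwoDefinable fun t => q ∧ P t := by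
  by_cases hq : q
  · exact hP.congr fun t => by simp [hq]
  · exact sigmaTwoDefinable_false.congr fun t => by simp [hq]

theorem SigmaTwoDefinable.exists {Y : Type*} [Finite Y] {P : Y → Forest A → Prop}
    (h : ∀ y, SigmaTwoDefinable (P y)) : SigmaTwoDefinable fun t => ∃ y, P y t := by
  classical
  have := Fintype.ofFinite Y
  suffices H : ∀ S : Finset Y, SigmaTwoDefinable fun t => ∃ y ∈ S, P y t from
    (H Finset.univ).congr fun t => by simp
  intro S
  induction S using Finset.induction_on with
  | empty => exact sigmaTwoDefinable_false.congr fun t => by simp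
  | insert y S _ ih => exact ((h y).or ih).congr fun t => by simp

theorem sigmaTwoDefinable_atomType [Finite A] (n m : ℕ) (Γ : Set (AtomType A (Fin (n + m)))) :
    SigmaTwoDefinable fun t : Forest A => ∃ v : Fin n → t.str, ∀ z : Fin (n + m) → t.str,
      (∀ i, z (Fin.castAdd m i) = v i) → atomType z ∈ Γ := by
  obtain ⟨φ, hφ, H⟩ := qfDefinable_atomType Γ
  obtain ⟨ψ, hψ, H'⟩ := exists_alls m φ (.of_isQF hφ)
  refine ⟨ψ.exs, .prenex (IsExistsForall.exs (.of_isUniversal hψ)), fun t => ?_⟩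
  refine BoundedFormula.realize_exs.trans (exists_congr fun v => ?_)
  simp only [← H]
  exact H' t v

theorem exists_extend {ι M : Type*} [Finite ι] {n : ℕ} (h : Nat.card ι ≤ n) (x : ι → M)
    [Nonempty M] : ∃ (g : ι → Fin n) (z : Fin n → M), z ∘ g = x := by
  let e : ι → Fin n := Fin.castLE h ∘ Finite.equivFin ι
  have he : e.Injective := (Fin.castLE_injective h).comp (Finite.equivFin ι).injective
  exact ⟨e, Function.extend e x fun _ => Classical.arbitrary M,
    funext fun i => he.extend_apply x _ i⟩

/-- A property of forests that is forced by a bounded number of nodes is defined by a `Σ₂`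
sentence. -/
theorem sigmaTwoDefinable_of_det [Finite A] {P : Forest A → Prop} (B : ℕ)
    (h : ∀ t, P t → Det B t P) : SigmaTwoDefinable P := by
  -- With `B` positive, a forest that has a `B`-tuple of nodes is nonempty, so shorter tuples can be
  -- padded. The empty forest gets a disjunct of its own.
  wlog hB : 1 ≤ B generalizing B
  · exact this 1 (fun t ht => (h t ht).mono (by omega) fun _ => id) le_rfl
  have key : ∀ Γ : Set (AtomType A (Fin (B + B))), SigmaTwoDefinable fun t : Forest A =>
      (∀ t' : Forest A, (∃ v : Fin B → t'.str, ∀ z : Fin (B + B) → t'.str,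
        (∀ i, z (Fin.castAdd B i) = v i) → atomType z ∈ Γ) → P t') ∧
          ∃ v : Fin B → t.str, ∀ z : Fin (B + B) → t.str,
            (∀ i, z (Fin.castAdd B i) = v i) → atomType z ∈ Γ :=
    fun Γ => (sigmaTwoDefinable_atomType B B Γ).const_and _
  refine ((sigmaTwoDefinable_eq_zero.const_and (P 0)).or (.exists key)).congr fun t => ⟨?_, ?_⟩
  · rintro (⟨h, rfl⟩ | ⟨Γ, h1, h2⟩)
    · exact h
    · exact h1 t h2
  · intro ht
    cases t with
    | nil => exact Or.inl ⟨ht, rfl⟩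
    | cons a s r =>
      refine Or.inr ?_
      obtain ⟨ι, _, x, hι, H⟩ := h _ ht
      have : Nonempty (Forest.cons a s r).str := ⟨root⟩
      obtain ⟨g, v, rfl⟩ := exists_extend hι x
      -- For this `Γ`, the set of all atomic types over the marks `v`, the sentence says that every
      -- extension of the chosen tuple looks like one of `v`, which is `Match B`. Only finitely many
      -- `Γ` exist, so the disjunction is finite.
      refine ⟨{τ | ∃ z : Fin (B + B) → (Forest.cons a s r).str,
        (∀ i, z (Fin.castAdd B i) = v i) ∧ τ = atomType z}, ?_, v, fun z hz => ⟨z, hz, rfl⟩⟩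
      rintro t' ⟨v', hv'⟩
      refine H t' (v' ∘ g) fun κ _ hκ y' => ?_
      have : Nonempty t'.str := ⟨v' ⟨0, hB⟩⟩
      obtain ⟨g', y'', rfl⟩ := exists_extend hκ y'
      obtain ⟨z, hz, e⟩ := hv' (Fin.append v' y'') fun i => Fin.append_left _ _ _
      refine ⟨z ∘ Fin.natAdd B ∘ g', ?_⟩
      convert (atomType_eq_iff.1 e).symm.comp
        (Sum.elim (Fin.castAdd B ∘ g) (Fin.natAdd B ∘ g')) using 1
      · ext (i | i)
        exacts [(hz _).symm, rfl]
      · ext (i | i)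
        exacts [(Fin.append_left v' y'' _).symm, (Fin.append_right v' y'' _).symm]

/-! ### The syntactic morphism -/

/-- The syntactic morphism. -/
def syntacticHom (L : Set (Forest A)) :
    ForestAlgebraHom (Forest A) (Context A) (ForestType L) (ContextType L) where
  onForests := (forestCon L).mk'
  onContexts := (contextCon L).mk'
  map_smul _ _ := rfl
  map_leftOf _ := rfl
  map_rightOf _ := rfl

theorem mem_iff_of_forestType_eq {L : Set (Forest A)} {s t : Forest A}
    (h : (syntacticHom L).onForests s = (syntacticHom L).onForests t) : s ∈ L ↔ t ∈ L := by
  have := Quotient.exact h (1 : Context A)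
  rwa [one_smul, one_smul] at this

section Relabel

variable {B : Type v} (c : B → A)

theorem Context.subst_letter (b : B) :
    (Context.letter b).subst (fun b => Context.letter (c b)) = Context.letter (c b) := by
  simp only [Context.letter, Context.subst, Context.one_def]
  exact (one_mul _).trans (mul_one (Context.letter (c b)))

theorem Context.subst_leftOf (d : B → Context A) (s : Forest B) :
    (Context.leftOf s).subst d = Context.leftOf (s.subst d) := rfl

theorem Context.subst_rightOf (d : B → Context A) (s : Forest B) :
    (Context.rightOf s).subst d = Context.rightOf (s.subst d) := rfl

theorem Context.IsPiece.relabel {p q : Context B} (h : p.IsPiece q) :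
    (p.subst fun b => Context.letter (c b)).IsPiece (q.subst fun b => Context.letter (c b)) := by
  have hf : ∀ s s' : Forest B, s.IsImmediatePiece s' →
      (s.subst fun b => Context.letter (c b)).IsImmediatePiece
        (s'.subst fun b => Context.letter (c b)) := by
    rintro _ _ ⟨p, a, t, rfl, rfl⟩
    exact ⟨_, c a, _, Forest.subst_smul _ p t, by
      rw [Forest.subst_smul, Context.subst_mul, Context.subst_letter]⟩
  refine Relation.ReflTransGen.lift _ ?_ _ _ h
  rintro _ _ (⟨p, q, a⟩ | ⟨p, q, h⟩ | ⟨p, q, h⟩)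
  · simpa only [Function.onFun, Context.subst_mul, Context.subst_letter] using
      Context.IsImmediatePiece.path _ _ (c a)
  · simpa only [Function.onFun, Context.subst_mul, Context.subst_leftOf] using
      Context.IsImmediatePiece.left _ _ (hf _ _ h)
  · simpa only [Function.onFun, Context.subst_mul, Context.subst_rightOf] using
      Context.IsImmediatePiece.right _ _ (hf _ _ h)

/-- The morphism of free forest algebras given by a map of alphabets. -/
def relabelHom : ForestAlgebraHom (Forest B) (Context B) (Forest A) (Context A) where
  onForests := ⟨⟨Forest.subst fun b => Context.letter (c b), rfl⟩, Forest.subst_add _⟩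
  onContexts := ⟨⟨Context.subst fun b => Context.letter (c b), rfl⟩, Context.subst_mul _⟩
  map_smul := Forest.subst_smul _
  map_leftOf _ := rfl
  map_rightOf _ := rfl

end Relabel

theorem Forest.relabel_relabel {B : Type v} (e : B ≃ A) (s : Forest A) :
    (s.subst fun a => Context.letter (e.symm a)).subst (fun b => Context.letter (e b)) = s := by
  induction s with
  | nil => rfl
  | cons a s t ihs iht =>
    rw [Forest.subst, Forest.subst_add, Forest.subst_smul, ihs, iht, Context.subst_letter,
      e.apply_symm_apply]
    simp [Context.letter, Context.node_smul, Forest.tree]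

theorem Context.relabel_relabel {B : Type v} (e : B ≃ A) (p : Context A) :
    (p.subst fun a => Context.letter (e.symm a)).subst (fun b => Context.letter (e b)) = p := by
  induction p with
  | hole l r => rw [Context.subst, Context.subst, Forest.relabel_relabel, Forest.relabel_relabel]
  | node l a p r ih =>
    rw [Context.subst, Context.subst_mul, Context.subst_mul, ih, Context.subst_letter,
      e.apply_symm_apply, Context.subst, Forest.relabel_relabel, Forest.relabel_relabel]
    simp [Context.letter, Context.node_mul, Context.hole_mul_node]

/-- `IsPieceType` asks for an alphabet in `Type`, while `A` may live in a higher universe. The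
finite alphabet is therefore renamed to some `Fin`. -/
theorem PieceStep.isPieceType [Finite A] {H : Type v} {V : Type w} [AddMonoid H] [Monoid V]
    [ForestAlgebra H V] {α : ForestAlgebraHom (Forest A) (Context A) H V} {w v : V}
    (h : PieceStep α w v) : IsPieceType H V w v := by
  obtain ⟨p, q, hpq, rfl, rfl⟩ := h
  let e := (Finite.equivFin A).symm
  refine ⟨Fin (Nat.card A), inferInstance,
    ⟨α.onForests.comp (relabelHom e).onForests, α.onContexts.comp (relabelHom e).onContexts,
      fun p h => ?_, fun g => ?_, fun g => ?_⟩, _, _, hpq.relabel e.symm, ?_, ?_⟩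
  · exact (congrArg α.onForests ((relabelHom e).map_smul p h)).trans (α.map_smul _ _)
  · exact α.map_leftOf _
  · exact α.map_rightOf _
  · exact congrArg α.onContexts (Context.relabel_relabel e p)
  · exact congrArg α.onContexts (Context.relabel_relabel e q)

/-- Forcing the type forces membership in `L` and also non-membership, so `L` and its complement
both have `Σ₂` sentences. -/
theorem deltaTwoDefinable_of_identity [Finite A] {L : Set (Forest A)} [Finite (ContextType L)]
    (h : SatisfiesDeltaTwoIdentity (ForestType L) (ContextType L)) : DeltaTwoDefinable L := by
  obtain ⟨n, hn, hid⟩ := h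
  obtain ⟨B, hB⟩ := exists_cap_of_identity (α := syntacticHom L) (contextCon L).mk'_surjective hn
    fun v w hwv => hid v w hwv.isPieceType
  have hdet : ∀ t, Det B t (fun t' => t' ∈ L ↔ t ∈ L) := fun t =>
    Det.mono le_rfl (fun t' ht' => mem_iff_of_forestType_eq (by simpa only [one_smul] using ht'))
      (hB 1 t)
  obtain ⟨φ, hφ, H⟩ := sigmaTwoDefinable_of_det (P := fun t => t ∈ L) B fun t ht =>
    Det.mono le_rfl (fun _ h => h.2 ht) (hdet t)
  obtain ⟨ψ, hψ, H'⟩ := sigmaTwoDefinable_of_det (P := fun t => t ∉ L) B fun t ht =>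
    Det.mono le_rfl (fun _ h h' => ht (h.1 h')) (hdet t)
  refine ⟨⟨φ, hφ, Set.ext fun t => (H t).symm⟩, ∼ψ, ⟨ψ, hψ, rfl⟩, Set.ext fun t => ?_⟩
  exact ⟨fun ht h => (H' t).1 h ht, fun ht => by_contra fun hn => ht ((H' t).2 hn)⟩

end ForestLogic

theorem mainTheorem1 {A : Type u} [Finite A] (L : Set (ForestLogic.Forest A)) :
    ForestLogic.DeltaTwoDefinable L ↔
      Finite (ForestLogic.ForestType L) ∧ Finite (ForestLogic.ContextType L) ∧
        ForestLogic.SatisfiesDeltaTwoIdentity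
          (ForestLogic.ForestType L) (ForestLogic.ContextType L) := by
  constructor
  · intro h
    have := h.finite_forestType
    have := ForestLogic.finite_contextType (L := L)
    exact ⟨inferInstance, inferInstance, h.identity⟩
  · rintro ⟨_, _, h⟩
    exact ForestLogic.deltaTwoDefinable_of_identity h
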